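/- **Theorem (Slepian inequality for Brown–Resnick max-stable processes).** For $i=1,2$ let $B_i(t)$, $t\in\mathbb R$, be a centered real Gaussian process with stationary increments and variance function $\sigma_i^2(t)=\operatorname{Var}(B_i(t))$, where $\sigma_i\ge 0$ and $\sigma_i(0)=0$, and put $$Z_i(t)=e^{B_i(t)-\sigma_i^2(t)/2},\qquad t\in\mathbb R.$$ Assume that $Z_i$ is separable (in the sense of Doob) and has locally bounded sample paths. Let $X_i(t)$, $t\in\mathbb R$, be the stationary Brown–Resnick max-stable process with spectral process $Z_i$, that is, a stochastically continuous, separable process with the same finite-dimensional distributions as $$t\mapsto \max_{k\ge 1}P_kZ_i^{(k)}(t),$$ where $P_1,P_2,\dots$ are the points of a Poisson point process on $(0,\infty)$ with intensity $x^{-2}\,dx$ and $Z_i^{(1)},Z_i^{(2)},\dots$ are independent copies of $Z_i$, independent of $(P_k)_{k\ge1}$. Suppose that $$\sigma_1(t)\ge\sigma_2(t)\qquad\text{for all } t\in\mathbb R .$$ Then for every compact set $K\subset\mathbb R$ $$\mathbb P\Big(\sup_{t\in K}X_1(t)>x\Big)\ \ge\ \mathbb P\Big(\sup_{t\in K}X_2(t)>x\Big)\qquad\text{for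 all } x>0 .$$ Moreover, the Pickands constants $$\mathcal H_i=\lim_{T\to\infty}\frac1T\,\mathbb E\Big[\sup_{t\in[0,T]}Z_i(t)\Big],\qquad i=1,2,$$ exist in $[0,\infty)$ and satisfy $\mathcal H_1\ge\mathcal H_2$. -/

import Mathlib

open MeasureTheory ProbabilityTheory Filter Set
open scoped ENNReal NNReal Topology

namespace BrownResnick

noncomputable section

/-- Two real-valued processes have the same finite-dimensional distributions. -/
def SameFidis {T Ω Ω' : Type*} [MeasurableSpace Ω] [MeasurableSpace Ω']
    (X : T → Ω → ℝ) (P : Measure Ω) (Y : T → Ω' → ℝ) (Q : Measure Ω') : Prop :=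
  ∀ I : Finset T, IdentDistrib (fun ω => I.restrict (X · ω)) (fun ω => I.restrict (Y · ω)) P Q

/-- The process `B` has stationary increments: the law of `(B (t + h) - B h)_t` does not depend
on `h`. -/
def HasStationaryIncrements {Ω : Type*} [MeasurableSpace Ω]
    (B : ℝ → Ω → ℝ) (P : Measure Ω) : Prop :=
  ∀ h : ℝ, SameFidis (fun t ω => B (t + h) ω - B h ω) P (fun t ω => B t ω - B 0 ω) P

/-- Separability in the sense of Doob: there is a countable dense set `D` of times such that, off
a null set, for every `t` the point `(t, X t ω)` is a limit of points `(s, X s ω)` with `s ∈ D`. -/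
def IsSeparable {Ω : Type*} [MeasurableSpace Ω] (X : ℝ → Ω → ℝ) (P : Measure Ω) : Prop :=
  ∃ D : Set ℝ, D.Countable ∧ Dense D ∧
    ∀ᵐ ω ∂P, ∀ t : ℝ, (t, X t ω) ∈ closure ((fun s : ℝ => (s, X s ω)) '' D)

/-- Almost every sample path is bounded on every compact set. -/
def HasLocallyBoundedPaths {Ω : Type*} [MeasurableSpace Ω]
    (X : ℝ → Ω → ℝ) (P : Measure Ω) : Prop :=
  ∀ᵐ ω ∂P, ∀ K : Set ℝ, IsCompact K → Bornology.IsBounded ((X · ω) '' K)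

/-- Continuity in probability at every time. -/
def IsStochasticallyContinuous {Ω : Type*} [MeasurableSpace Ω]
    (X : ℝ → Ω → ℝ) (P : Measure Ω) : Prop :=
  ∀ t : ℝ, TendstoInMeasure P X (𝓝 t) (X t)

/-- The random counting measure `∑ₖ δ_{p k}`. -/
def countingMeasure {Ω : Type*} (p : ℕ → Ω → ℝ) (ω : Ω) : Measure ℝ :=
  Measure.sum fun k => Measure.dirac (p k ω)

/-- The points `p 0, p 1, …` form a Poisson point process with intensity measure `ν`: the number of
points in a measurable set `A` has the Poisson law with mean `ν A` (it is a.s. infinite if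
`ν A = ∞`), and the numbers of points in disjoint sets are independent. -/
structure IsPoissonPointProcess {Ω : Type*} [MeasurableSpace Ω]
    (p : ℕ → Ω → ℝ) (ν : Measure ℝ) (Q : Measure Ω) : Prop where
  measurable : ∀ k, Measurable (p k)
  hasLaw : ∀ A : Set ℝ, MeasurableSet A → ν A ≠ ∞ →
    HasLaw (fun ω => countingMeasure p ω A)
      ((poissonMeasure (ν A).toNNReal).map (Nat.cast : ℕ → ℝ≥0∞)) Q
  infinite : ∀ A : Set ℝ, MeasurableSet A → ν A = ∞ → ∀ᵐ ω ∂Q, countingMeasure p ω A = ∞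
  indep : ∀ (n : ℕ) (A : Fin n → Set ℝ), (∀ i, MeasurableSet (A i)) →
    Pairwise (Function.onFun Disjoint A) → iIndepFun (fun i ω => countingMeasure p ω (A i)) Q

/-- The measure `x⁻² dx` on `(0, ∞)`. -/
def frechetIntensity : Measure ℝ :=
  (volume.restrict (Ioi (0 : ℝ))).withDensity fun x => ENNReal.ofReal (1 / x ^ 2)

/-- `p` is a Poisson point process with intensity `x⁻² dx` on `(0, ∞)`, independent of the processes
`Y 0, Y 1, …`, which are independent copies of `Z`. -/
structure IsDeHaanSystem {Ω Ω' : Type*} [MeasurableSpace Ω] [MeasurableSpace Ω']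
    (p : ℕ → Ω' → ℝ) (Y : ℕ → ℝ → Ω' → ℝ) (Q : Measure Ω')
    (Z : ℝ → Ω → ℝ) (μ : Measure Ω) : Prop where
  poisson : IsPoissonPointProcess p frechetIntensity Q
  measurable : ∀ k t, Measurable (Y k t)
  copies : ∀ k, SameFidis (Y k) Q Z μ
  indep_copies : iIndepFun (fun k ω => fun t => Y k t ω) Q
  indep_points : IndepFun (fun ω => fun k => p k ω) (fun ω => fun k t => Y k t ω) Q

/-- `X` is a max-stable process with spectral process `Z` (and unit Fréchet scale): it has the
finite-dimensional distributions of `t ↦ maxₖ pₖ Yₖ(t)` for some system as above. Only the joint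
law of `p` and `Y` matters and it can be realized on `(ℕ → ℝ) × (ℕ → ℝ → ℝ)`, so that it is no
restriction to take the space of the system in `Type`. For each `t` the supremum is a.s. finite
as soon as `Z t` is integrable. -/
def IsMaxStableWithSpectral {Ω Ω₀ : Type*} [MeasurableSpace Ω] [MeasurableSpace Ω₀]
    (X : ℝ → Ω₀ → ℝ) (P : Measure Ω₀) (Z : ℝ → Ω → ℝ) (μ : Measure Ω) : Prop :=
  ∃ (Ω' : Type) (_ : MeasurableSpace Ω') (Q : Measure Ω') (p : ℕ → Ω' → ℝ) (Y : ℕ → ℝ → Ω' → ℝ),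
    IsProbabilityMeasure Q ∧ IsDeHaanSystem p Y Q Z μ ∧
      SameFidis X P (fun t ω => ⨆ k, p k ω * Y k t ω) Q

/-- The standard deviation function `σ` of the process `B`. -/
def stdDev {Ω : Type*} [MeasurableSpace Ω] (B : ℝ → Ω → ℝ) (μ : Measure Ω) (t : ℝ) : ℝ :=
  Real.sqrt (variance (B t) μ)

/-- The log-normal spectral process `Z(t) = exp (B(t) - σ²(t) / 2)`. -/
def spectral {Ω : Type*} [MeasurableSpace Ω] (B : ℝ → Ω → ℝ) (μ : Measure Ω)
    (t : ℝ) (ω : Ω) : ℝ :=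
  Real.exp (B t ω - stdDev B μ t ^ 2 / 2)

/-- `X` is a stationary Brown-Resnick process: it is max-stable with spectral process
`Z(t) = exp (B(t) - σ²(t) / 2)`, where `B` is a centered Gaussian process with stationary
increments and variance function `σ²`. -/
structure IsStationaryBrownResnick {Ω Ω₀ : Type*} [MeasurableSpace Ω] [MeasurableSpace Ω₀]
    (X : ℝ → Ω₀ → ℝ) (P : Measure Ω₀) (B : ℝ → Ω → ℝ) (μ : Measure Ω) : Prop where
  gaussian : IsGaussianProcess B μ
  centered : ∀ t, ∫ ω, B t ω ∂μ = 0
  stationaryIncrements : HasStationaryIncrements B μ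
  maxStable : IsMaxStableWithSpectral X P (spectral B μ) μ

/-- `H` is the Pickands constant of the (nonnegative) spectral process `Z`:
`H = lim_{T → ∞} E[sup_{t ∈ [0, T]} Z(t)] / T`, the limit being part of the assertion. -/
def HasPickandsConstant {Ω : Type*} [MeasurableSpace Ω]
    (Z : ℝ → Ω → ℝ) (μ : Measure Ω) (H : ℝ≥0) : Prop :=
  Tendsto (fun T : ℝ => (∫⁻ ω, ⨆ t ∈ Icc (0 : ℝ) T, ENNReal.ofReal (Z t ω) ∂μ) / ENNReal.ofReal T)
    atTop (𝓝 (H : ℝ≥0∞))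

end

end BrownResnick

/-!
The spectral process enters both conclusions only through the numbers `E[max_{t ∈ I} Z t]` for
finite sets `I` of times, and these numbers increase with the variances of the increments of the
Gaussian process. For stationary increments those variances are `σ (s - t) ^ 2`, so that
`σ₂ ≤ σ₁` compares the two processes.

*Comparison* (`lintegral_iSup_exp_le`). The maximum is approximated by `ℓ^p` norms (`expNorm`) of
the log-normal vector, and the Gaussian vector is replaced little by little (Lindeberg). One small
step multiplies the norm by a weighted `p`-mean whose expectation is, up to third order, `1` plus a
nonnegative combination of the increment variances (`exists_step_le`); centering the exponentials
to mean one is what removes every other second-order term. The steps are put together by the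
convolution semigroup of log-normal perturbations (`logNormalStep_conv`). The finite sets are then
exhausted: `supMean U μ A` is the supremum of the means over the finite subsets of `A`.

*From finite sets to a compact set*. By de Haan's formula
(`IsMaxStableWithSpectral.measure_forall_le`), a consequence of the Laplace functional of a Poisson
process, `P (max_I X > x) = 1 - exp (-E[max_I Z] / x)`. This bounds `P (sup_K X > x)` from below in
terms of `supMean B μ K`. For the reverse bound separability of `X` only gives access to countable
subsets of neighbourhoods of `K`, hence one has to show that `supMean` of the `ε`-neighbourhood of
`K` decreases to `supMean` of `K` (`iInf_supMean_sumset_le`). This replaces any discussion of path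
continuity, and rests on the comparison again. The limit `b` of the mean suprema over `[-ε, ε]`
satisfies `b * b ≤ b`, since the process on a sumset dominates an independent sum of (slightly
shrunk) copies, and is therefore `1` (`iInf_supMean_Icc_le_one`). In the other direction the process
on `K + [-ε, ε]` is dominated by an independent sum of (stretched) copies on `K` and on `[-ε, ε]`
(`supMean_sumset_le`). The argument needs that the means are finite, which is Fernique's theorem
(`supMean_Icc_ne_top`), and that `σ` is continuous at `0`, which is read off the bivariate laws of
the stochastically continuous process `X` (`IsStationaryBrownResnick.tendsto_stdDev`).

*Pickands constants*. For a separable `Z` the mean of `sup_{[0, T]} Z` is `supMean B μ (Icc 0 T)`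
(`HasStationaryVariogram.lintegral_iSup_Icc`). By the comparison it is invariant under translations,
thus subadditive in `T`, and the limit exists by Fekete's lemma.
-/

namespace BrownResnick

/-! ### Taylor expansions -/

/-- Second-order Taylor expansion of `(1 + A) ^ a`, with an error that is cubic on the whole
half-line `-1 ≤ A`: near `0` this is the binomial series, away from `0` both sides are at most
quadratic. -/
lemma exists_abs_one_add_rpow_sub_le {a : ℝ} (ha : 0 < a) (ha1 : a ≤ 1) :
    ∃ C : ℝ, 0 ≤ C ∧ ∀ A : ℝ, -1 ≤ A →
      |(1 + A) ^ a - (1 + a * A + a * (a - 1) / 2 * A ^ 2)| ≤ C * |A| ^ 3 := by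
  have h := (Real.one_add_rpow_hasFPowerSeriesAt_zero (a := a)).isBigO_sub_partialSum_pow 3
  have hps : ∀ y : ℝ, (binomialSeries ℝ a).partialSum 3 y
      = 1 + a * y + a * (a - 1) / 2 * y ^ 2 := by
    intro y
    have h2 : Ring.choose a 2 = a * (a - 1) / 2 := by
      rw [Ring.choose_eq_smul]
      simp [descPochhammer_succ_left, Polynomial.smeval_sub, Polynomial.smeval_mul,
        Polynomial.smeval_one]
      ring
    simp [FormalMultilinearSeries.partialSum, Finset.sum_range_succ, binomialSeries, h2]
    ring
  simp only [hps, zero_add, Real.norm_eq_abs] at h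
  obtain ⟨C, hC⟩ := h.bound
  obtain ⟨δ, hδ, hball⟩ := Metric.eventually_nhds_iff.1 hC
  -- Far from `0` the constant `4 / δ' ^ 3` comes from `|A| ≤ |A| / δ'` and `1 ≤ |A| / δ'`.
  set δ' := min δ 1 with hδ'
  have hδp : 0 < δ' := lt_min hδ one_pos
  refine ⟨max |C| (4 / δ' ^ 3), by positivity, fun A hA => ?_⟩
  by_cases hAδ : |A| < δ'
  · have := hball (y := A) (by simpa using hAδ.trans_le (min_le_left _ _))
    simp only [Real.norm_eq_abs, abs_pow, abs_abs] at this
    refine this.trans ?_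
    gcongr
    exact (le_abs_self C).trans (le_max_left _ _)
  · push Not at hAδ
    have h1 : 0 ≤ (1 + A) ^ a := Real.rpow_nonneg (by linarith) _
    have h2 : (1 + A) ^ a ≤ 1 + |A| := by
      calc (1 + A) ^ a ≤ (1 + |A|) ^ a :=
            Real.rpow_le_rpow (by linarith) (by linarith [le_abs_self A]) ha.le
        _ ≤ (1 + |A|) ^ (1 : ℝ) :=
            Real.rpow_le_rpow_of_exponent_le (by linarith [abs_nonneg A]) ha1
        _ = 1 + |A| := Real.rpow_one _
    have hδ1 : δ' ≤ 1 := min_le_right _ _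
    set u := |A| / δ' with hu
    have hu1 : 1 ≤ u := (one_le_div hδp).2 hAδ
    have hAu : |A| ≤ u := by
      rw [hu, le_div_iff₀ hδp]; nlinarith [abs_nonneg A]
    have key : |(1 + A) ^ a - (1 + a * A + a * (a - 1) / 2 * A ^ 2)| ≤ 4 * u ^ 3 := by
      have hA2 : A ^ 2 ≤ u ^ 2 := by rw [← sq_abs]; gcongr
      have hA1 := abs_le.1 hAu
      have hu2 : u ≤ u ^ 2 := by nlinarith
      have hu3 : u ^ 2 ≤ u ^ 3 := by nlinarith
      have e1 : |a * A| ≤ u := by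
        rw [abs_mul, abs_of_pos ha]; nlinarith [abs_nonneg A]
      have e2 : 0 ≤ a * (1 - a) / 2 * A ^ 2 := by
        have : 0 ≤ 1 - a := by linarith
        positivity
      have e3 : a * (1 - a) / 2 * A ^ 2 ≤ u ^ 2 := by
        have : a * (1 - a) / 2 ≤ 1 := by nlinarith
        nlinarith [sq_nonneg A]
      have := abs_le.1 e1
      rw [abs_le]; constructor <;> nlinarith
    refine key.trans ?_
    calc 4 * u ^ 3 = 4 / δ' ^ 3 * |A| ^ 3 := by rw [hu]; field_simp
      _ ≤ _ := by gcongr; exact le_max_right _ _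

lemma abs_exp_sub_quadratic_le (u : ℝ) :
    |Real.exp u - (1 + u + u ^ 2 / 2)| ≤ |u| ^ 3 * Real.exp |u| := by
  have := Complex.norm_exp_sub_sum_le_norm_mul_exp (u : ℂ) 3
  have e : Complex.exp u - ∑ m ∈ Finset.range 3, (u : ℂ) ^ m / (m.factorial : ℂ)
      = ((Real.exp u - (1 + u + u ^ 2 / 2) : ℝ) : ℂ) := by
    simp [Finset.sum_range_succ]
  rw [e, Complex.norm_real, Complex.norm_real] at this
  simpa using this

lemma abs_exp_sub_one_le_mul (u : ℝ) : |Real.exp u - 1| ≤ |u| * Real.exp |u| := by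
  have := Complex.norm_exp_sub_sum_le_norm_mul_exp (u : ℂ) 1
  have e : Complex.exp u - ∑ m ∈ Finset.range 1, (u : ℂ) ^ m / (m.factorial : ℂ)
      = ((Real.exp u - 1 : ℝ) : ℂ) := by
    simp
  rw [e, Complex.norm_real, Complex.norm_real] at this
  simpa using this

set_option maxHeartbeats 800000 in
/-- Expansion, for small `s`, of the weighted `p`-mean of the numbers `exp (s x i - s ^ 2 d i)`.
The error is of third order in `s`, uniformly in the weights. -/
lemma exists_abs_rpow_sum_exp_sub_le {ι : Type*} [Fintype ι] {p : ℝ} (hp : 1 ≤ p) :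
    ∃ C : ℝ, 0 ≤ C ∧ ∀ (π x d : ι → ℝ) (w s : ℝ), (∀ i, 0 ≤ π i) → ∑ i, π i = 1 →
      (∀ i, |x i| ≤ w) → (∀ i, |d i| ≤ w) → 0 ≤ w → 0 ≤ s → s ≤ 1 →
      |(∑ i, π i * Real.exp (p * (s * x i - s ^ 2 * d i))) ^ (1 / p)
        - (1 + s * ∑ i, π i * x i + s ^ 2 * (-∑ i, π i * d i + p / 2 * ∑ i, π i * x i ^ 2
          + (1 - p) / 2 * (∑ i, π i * x i) ^ 2))| ≤ C * s ^ 3 * Real.exp (9 * (p * w)) := by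
  have hp0 : 0 < p := by linarith
  obtain ⟨C, hC0, hC⟩ := exists_abs_one_add_rpow_sub_le (a := 1 / p) (by positivity)
    ((div_le_one hp0).2 hp)
  refine ⟨46 + 8 * C, by positivity, fun π x d w s hπ hπ1 hx hd hw hs hs1 => ?_⟩
  -- All errors are bounded by powers of `E`, which dominates `1`, `w` and `p * w`.
  set E := Real.exp (p * w) with hE
  have hE9 : Real.exp (9 * (p * w)) = E ^ 9 := by
    rw [hE, ← Real.exp_nat_mul]; norm_num
  have hpw : p * w ≤ E := by linarith [Real.add_one_le_exp (p * w)]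
  have hpw0 : 0 ≤ p * w := by positivity
  have hwE : w ≤ E := le_trans (by nlinarith) hpw
  have hE1 : 1 ≤ E := Real.one_le_exp hpw0
  set z : ι → ℝ := fun i => p * (s * x i - s ^ 2 * d i) with hz
  -- A weighted mean is bounded by a bound on its terms.
  have mean : ∀ (f : ι → ℝ) (b : ℝ), (∀ i, |f i| ≤ b) → |∑ i, π i * f i| ≤ b := by
    intro f b hf
    calc |∑ i, π i * f i| ≤ ∑ i, |π i * f i| := Finset.abs_sum_le_sum_abs _ _
      _ ≤ ∑ i, π i * b := by
          refine Finset.sum_le_sum fun i _ => ?_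
          rw [abs_mul, abs_of_nonneg (hπ i)]
          exact mul_le_mul_of_nonneg_left (hf i) (hπ i)
      _ = b := by rw [← Finset.sum_mul, hπ1, one_mul]
  have hs2 : s ^ 2 ≤ s := by nlinarith
  have hzb : ∀ i, |z i| ≤ 2 * (s * (p * w)) := by
    intro i
    have h1 : |s * x i - s ^ 2 * d i| ≤ s * w + s * w := by
      refine (abs_sub _ _).trans (add_le_add ?_ ?_)
      · rw [abs_mul, abs_of_nonneg hs]; exact mul_le_mul_of_nonneg_left (hx i) hs
      · rw [abs_mul, abs_of_nonneg (sq_nonneg s)]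
        exact mul_le_mul hs2 (hd i) (abs_nonneg _) hs
    rw [hz]
    simp only [abs_mul, abs_of_pos hp0]
    nlinarith
  have hzb' : ∀ i, |z i| ≤ 2 * s * E := fun i => (hzb i).trans (by nlinarith)
  have hez : ∀ i, Real.exp |z i| ≤ E ^ 2 := by
    intro i
    rw [hE, ← Real.exp_nat_mul]
    refine Real.exp_le_exp.2 ((hzb i).trans ?_)
    push_cast; nlinarith
  -- The mean is `(1 + A) ^ (1 / p)` with `A` of order `s`; it is expanded to second order in `A`,
  -- and `A` and `A ^ 2` are expanded to second order in `s`.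
  set A := ∑ i, π i * Real.exp (z i) - 1 with hA
  have hAe : A = ∑ i, π i * (Real.exp (z i) - 1) := by
    simp only [mul_sub, mul_one, Finset.sum_sub_distrib, hπ1, hA]
  set m1 := ∑ i, π i * x i with hm1
  set dd := ∑ i, π i * d i with hdd
  set m2 := ∑ i, π i * x i ^ 2 with hm2
  have hm1b : |m1| ≤ w := mean x w hx
  have hddb : |dd| ≤ w := mean d w hd
  have hm2b : |m2| ≤ w ^ 2 := mean _ _ fun i => by
    rw [abs_pow]; exact pow_le_pow_left₀ (abs_nonneg _) (hx i) 2
  have hA1 : |A| ≤ 2 * s * E ^ 3 := by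
    rw [hAe]
    refine mean _ _ fun i => (abs_exp_sub_one_le_mul _).trans ?_
    calc |z i| * Real.exp |z i| ≤ 2 * s * E * E ^ 2 := by
          gcongr
          · exact hzb' i
          · exact hez i
      _ = 2 * s * E ^ 3 := by ring
  have hA2 : |A - (p * s * m1 - p * s ^ 2 * dd + p ^ 2 * s ^ 2 * m2 / 2)| ≤ 10 * s ^ 3 * E ^ 5 := by
    have e : A - (p * s * m1 - p * s ^ 2 * dd + p ^ 2 * s ^ 2 * m2 / 2)
        = ∑ i, π i * ((Real.exp (z i) - (1 + z i + z i ^ 2 / 2))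
            + p ^ 2 * (s ^ 4 * d i ^ 2 - 2 * s ^ 3 * (x i * d i)) / 2) := by
      rw [hAe, hm1, hdd, hm2]
      simp only [Finset.mul_sum, Finset.sum_div, ← Finset.sum_sub_distrib,
        ← Finset.sum_add_distrib]
      refine Finset.sum_congr rfl fun i _ => ?_
      simp only [hz]; ring
    rw [e]
    refine mean _ _ fun i => ?_
    have t1 : |Real.exp (z i) - (1 + z i + z i ^ 2 / 2)| ≤ 8 * s ^ 3 * E ^ 5 := by
      refine (abs_exp_sub_quadratic_le _).trans ?_
      calc |z i| ^ 3 * Real.exp |z i| ≤ (2 * s * E) ^ 3 * E ^ 2 := by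
            gcongr
            · exact hzb' i
            · exact hez i
        _ = 8 * s ^ 3 * E ^ 5 := by ring
    have t2 : |p ^ 2 * (s ^ 4 * d i ^ 2 - 2 * s ^ 3 * (x i * d i)) / 2| ≤ 2 * s ^ 3 * E ^ 5 := by
      have b1 : |d i ^ 2| ≤ w ^ 2 := by
        rw [abs_pow]; exact pow_le_pow_left₀ (abs_nonneg _) (hd i) 2
      have b2 : |x i * d i| ≤ w ^ 2 := by
        rw [abs_mul, sq]; exact mul_le_mul (hx i) (hd i) (abs_nonneg _) hw
      have hs4 : s ^ 4 ≤ s ^ 3 := pow_le_pow_of_le_one hs hs1 (by norm_num)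
      have b3 : |s ^ 4 * d i ^ 2 - 2 * s ^ 3 * (x i * d i)| ≤ 3 * s ^ 3 * w ^ 2 := by
        refine (abs_sub _ _).trans ?_
        rw [abs_mul, abs_mul, abs_of_nonneg (by positivity : 0 ≤ s ^ 4),
          abs_of_nonneg (by positivity : 0 ≤ 2 * s ^ 3)]
        calc s ^ 4 * |d i ^ 2| + 2 * s ^ 3 * |x i * d i| ≤ s ^ 3 * w ^ 2 + 2 * s ^ 3 * w ^ 2 := by
              gcongr
          _ = _ := by ring
      have hE25 : E ^ 2 ≤ E ^ 5 := pow_le_pow_right₀ hE1 (by norm_num)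
      rw [abs_div, abs_mul, abs_of_nonneg (sq_nonneg p), abs_two]
      calc p ^ 2 * |s ^ 4 * d i ^ 2 - 2 * s ^ 3 * (x i * d i)| / 2
          ≤ p ^ 2 * (3 * s ^ 3 * w ^ 2) / 2 := by gcongr
        _ = 3 / 2 * s ^ 3 * (p * w) ^ 2 := by ring
        _ ≤ 3 / 2 * s ^ 3 * E ^ 2 := by gcongr
        _ ≤ 2 * s ^ 3 * E ^ 5 := by gcongr; norm_num
    calc _ ≤ _ := abs_add_le _ _
      _ ≤ 8 * s ^ 3 * E ^ 5 + 2 * s ^ 3 * E ^ 5 := add_le_add t1 t2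
      _ = _ := by ring
  have hA3 : |A - p * s * m1| ≤ 12 * s ^ 2 * E ^ 5 := by
    have e : A - p * s * m1 = (A - (p * s * m1 - p * s ^ 2 * dd + p ^ 2 * s ^ 2 * m2 / 2))
        + (-(s ^ 2 * (p * dd)) + s ^ 2 * (p ^ 2 * m2) / 2) := by ring
    have q1 : |s ^ 2 * (p * dd)| ≤ s ^ 2 * E ^ 5 := by
      rw [abs_mul, abs_mul, abs_of_nonneg (sq_nonneg s), abs_of_pos hp0]
      have : p * |dd| ≤ E := le_trans (by gcongr) hpw
      gcongr
      exact this.trans (le_self_pow₀ hE1 (by norm_num))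
    have q2 : |s ^ 2 * (p ^ 2 * m2) / 2| ≤ s ^ 2 * E ^ 5 := by
      rw [abs_div, abs_mul, abs_mul, abs_of_nonneg (sq_nonneg s), abs_of_nonneg (sq_nonneg p),
        abs_two]
      have : p ^ 2 * |m2| ≤ E ^ 2 := by
        calc p ^ 2 * |m2| ≤ p ^ 2 * w ^ 2 := by gcongr
          _ = (p * w) ^ 2 := by ring
          _ ≤ E ^ 2 := by gcongr
      have h5 : E ^ 2 ≤ E ^ 5 := pow_le_pow_right₀ hE1 (by norm_num)
      have : s ^ 2 * (p ^ 2 * |m2|) ≤ s ^ 2 * E ^ 5 := by gcongr; exact this.trans h5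
      have : 0 ≤ s ^ 2 * E ^ 5 := by positivity
      linarith
    have hs3 : s ^ 3 ≤ s ^ 2 := pow_le_pow_of_le_one hs hs1 (by norm_num)
    have q3 : 10 * s ^ 3 * E ^ 5 ≤ 10 * s ^ 2 * E ^ 5 := by gcongr
    rw [e]
    have r1 := abs_le.1 q1
    have r2 := abs_le.1 q2
    have r3 := abs_le.1 hA2
    rw [abs_le]; constructor <;> linarith
  have hA4 : |A + p * s * m1| ≤ 3 * s * E ^ 3 := by
    have : |p * s * m1| ≤ s * E ^ 3 := by
      rw [abs_mul, abs_mul, abs_of_pos hp0, abs_of_nonneg hs]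
      calc p * s * |m1| ≤ p * s * w := by gcongr
        _ = s * (p * w) := by ring
        _ ≤ s * E ^ 3 := by gcongr; exact hpw.trans (le_self_pow₀ hE1 (by norm_num))
    refine (abs_add_le _ _).trans ?_
    linarith
  have hA5 : |A ^ 2 - p ^ 2 * s ^ 2 * m1 ^ 2| ≤ 36 * s ^ 3 * E ^ 8 := by
    have e : A ^ 2 - p ^ 2 * s ^ 2 * m1 ^ 2 = (A - p * s * m1) * (A + p * s * m1) := by ring
    rw [e, abs_mul]
    calc _ ≤ (12 * s ^ 2 * E ^ 5) * (3 * s * E ^ 3) := by gcongr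
      _ = _ := by ring
  have hAm : -1 ≤ A := by
    have : 0 ≤ ∑ i, π i * Real.exp (z i) :=
      Finset.sum_nonneg fun i _ => mul_nonneg (hπ i) (Real.exp_pos _).le
    rw [hA]; linarith
  have hmain := hC A hAm
  have hA6 : C * |A| ^ 3 ≤ 8 * C * s ^ 3 * E ^ 9 := by
    calc C * |A| ^ 3 ≤ C * (2 * s * E ^ 3) ^ 3 := by gcongr
      _ = _ := by ring
  have h1A : ∑ i, π i * Real.exp (z i) = 1 + A := by rw [hA]; ring
  rw [h1A, hE9]
  have e : (1 + A) ^ (1 / p) - (1 + s * m1 + s ^ 2 * (-dd + p / 2 * m2 + (1 - p) / 2 * m1 ^ 2))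
      = ((1 + A) ^ (1 / p) - (1 + 1 / p * A + 1 / p * (1 / p - 1) / 2 * A ^ 2))
        + 1 / p * (A - (p * s * m1 - p * s ^ 2 * dd + p ^ 2 * s ^ 2 * m2 / 2))
        + 1 / p * (1 / p - 1) / 2 * (A ^ 2 - p ^ 2 * s ^ 2 * m1 ^ 2) := by
    field_simp; ring
  have ha0 : 0 ≤ 1 / p := by positivity
  have ha1 : 1 / p ≤ 1 := (div_le_one hp0).2 hp
  have c1 : |1 / p * (A - (p * s * m1 - p * s ^ 2 * dd + p ^ 2 * s ^ 2 * m2 / 2))|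
      ≤ 10 * s ^ 3 * E ^ 5 := by
    rw [abs_mul, abs_of_nonneg ha0]
    exact (mul_le_of_le_one_left (abs_nonneg _) ha1).trans hA2
  have c2 : |1 / p * (1 / p - 1) / 2 * (A ^ 2 - p ^ 2 * s ^ 2 * m1 ^ 2)| ≤ 36 * s ^ 3 * E ^ 8 := by
    rw [abs_mul]
    refine (mul_le_of_le_one_left (abs_nonneg _) ?_).trans hA5
    have k0 : 0 ≤ 1 / p * (1 - 1 / p) := mul_nonneg ha0 (by linarith)
    have k1 : 1 / p * (1 - 1 / p) ≤ 1 := mul_le_one₀ ha1 (by linarith) (by linarith)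
    have k2 : 1 / p * (1 / p - 1) / 2 = -(1 / p * (1 - 1 / p)) / 2 := by ring
    rw [k2, abs_le]; constructor <;> linarith
  have h59 : E ^ 5 ≤ E ^ 9 := pow_le_pow_right₀ hE1 (by norm_num)
  have h89 : E ^ 8 ≤ E ^ 9 := pow_le_pow_right₀ hE1 (by norm_num)
  rw [e]
  calc _ ≤ 8 * C * s ^ 3 * E ^ 9 + 10 * s ^ 3 * E ^ 5 + 36 * s ^ 3 * E ^ 8 :=
        (abs_add_le _ _).trans (add_le_add ((abs_add_le _ _).trans
          (add_le_add (hmain.trans hA6) c1)) c2)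
    _ ≤ 8 * C * s ^ 3 * E ^ 9 + 10 * s ^ 3 * E ^ 9 + 36 * s ^ 3 * E ^ 9 := by gcongr
    _ = _ := by ring

/-! ### One step of the Lindeberg replacement -/

/-- A consequence of Fernique's theorem, since `c r ≤ c ^ 2 / (4 C) + C r ^ 2`. -/
lemma integrable_exp_mul_norm {E : Type*} [NormedAddCommGroup E] [NormedSpace ℝ E]
    [MeasurableSpace E] [BorelSpace E] [SecondCountableTopology E] [CompleteSpace E]
    (ρ : Measure E) [IsGaussian ρ] (c : ℝ) : Integrable (fun x => Real.exp (c * ‖x‖)) ρ := by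
  obtain ⟨C, hC, hint⟩ := IsGaussian.exists_integrable_exp_sq ρ
  refine Integrable.mono' (hint.const_mul (Real.exp (c ^ 2 / (4 * C)))) (by fun_prop)
    (ae_of_all _ fun x => ?_)
  rw [Real.norm_of_nonneg (Real.exp_pos _).le, ← Real.exp_add]
  refine Real.exp_le_exp.2 ?_
  have : c ^ 2 / (4 * C) + C * ‖x‖ ^ 2 - c * ‖x‖ = (c - 2 * C * ‖x‖) ^ 2 / (4 * C) := by
    field_simp; ring
  have h2 : 0 ≤ (c - 2 * C * ‖x‖) ^ 2 / (4 * C) := by positivity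
  linarith

section Comparison

variable {ι : Type*}

/-- The law of `s x - s ^ 2 Var x / 2` for a centered Gaussian vector `x` with law `ρ`: the logarithm
of a log-normal vector with mean `1`. The variance of `x i` is encoded as its second moment. -/
noncomputable def logNormalStep (ρ : Measure (ι → ℝ)) (s : ℝ) : Measure (ι → ℝ) :=
  ρ.map fun x i => s * x i - s ^ 2 * ((∫ y, y i ^ 2 ∂ρ) / 2)

lemma measurable_logNormalStep_map (ρ : Measure (ι → ℝ)) (s : ℝ) :
    Measurable fun (x : ι → ℝ) i => s * x i - s ^ 2 * ((∫ y, y i ^ 2 ∂ρ) / 2) := by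
  fun_prop

instance (ρ : Measure (ι → ℝ)) [IsProbabilityMeasure ρ] (s : ℝ) :
    IsProbabilityMeasure (logNormalStep ρ s) :=
  Measure.isProbabilityMeasure_map (measurable_logNormalStep_map ρ s).aemeasurable

variable (ρ : Measure (ι → ℝ)) [IsGaussian ρ]

lemma memLp_eval (i : ι) : MemLp (fun x : ι → ℝ => x i) 2 ρ :=
  (IsGaussian.hasGaussianLaw_id (μ := ρ)).eval i |>.memLp_two

lemma integrable_eval_mul_eval (i j : ι) : Integrable (fun x : ι → ℝ => x i * x j) ρ :=
  (memLp_eval ρ i).integrable_mul (memLp_eval ρ j)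

lemma integrable_eval (i : ι) : Integrable (fun x : ι → ℝ => x i) ρ :=
  (memLp_eval ρ i).integrable (by norm_num)

variable [Fintype ι]

/-- The `ℓ^p` norm of the vector `(exp (x i))`, a smooth substitute for `max exp (x i)`. -/
noncomputable def expNorm (p : ℝ) (x : ι → ℝ) : ℝ := (∑ i, Real.exp (p * x i)) ^ (1 / p)

lemma measurable_expNorm (p : ℝ) : Measurable (expNorm p : (ι → ℝ) → ℝ) := by
  unfold expNorm; fun_prop

lemma expNorm_nonneg (p : ℝ) (x : ι → ℝ) : 0 ≤ expNorm p x :=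
  Real.rpow_nonneg (Finset.sum_nonneg fun _ _ => (Real.exp_pos _).le) _

/-- The expected weighted `p`-mean after a small log-normal perturbation only depends, up to third
order, on the variances of the increments. -/
lemma exists_abs_integral_rpow_sum_exp_sub_le (hρ : ∀ i, ∫ x, x i ∂ρ = 0) {p : ℝ} (hp : 1 ≤ p) :
    ∃ C : ℝ, 0 ≤ C ∧ ∀ (π : ι → ℝ) (s : ℝ), (∀ i, 0 ≤ π i) → ∑ i, π i = 1 → 0 ≤ s → s ≤ 1 →
      Integrable (fun x : ι → ℝ => (∑ i, π i * Real.exp (p * (s * x i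
        - s ^ 2 * ((∫ y, y i ^ 2 ∂ρ) / 2)))) ^ (1 / p)) ρ ∧
      |(∫ x, (∑ i, π i * Real.exp (p * (s * x i - s ^ 2 * ((∫ y, y i ^ 2 ∂ρ) / 2)))) ^ (1 / p) ∂ρ)
        - (1 + s ^ 2 * ((p - 1) / 4 * ∑ i, ∑ j, π i * π j * ∫ x, (x i - x j) ^ 2 ∂ρ))|
        ≤ C * s ^ 3 := by
  obtain ⟨C, hC0, hC⟩ := exists_abs_rpow_sum_exp_sub_le (ι := ι) hp
  set d : ι → ℝ := fun i => (∫ y, y i ^ 2 ∂ρ) / 2 with hd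
  set K : (ι → ℝ) → ℝ := fun x => Real.exp (9 * (p * (‖x‖ + ‖d‖))) with hK
  have hKint : Integrable K ρ := by
    have : K = fun x => Real.exp (9 * p * ‖d‖) * Real.exp (9 * p * ‖x‖) := by
      ext x; rw [hK, ← Real.exp_add]; ring_nf
    rw [this]
    exact (integrable_exp_mul_norm ρ _).const_mul _
  refine ⟨C * ∫ x, K x ∂ρ, mul_nonneg hC0 (integral_nonneg fun x => (Real.exp_pos _).le), ?_⟩
  intro π s hπ hπ1 hs hs1
  set b : (ι → ℝ) → ℝ := fun x =>
    (∑ i, π i * Real.exp (p * (s * x i - s ^ 2 * d i))) ^ (1 / p) with hb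
  -- The second-order Taylor polynomial of `b` in `s`.
  set T : (ι → ℝ) → ℝ := fun x => 1 + s * ∑ i, π i * x i + s ^ 2 * (-∑ i, π i * d i
    + p / 2 * ∑ i, π i * x i ^ 2 + (1 - p) / 2 * (∑ i, π i * x i) ^ 2) with hT
  have hbT : ∀ x, |b x - T x| ≤ C * s ^ 3 * K x := fun x =>
    hC π x d (‖x‖ + ‖d‖) s hπ hπ1
      (fun i => (norm_le_pi_norm x i).trans (by linarith [norm_nonneg d]))
      (fun i => (norm_le_pi_norm d i).trans (by linarith [norm_nonneg x])) (by positivity) hs hs1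
  have hsq : ∀ x : ι → ℝ, (∑ i, π i * x i) ^ 2 = ∑ i, ∑ j, π i * π j * (x i * x j) := by
    intro x
    rw [sq, Finset.sum_mul_sum]
    exact Finset.sum_congr rfl fun i _ => Finset.sum_congr rfl fun j _ => by ring
  have i1 : Integrable (fun x : ι → ℝ => ∑ i, π i * x i) ρ :=
    integrable_finsetSum _ fun i _ => (integrable_eval ρ i).const_mul _
  have isq : ∀ i, Integrable (fun x : ι → ℝ => x i ^ 2) ρ := fun i => by
    simpa only [sq] using integrable_eval_mul_eval ρ i i
  have i2 : Integrable (fun x : ι → ℝ => ∑ i, π i * x i ^ 2) ρ :=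
    integrable_finsetSum _ fun i _ => (isq i).const_mul _
  have i3 : Integrable (fun x : ι → ℝ => (∑ i, π i * x i) ^ 2) ρ := by
    simp only [hsq]
    exact integrable_finsetSum _ fun i _ => integrable_finsetSum _ fun j _ =>
      (integrable_eval_mul_eval ρ i j).const_mul _
  have iQ : Integrable (fun x : ι → ℝ => -∑ i, π i * d i
    + p / 2 * ∑ i, π i * x i ^ 2 + (1 - p) / 2 * (∑ i, π i * x i) ^ 2) ρ :=
    ((integrable_const _).add (i2.const_mul _)).add (i3.const_mul _)
  have i01 : Integrable (fun x : ι → ℝ => 1 + s * ∑ i, π i * x i) ρ :=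
    (integrable_const _).add (i1.const_mul _)
  have iT : Integrable T ρ := i01.add (iQ.const_mul _)
  have iD : Integrable (fun x => b x - T x) ρ := by
    refine Integrable.mono' (hKint.const_mul (C * s ^ 3)) ?_ (ae_of_all _ hbT)
    have : Measurable fun x => b x - T x := by
      simp only [hb, hT]; fun_prop
    exact this.aestronglyMeasurable
  have ib : Integrable b ρ := by
    have := iD.add iT
    exact this.congr (ae_of_all _ fun x => by simp)
  refine ⟨ib, ?_⟩
  have e1 : ∫ x, ∑ i, π i * x i ∂ρ = 0 := by
    rw [integral_finsetSum _ fun i _ => (integrable_eval ρ i).const_mul _]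
    simp [integral_const_mul, hρ]
  have e2 : ∫ x, ∑ i, π i * x i ^ 2 ∂ρ = ∑ i, π i * ∫ x, x i ^ 2 ∂ρ := by
    rw [integral_finsetSum _ fun i _ => (isq i).const_mul _]
    simp [integral_const_mul]
  have e3 : ∫ x, (∑ i, π i * x i) ^ 2 ∂ρ = ∑ i, ∑ j, π i * π j * ∫ x, x i * x j ∂ρ := by
    simp only [hsq]
    rw [integral_finsetSum _ fun i _ => integrable_finsetSum _ fun j _ =>
      (integrable_eval_mul_eval ρ i j).const_mul _]
    refine Finset.sum_congr rfl fun i _ => ?_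
    rw [integral_finsetSum _ fun j _ => (integrable_eval_mul_eval ρ i j).const_mul _]
    simp [integral_const_mul]
  have eT : ∫ x, T x ∂ρ
      = 1 + s ^ 2 * ((p - 1) / 4 * ∑ i, ∑ j, π i * π j * ∫ x, (x i - x j) ^ 2 ∂ρ) := by
    have einc : ∀ i j, ∫ x, (x i - x j) ^ 2 ∂ρ
        = ∫ x, x i ^ 2 ∂ρ + ∫ x, x j ^ 2 ∂ρ - 2 * ∫ x, x i * x j ∂ρ := by
      intro i j
      have iij : Integrable (fun x : ι → ℝ => x i ^ 2 + x j ^ 2) ρ := (isq i).add (isq j)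
      rw [← integral_add (isq i) (isq j), ← integral_const_mul,
        ← integral_sub iij ((integrable_eval_mul_eval ρ i j).const_mul 2)]
      exact integral_congr_ae (ae_of_all _ fun x => by ring)
    have a1 : ∑ i, ∑ j, π i * π j * ∫ x, x i ^ 2 ∂ρ = ∑ i, π i * ∫ x, x i ^ 2 ∂ρ := by
      refine Finset.sum_congr rfl fun i _ => ?_
      calc ∑ j, π i * π j * ∫ x, x i ^ 2 ∂ρ = (∑ j, π j) * (π i * ∫ x, x i ^ 2 ∂ρ) := by
            rw [Finset.sum_mul]; exact Finset.sum_congr rfl fun j _ => by ring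
        _ = _ := by rw [hπ1, one_mul]
    have a2 : ∑ i, ∑ j, π i * π j * ∫ x, x j ^ 2 ∂ρ = ∑ i, π i * ∫ x, x i ^ 2 ∂ρ := by
      rw [Finset.sum_comm, ← a1]
      exact Finset.sum_congr rfl fun i _ => Finset.sum_congr rfl fun j _ => by ring
    have a3 : ∑ i, ∑ j, π i * π j * ∫ x, (x i - x j) ^ 2 ∂ρ
        = 2 * ∑ i, π i * ∫ x, x i ^ 2 ∂ρ - 2 * ∑ i, ∑ j, π i * π j * ∫ x, x i * x j ∂ρ := by
      simp only [einc, mul_sub, mul_add, Finset.sum_add_distrib, Finset.sum_sub_distrib, a1, a2]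
      rw [Finset.mul_sum]
      simp only [Finset.mul_sum]
      have : ∀ i j, π i * π j * (2 * ∫ x, x i * x j ∂ρ) = 2 * (π i * π j * ∫ x, x i * x j ∂ρ) :=
        fun i j => by ring
      simp only [this]
      rw [← Finset.mul_sum]
      ring
    have a4 : ∑ i, π i * d i = (∑ i, π i * ∫ x, x i ^ 2 ∂ρ) / 2 := by
      rw [Finset.sum_div]
      exact Finset.sum_congr rfl fun i _ => by simp only [hd]; ring
    have i02 : Integrable (fun x : ι → ℝ => -∑ i, π i * d i + p / 2 * ∑ i, π i * x i ^ 2) ρ :=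
      (integrable_const _).add (i2.const_mul _)
    rw [a3]
    simp only [hT]
    rw [integral_add i01 (iQ.const_mul _), integral_add (integrable_const _) (i1.const_mul _),
      integral_const_mul, integral_const_mul,
      integral_add i02 (i3.const_mul _),
      integral_add (integrable_const _) (i2.const_mul _), integral_const_mul, integral_const_mul,
      e1, e2, e3, a4]
    simp only [integral_const, probReal_univ, smul_eq_mul]
    ring
  have : (∫ x, b x ∂ρ) - ∫ x, T x ∂ρ = ∫ x, (b x - T x) ∂ρ := (integral_sub ib iT).symm
  rw [← eT, this]
  calc |∫ x, (b x - T x) ∂ρ| ≤ ∫ x, |b x - T x| ∂ρ := abs_integral_le_integral_abs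
    _ ≤ ∫ x, C * s ^ 3 * K x ∂ρ := integral_mono iD.abs (hKint.const_mul _) hbT
    _ = C * (∫ x, K x ∂ρ) * s ^ 3 := by rw [integral_const_mul]; ring

/-- A perturbation `z` of `x` multiplies `expNorm p x` by a weighted `p`-mean of `exp (z i)`. -/
lemma expNorm_add [Nonempty ι] {p : ℝ} (x z : ι → ℝ) :
    expNorm p (x + z) = expNorm p x *
      (∑ i, Real.exp (p * x i) / (∑ j, Real.exp (p * x j)) * Real.exp (p * z i)) ^ (1 / p) := by
  have hS : 0 < ∑ j, Real.exp (p * x j) :=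
    Finset.sum_pos (fun _ _ => Real.exp_pos _) Finset.univ_nonempty
  rw [expNorm, expNorm, ← Real.mul_rpow hS.le
    (Finset.sum_nonneg fun i _ => by positivity), Finset.mul_sum]
  congr 1
  refine Finset.sum_congr rfl fun i _ => ?_
  rw [Pi.add_apply, mul_add, Real.exp_add]
  field_simp

/-- One step of the Lindeberg replacement: exchanging a small log-normal perturbation for one with
larger increment variances lowers the mean of `expNorm` at most by a factor `1 - O (s ^ 3)`. -/
lemma exists_step_le [Nonempty ι] (ρ₁ ρ₂ : Measure (ι → ℝ)) [IsGaussian ρ₁] [IsGaussian ρ₂]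
    (h₁ : ∀ i, ∫ x, x i ∂ρ₁ = 0) (h₂ : ∀ i, ∫ x, x i ∂ρ₂ = 0)
    (h : ∀ i j, ∫ x, (x i - x j) ^ 2 ∂ρ₂ ≤ ∫ x, (x i - x j) ^ 2 ∂ρ₁) {p : ℝ} (hp : 1 ≤ p) :
    ∃ C : ℝ, 0 ≤ C ∧ ∀ (s : ℝ) (x : ι → ℝ), 0 ≤ s → s ≤ 1 →
      ENNReal.ofReal (1 - C * s ^ 3) *
        ∫⁻ z, ENNReal.ofReal (expNorm p (x + z)) ∂(logNormalStep ρ₂ s)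
        ≤ ∫⁻ z, ENNReal.ofReal (expNorm p (x + z)) ∂(logNormalStep ρ₁ s) := by
  obtain ⟨C₁, hC₁, H₁⟩ := exists_abs_integral_rpow_sum_exp_sub_le ρ₁ h₁ hp
  obtain ⟨C₂, hC₂, H₂⟩ := exists_abs_integral_rpow_sum_exp_sub_le ρ₂ h₂ hp
  refine ⟨C₁ + C₂, by positivity, fun s x hs hs1 => ?_⟩
  set S := ∑ j, Real.exp (p * x j) with hSdef
  have hS : 0 < S := Finset.sum_pos (fun _ _ => Real.exp_pos _) Finset.univ_nonempty
  set π : ι → ℝ := fun i => Real.exp (p * x i) / S with hπ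
  have hπ0 : ∀ i, 0 ≤ π i := fun i => by positivity
  have hπ1 : ∑ i, π i = 1 := by rw [← Finset.sum_div, ← hSdef, div_self hS.ne']
  obtain ⟨i₁, b₁⟩ := H₁ π s hπ0 hπ1 hs hs1
  obtain ⟨i₂, b₂⟩ := H₂ π s hπ0 hπ1 hs hs1
  have key : ∀ (ρ : Measure (ι → ℝ)) (_ : Integrable (fun x : ι → ℝ => (∑ i, π i * Real.exp
      (p * (s * x i - s ^ 2 * ((∫ y, y i ^ 2 ∂ρ) / 2)))) ^ (1 / p)) ρ),
      ∫⁻ z, ENNReal.ofReal (expNorm p (x + z)) ∂(logNormalStep ρ s)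
      = ENNReal.ofReal (expNorm p x * ∫ x, (∑ i, π i * Real.exp
      (p * (s * x i - s ^ 2 * ((∫ y, y i ^ 2 ∂ρ) / 2)))) ^ (1 / p) ∂ρ) := by
    intro ρ hi
    have hm : Measurable fun z => ENNReal.ofReal (expNorm p (x + z)) :=
      ((measurable_expNorm p).comp (measurable_const_add x)).ennreal_ofReal
    rw [logNormalStep, lintegral_map hm (measurable_logNormalStep_map ρ s),
      ← integral_const_mul, ofReal_integral_eq_lintegral_ofReal (hi.const_mul _) (ae_of_all _ fun y => ?_)]
    · refine lintegral_congr fun y => ?_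
      rw [expNorm_add]
    · exact mul_nonneg (expNorm_nonneg _ _)
        (Real.rpow_nonneg (Finset.sum_nonneg fun i _ => mul_nonneg (hπ0 i) (Real.exp_pos _).le) _)
  rw [key ρ₁ i₁, key ρ₂ i₂]
  by_cases hc : 0 ≤ 1 - (C₁ + C₂) * s ^ 3
  swap
  · rw [ENNReal.ofReal_of_nonpos (le_of_not_ge hc), zero_mul]; exact zero_le
  rw [← ENNReal.ofReal_mul hc]
  refine ENNReal.ofReal_le_ofReal ?_
  rw [mul_left_comm]
  refine mul_le_mul_of_nonneg_left ?_ (expNorm_nonneg _ _)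
  set q₁ := (p - 1) / 4 * ∑ i, ∑ j, π i * π j * ∫ x, (x i - x j) ^ 2 ∂ρ₁ with hq₁
  set q₂ := (p - 1) / 4 * ∑ i, ∑ j, π i * π j * ∫ x, (x i - x j) ^ 2 ∂ρ₂ with hq₂
  have hp4 : 0 ≤ (p - 1) / 4 := by linarith
  have hq : q₂ ≤ q₁ := by
    refine mul_le_mul_of_nonneg_left (Finset.sum_le_sum fun i _ => Finset.sum_le_sum fun j _ =>
      mul_le_mul_of_nonneg_left (h i j) (mul_nonneg (hπ0 i) (hπ0 j))) hp4
  have hq0 : 0 ≤ q₂ := mul_nonneg hp4 (Finset.sum_nonneg fun i _ => Finset.sum_nonneg fun j _ =>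
    mul_nonneg (mul_nonneg (hπ0 i) (hπ0 j)) (integral_nonneg fun _ => sq_nonneg _))
  have a₁ := (abs_le.1 b₁).1
  have a₂ := (abs_le.1 b₂).2
  have hs3 : 0 ≤ s ^ 3 := by positivity
  have hs2 : s ^ 2 * q₂ ≤ s ^ 2 * q₁ := by gcongr
  have hs20 : 0 ≤ s ^ 2 * q₂ := by positivity
  set ε₁ := C₁ * s ^ 3
  set ε₂ := C₂ * s ^ 3
  have hε₁ : 0 ≤ ε₁ := by positivity
  have hε₂ : 0 ≤ ε₂ := by positivity
  have hce : (C₁ + C₂) * s ^ 3 = ε₁ + ε₂ := by ring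
  rw [hce] at hc ⊢
  -- The means are `1 + s ^ 2 * q₁` and `1 + s ^ 2 * q₂`, up to errors `ε₁` and `ε₂`.
  calc _ ≤ (1 - (ε₁ + ε₂)) * (1 + s ^ 2 * q₂ + ε₂) := by
        refine mul_le_mul_of_nonneg_left ?_ hc
        linarith
    _ ≤ 1 + s ^ 2 * q₂ - ε₁ := by
        nlinarith [mul_nonneg hε₁ hs20, mul_nonneg hε₂ hs20, mul_nonneg hε₁ hε₂]
    _ ≤ _ := by linarith

end Comparison

/-! ### Comparison of Gaussian vectors -/

section Comparison

variable {ι : Type*} [Fintype ι]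

lemma integral_id_eq_zero (ρ : Measure (ι → ℝ)) [IsGaussian ρ] (hρ : ∀ i, ∫ x, x i ∂ρ = 0) :
    ρ[id] = 0 := by
  ext i
  change (∫ x, x ∂ρ) i = 0
  rw [eval_integral fun i => integrable_eval ρ i]
  exact hρ i

/-- Log-normal perturbations with the same Gaussian law form a convolution semigroup, with parameter
`s ^ 2`: the law `ρ ⊗ ρ` is invariant under rotations. -/
lemma logNormalStep_conv (ρ : Measure (ι → ℝ)) [IsGaussian ρ] (hρ : ∀ i, ∫ x, x i ∂ρ = 0)
    (a b : ℝ) :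
    (logNormalStep ρ a).conv (logNormalStep ρ b) = logNormalStep ρ (√(a ^ 2 + b ^ 2)) := by
  have hc := integral_id_eq_zero ρ hρ
  set r := √(a ^ 2 + b ^ 2) with hr
  have hr2 : r ^ 2 = a ^ 2 + b ^ 2 := Real.sq_sqrt (by positivity)
  obtain ⟨θ, ha, hb⟩ : ∃ θ : ℝ, r * Real.cos θ = a ∧ r * Real.sin θ = b := by
    refine ⟨Complex.arg ⟨a, b⟩, ?_, ?_⟩
    · have := Complex.norm_mul_cos_arg ⟨a, b⟩
      rwa [Complex.norm_def, Complex.normSq_mk, ← sq, ← sq, ← hr] at this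
    · have := Complex.norm_mul_sin_arg ⟨a, b⟩
      rwa [Complex.norm_def, Complex.normSq_mk, ← sq, ← sq, ← hr] at this
  have hrot := IsGaussian.map_rotation_eq_self (μ := ρ) hc θ
  have hfst : ρ = ((ρ.prod ρ).map (ContinuousLinearMap.rotation θ)).map Prod.fst := by
    rw [hrot, Measure.map_fst_prod]; simp
  have hrhs : logNormalStep ρ r = (ρ.prod ρ).map (fun q : (ι → ℝ) × (ι → ℝ) => fun i =>
      r * (Real.cos θ * q.1 i + Real.sin θ * q.2 i) - r ^ 2 * ((∫ y, y i ^ 2 ∂ρ) / 2)) := by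
    have hmap : ∀ g : (ι → ℝ) → ι → ℝ, Measurable g →
        ρ.map g = (ρ.prod ρ).map (g ∘ Prod.fst ∘ ContinuousLinearMap.rotation θ) := by
      intro g hg
      conv_lhs => rw [hfst]
      rw [Measure.map_map measurable_fst (by fun_prop),
        Measure.map_map hg (measurable_fst.comp (by fun_prop))]
    exact hmap _ (measurable_logNormalStep_map ρ r)
  rw [hrhs, Measure.conv, logNormalStep, logNormalStep,
    Measure.map_prod_map _ _ (measurable_logNormalStep_map ρ a) (measurable_logNormalStep_map ρ b),
    Measure.map_map (by fun_prop)
      ((measurable_logNormalStep_map ρ a).prodMap (measurable_logNormalStep_map ρ b))]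
  congr 1
  ext q i
  simp only [Function.comp, Prod.map, Pi.add_apply]
  rw [hr2, ← ha, ← hb]
  ring

/-- The Lindeberg replacement iterated `k` times. The factors commute by Tonelli's theorem. -/
lemma pow_mul_lintegral_le {ρ₁ ρ₂ : Measure (ι → ℝ)} [IsGaussian ρ₁] [IsGaussian ρ₂]
    (h₁ : ∀ i, ∫ x, x i ∂ρ₁ = 0) (h₂ : ∀ i, ∫ x, x i ∂ρ₂ = 0) {F : (ι → ℝ) → ℝ≥0∞}
    (hF : Measurable F) {c : ℝ≥0∞} {s : ℝ} (hs : 0 ≤ s)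
    (h : ∀ x, c * ∫⁻ z, F (x + z) ∂(logNormalStep ρ₂ s) ≤ ∫⁻ z, F (x + z) ∂(logNormalStep ρ₁ s))
    (k : ℕ) (x : ι → ℝ) :
    c ^ k * ∫⁻ z, F (x + z) ∂(logNormalStep ρ₂ (√k * s))
      ≤ ∫⁻ z, F (x + z) ∂(logNormalStep ρ₁ (√k * s)) := by
  have hFx : ∀ x, Measurable fun z => F (x + z) := fun x => hF.comp (measurable_const_add x)
  have hadd : ∀ (ρ : Measure (ι → ℝ)) [IsGaussian ρ] (_ : ∀ i, ∫ x, x i ∂ρ = 0) (k : ℕ),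
      logNormalStep ρ (√((k + 1 : ℕ) : ℝ) * s)
        = (logNormalStep ρ (√k * s)).conv (logNormalStep ρ s) := by
    intro ρ _ hρ k
    rw [logNormalStep_conv ρ hρ]
    congr 1
    rw [mul_pow, Real.sq_sqrt (by positivity)]
    have : (k : ℝ) * s ^ 2 + s ^ 2 = ((k + 1 : ℕ) : ℝ) * s ^ 2 := by push_cast; ring
    rw [this, Real.sqrt_mul (by positivity), Real.sqrt_sq hs]
  induction k generalizing x with
  | zero =>
    have : ∀ (ρ : Measure (ι → ℝ)) [IsGaussian ρ], ∫⁻ z, F (x + z) ∂(logNormalStep ρ 0) = F x := by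
      intro ρ _
      rw [logNormalStep, lintegral_map (hFx x) (measurable_logNormalStep_map ρ 0)]
      have : ∀ y : ι → ℝ, (x + fun i => 0 * y i - 0 ^ 2 * ((∫ y, y i ^ 2 ∂ρ) / 2)) = x := by
        intro y; ext i; simp
      simp only [this]
      simp
    simp [this]
  | succ k ih =>
    rw [hadd ρ₁ h₁, hadd ρ₂ h₂, Measure.lintegral_conv (hFx x), Measure.lintegral_conv (hFx x)]
    have hjoint : Measurable (Function.uncurry fun z w : ι → ℝ => F (x + (z + w))) := by
      refine hF.comp ?_
      fun_prop
    calc c ^ (k + 1) * ∫⁻ z, ∫⁻ w, F (x + (z + w)) ∂(logNormalStep ρ₂ s)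
          ∂(logNormalStep ρ₂ (√k * s))
        = c * (c ^ k * ∫⁻ w, ∫⁻ z, F (x + (z + w)) ∂(logNormalStep ρ₂ (√k * s))
            ∂(logNormalStep ρ₂ s)) := by
          rw [lintegral_lintegral_swap hjoint.aemeasurable, pow_succ]; ring
      _ = c * ∫⁻ w, c ^ k * ∫⁻ z, F (x + w + z) ∂(logNormalStep ρ₂ (√k * s))
            ∂(logNormalStep ρ₂ s) := by
          rw [lintegral_const_mul]
          · congr 3; ext w; congr 1; ext z; congr 1; ext i; simp only [Pi.add_apply]; ring
          · refine Measurable.lintegral_prod_right' (f := fun q : (ι → ℝ) × (ι → ℝ) =>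
              F (x + q.1 + q.2)) (hF.comp (by fun_prop))
      _ ≤ c * ∫⁻ w, ∫⁻ z, F (x + w + z) ∂(logNormalStep ρ₁ (√k * s)) ∂(logNormalStep ρ₂ s) := by
          gcongr with w
          exact ih (x + w)
      _ = c * ∫⁻ z, ∫⁻ w, F (x + z + w) ∂(logNormalStep ρ₂ s) ∂(logNormalStep ρ₁ (√k * s)) := by
          rw [lintegral_lintegral_swap
            (f := fun w z => F (x + w + z)) (Measurable.aemeasurable (hF.comp
              (by fun_prop : Measurable fun q : (ι → ℝ) × (ι → ℝ) => x + q.1 + q.2)))]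
          congr 3; ext z; congr 1; ext w; congr 1; ext i; simp only [Pi.add_apply]; ring
      _ = ∫⁻ z, c * ∫⁻ w, F (x + z + w) ∂(logNormalStep ρ₂ s) ∂(logNormalStep ρ₁ (√k * s)) := by
          rw [lintegral_const_mul]
          refine Measurable.lintegral_prod_right' (f := fun q : (ι → ℝ) × (ι → ℝ) =>
              F (x + q.1 + q.2)) (hF.comp (by fun_prop))
      _ ≤ ∫⁻ z, ∫⁻ w, F (x + z + w) ∂(logNormalStep ρ₁ s) ∂(logNormalStep ρ₁ (√k * s)) :=
          lintegral_mono fun z => h (x + z)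
      _ = _ := by simp only [add_assoc]

lemma lintegral_expNorm_le [Nonempty ι] {ρ₁ ρ₂ : Measure (ι → ℝ)} [IsGaussian ρ₁] [IsGaussian ρ₂]
    (h₁ : ∀ i, ∫ x, x i ∂ρ₁ = 0) (h₂ : ∀ i, ∫ x, x i ∂ρ₂ = 0)
    (h : ∀ i j, ∫ x, (x i - x j) ^ 2 ∂ρ₂ ≤ ∫ x, (x i - x j) ^ 2 ∂ρ₁) {p : ℝ} (hp : 1 ≤ p) :
    ∫⁻ x, ENNReal.ofReal (expNorm p x) ∂(logNormalStep ρ₂ 1)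
      ≤ ∫⁻ x, ENNReal.ofReal (expNorm p x) ∂(logNormalStep ρ₁ 1) := by
  obtain ⟨C, hC, H⟩ := exists_step_le ρ₁ ρ₂ h₁ h₂ h hp
  set a := ∫⁻ x, ENNReal.ofReal (expNorm p x) ∂(logNormalStep ρ₂ 1)
  -- `N` replacements with `s = 1 / √N` lose at most a factor `1 - C / √N`.
  have hN : ∀ N : ℕ, N ≠ 0 → C ≤ N → ENNReal.ofReal (1 - C / √N) * a
      ≤ ∫⁻ x, ENNReal.ofReal (expNorm p x) ∂(logNormalStep ρ₁ 1) := by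
    intro N hN0 hCN
    have hNp : (0 : ℝ) < N := by positivity
    have hN1 : (1 : ℝ) ≤ N := by exact_mod_cast Nat.one_le_iff_ne_zero.2 hN0
    have hsN : 0 < √(N : ℝ) := Real.sqrt_pos.2 hNp
    have hs1 : 1 ≤ √(N : ℝ) := Real.one_le_sqrt.2 hN1
    have hs : (1 / √(N : ℝ)) ≤ 1 := (div_le_one hsN).2 hs1
    have := pow_mul_lintegral_le h₁ h₂ (measurable_expNorm p).ennreal_ofReal
      (by positivity : 0 ≤ 1 / √(N : ℝ)) (fun x => H (1 / √N) x (by positivity) hs) N 0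
    rw [mul_one_div_cancel hsN.ne'] at this
    simp only [zero_add] at this
    refine le_trans (mul_le_mul_left ?_ a) this
    have hsq : √(N : ℝ) ^ 2 = N := Real.sq_sqrt hNp.le
    have hs3 : C * (1 / √(N : ℝ)) ^ 3 ≤ 1 := by
      rw [div_pow, one_pow, mul_one_div, div_le_one (by positivity)]
      calc C ≤ N := hCN
        _ = √(N : ℝ) ^ 2 := hsq.symm
        _ ≤ √(N : ℝ) ^ 3 := pow_le_pow_right₀ hs1 (by norm_num)
    rw [← ENNReal.ofReal_pow (by linarith)]
    refine ENNReal.ofReal_le_ofReal ?_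
    have hb := one_add_mul_le_pow (a := -(C * (1 / √(N : ℝ)) ^ 3)) (by linarith) N
    rw [← sub_eq_add_neg] at hb
    refine le_trans (le_of_eq ?_) hb
    have : (N : ℝ) * (C * (1 / √(N : ℝ)) ^ 3) = C / √N := by
      field_simp; rw [hsq]; ring
    linarith
  have hlim : Tendsto (fun N : ℕ => ENNReal.ofReal (1 - C / √N) * a) atTop
      (𝓝 (ENNReal.ofReal (1 - 0) * a)) := by
    refine ENNReal.Tendsto.mul_const (ENNReal.tendsto_ofReal (tendsto_const_nhds.sub ?_))
      (Or.inl (by simp))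
    exact tendsto_const_nhds.div_atTop
      (Real.tendsto_sqrt_atTop.comp tendsto_natCast_atTop_atTop)
  rw [sub_zero, ENNReal.ofReal_one, one_mul] at hlim
  refine le_of_tendsto hlim ?_
  filter_upwards [eventually_ne_atTop 0,
    tendsto_natCast_atTop_atTop.eventually (eventually_ge_atTop C)] with N h0 hCN
  exact hN N h0 hCN

/-- **Gaussian comparison** for the maximum of log-normal variables of mean one: the mean of the
maximum increases with the variances of the increments of the underlying Gaussian vector. -/
theorem lintegral_iSup_exp_le (ρ₁ ρ₂ : Measure (ι → ℝ)) [IsGaussian ρ₁] [IsGaussian ρ₂]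
    (h₁ : ∀ i, ∫ x, x i ∂ρ₁ = 0) (h₂ : ∀ i, ∫ x, x i ∂ρ₂ = 0)
    (h : ∀ i j, ∫ x, (x i - x j) ^ 2 ∂ρ₂ ≤ ∫ x, (x i - x j) ^ 2 ∂ρ₁) :
    ∫⁻ x, ⨆ i, ENNReal.ofReal (Real.exp (x i - (∫ y, y i ^ 2 ∂ρ₂) / 2)) ∂ρ₂
      ≤ ∫⁻ x, ⨆ i, ENNReal.ofReal (Real.exp (x i - (∫ y, y i ^ 2 ∂ρ₁) / 2)) ∂ρ₁ := by
  cases isEmpty_or_nonempty ι with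
  | inl _ => simp
  | inr _ =>
  set M : (ι → ℝ) → ℝ≥0∞ := fun x => ⨆ i, ENNReal.ofReal (Real.exp (x i)) with hM
  have hMm : Measurable M := by
    refine Measurable.iSup fun i => ?_
    fun_prop
  have hstep : ∀ ρ : Measure (ι → ℝ),
      ∫⁻ x, ⨆ i, ENNReal.ofReal (Real.exp (x i - (∫ y, y i ^ 2 ∂ρ) / 2)) ∂ρ
        = ∫⁻ x, M x ∂(logNormalStep ρ 1) := by
    intro ρ
    rw [logNormalStep, lintegral_map hMm (measurable_logNormalStep_map ρ 1)]
    simp [hM]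
  rw [hstep, hstep]
  set n := Fintype.card ι with hn
  have hn0 : (0 : ℝ) < n := by exact_mod_cast Fintype.card_pos
  -- `max ≤ ℓ^p norm ≤ n ^ (1 / p) * max`, and `p` tends to infinity.
  have lower : ∀ (p : ℝ) (_ : 1 ≤ p) (x : ι → ℝ), M x ≤ ENNReal.ofReal (expNorm p x) := by
    intro p hp x
    refine iSup_le fun i => ENNReal.ofReal_le_ofReal ?_
    have : Real.exp (x i) = (Real.exp (p * x i)) ^ (1 / p) := by
      rw [← Real.exp_mul]; congr 1; field_simp
    rw [this]
    refine Real.rpow_le_rpow (Real.exp_pos _).le ?_ (by positivity)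
    exact Finset.single_le_sum (f := fun i => Real.exp (p * x i))
      (fun _ _ => (Real.exp_pos _).le) (Finset.mem_univ i)
  have upper : ∀ (p : ℝ) (_ : 1 ≤ p) (x : ι → ℝ),
      ENNReal.ofReal (expNorm p x) ≤ ENNReal.ofReal ((n : ℝ) ^ (1 / p)) * M x := by
    intro p hp x
    obtain ⟨i, -, hi⟩ := Finset.exists_max_image Finset.univ x Finset.univ_nonempty
    have hp0 : 0 < p := by linarith
    have h1 : expNorm p x ≤ (n : ℝ) ^ (1 / p) * Real.exp (x i) := by
      have : Real.exp (x i) = (Real.exp (p * x i)) ^ (1 / p) := by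
        rw [← Real.exp_mul]; congr 1; field_simp
      rw [this, ← Real.mul_rpow hn0.le (Real.exp_pos _).le]
      refine Real.rpow_le_rpow (Finset.sum_nonneg fun _ _ => (Real.exp_pos _).le) ?_
        (by positivity)
      calc ∑ j, Real.exp (p * x j) ≤ ∑ _j : ι, Real.exp (p * x i) :=
            Finset.sum_le_sum fun j _ => Real.exp_le_exp.2
              (mul_le_mul_of_nonneg_left (hi j (Finset.mem_univ j)) hp0.le)
        _ = n * Real.exp (p * x i) := by simp [hn]
    calc ENNReal.ofReal (expNorm p x) ≤ ENNReal.ofReal ((n : ℝ) ^ (1 / p) * Real.exp (x i)) :=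
          ENNReal.ofReal_le_ofReal h1
      _ = ENNReal.ofReal ((n : ℝ) ^ (1 / p)) * ENNReal.ofReal (Real.exp (x i)) :=
          ENNReal.ofReal_mul (by positivity)
      _ ≤ _ := by
          gcongr
          exact le_iSup (fun i => ENNReal.ofReal (Real.exp (x i))) i
  have hp : ∀ p : ℝ, 1 ≤ p → ∫⁻ x, M x ∂(logNormalStep ρ₂ 1)
      ≤ ENNReal.ofReal ((n : ℝ) ^ (1 / p)) * ∫⁻ x, M x ∂(logNormalStep ρ₁ 1) := fun p hp =>
    calc ∫⁻ x, M x ∂(logNormalStep ρ₂ 1)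
        ≤ ∫⁻ x, ENNReal.ofReal (expNorm p x) ∂(logNormalStep ρ₂ 1) := lintegral_mono (lower p hp)
      _ ≤ ∫⁻ x, ENNReal.ofReal (expNorm p x) ∂(logNormalStep ρ₁ 1) :=
          lintegral_expNorm_le h₁ h₂ h hp
      _ ≤ ∫⁻ x, ENNReal.ofReal ((n : ℝ) ^ (1 / p)) * M x ∂(logNormalStep ρ₁ 1) :=
          lintegral_mono (upper p hp)
      _ = _ := lintegral_const_mul _ hMm
  have hlim : Tendsto (fun p : ℝ => ENNReal.ofReal ((n : ℝ) ^ (1 / p))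
      * ∫⁻ x, M x ∂(logNormalStep ρ₁ 1)) atTop
      (𝓝 (ENNReal.ofReal ((n : ℝ) ^ (0 : ℝ)) * ∫⁻ x, M x ∂(logNormalStep ρ₁ 1))) := by
    refine ENNReal.Tendsto.mul_const (ENNReal.tendsto_ofReal ?_) (Or.inl (by simp))
    exact tendsto_const_nhds.rpow (tendsto_const_nhds.div_atTop tendsto_id) (Or.inl hn0.ne')
  rw [Real.rpow_zero, ENNReal.ofReal_one, one_mul] at hlim
  exact ge_of_tendsto hlim ((eventually_ge_atTop 1).mono hp)

end Comparison

/-! ### Mean suprema of log-normal processes -/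

/-- A centered real Gaussian process. -/
structure IsCenteredGaussian {ι Ω : Type*} [MeasurableSpace Ω] (U : ι → Ω → ℝ) (μ : Measure Ω) :
    Prop where
  gaussian : IsGaussianProcess U μ
  centered : ∀ i, ∫ ω, U i ω ∂μ = 0

/-- The log-normal variable `exp (U i - Var (U i) / 2)`, of mean `1` if `U` is centered Gaussian. -/
noncomputable def logNormal {ι Ω : Type*} [MeasurableSpace Ω] (U : ι → Ω → ℝ) (μ : Measure Ω)
    (i : ι) (ω : Ω) : ℝ≥0∞ :=
  ENNReal.ofReal (Real.exp (U i ω - Var[U i; μ] / 2))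

/-- The mean of `max exp (U i - Var (U i) / 2)` over a finite set of indices. -/
noncomputable def maxMean {ι Ω : Type*} [MeasurableSpace Ω] (U : ι → Ω → ℝ) (μ : Measure Ω)
    (I : Finset ι) : ℝ≥0∞ :=
  ∫⁻ ω, ⨆ i ∈ I, logNormal U μ i ω ∂μ

/-- The supremum of `maxMean U μ I` over the finite subsets `I` of `A`: the mean of
`sup exp (U i - Var (U i) / 2)` over `A`, freed from questions of measurability. -/
noncomputable def supMean {ι Ω : Type*} [MeasurableSpace Ω] (U : ι → Ω → ℝ) (μ : Measure Ω)
    (A : Set ι) : ℝ≥0∞ :=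
  ⨆ (I : Finset ι) (_ : (I : Set ι) ⊆ A), maxMean U μ I

section Functional

variable {ι κ Ω Ω' : Type*} [MeasurableSpace Ω] [MeasurableSpace Ω'] {μ : Measure Ω}
  {ν : Measure Ω'} {U : ι → Ω → ℝ} {V : ι → Ω' → ℝ}

lemma maxMean_le_supMean {A : Set ι} {I : Finset ι} (h : (I : Set ι) ⊆ A) :
    maxMean U μ I ≤ supMean U μ A :=
  le_iSup₂_of_le I h le_rfl

lemma supMean_le_iff {A : Set ι} {b : ℝ≥0∞} :
    supMean U μ A ≤ b ↔ ∀ I : Finset ι, (I : Set ι) ⊆ A → maxMean U μ I ≤ b :=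
  iSup₂_le_iff

lemma supMean_mono {A A' : Set ι} (h : A ⊆ A') : supMean U μ A ≤ supMean U μ A' :=
  supMean_le_iff.2 fun _ hI => maxMean_le_supMean (hI.trans h)

namespace IsCenteredGaussian

lemma memLp (hU : IsCenteredGaussian U μ) (i : ι) : MemLp (U i) 2 μ :=
  (hU.gaussian.hasGaussianLaw_eval i).memLp_two

lemma aemeasurable (hU : IsCenteredGaussian U μ) (i : ι) : AEMeasurable (U i) μ :=
  hU.gaussian.aemeasurable i

lemma variance_eq (hU : IsCenteredGaussian U μ) (i : ι) : Var[U i; μ] = ∫ ω, U i ω ^ 2 ∂μ :=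
  variance_of_integral_eq_zero (hU.aemeasurable i) (hU.centered i)

lemma variance_sub_eq (hU : IsCenteredGaussian U μ) (i j : ι) :
    Var[fun ω => U i ω - U j ω; μ] = ∫ ω, (U i ω - U j ω) ^ 2 ∂μ := by
  have := hU.gaussian.isProbabilityMeasure
  refine variance_of_integral_eq_zero ((hU.aemeasurable i).sub (hU.aemeasurable j)) ?_
  rw [integral_sub ((hU.memLp i).integrable (by norm_num))
    ((hU.memLp j).integrable (by norm_num)), hU.centered, hU.centered, sub_zero]

lemma aemeasurable_logNormal (hU : IsCenteredGaussian U μ) (i : ι) :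
    AEMeasurable (logNormal U μ i) μ := by
  have := hU.aemeasurable i
  unfold logNormal
  fun_prop

lemma aemeasurable_iSup_logNormal (hU : IsCenteredGaussian U μ) (I : Finset ι) :
    AEMeasurable (fun ω => ⨆ i ∈ I, logNormal U μ i ω) μ :=
  AEMeasurable.biSup (I : Set ι) I.countable_toSet fun i _ => hU.aemeasurable_logNormal i

/-- A log-normal variable `exp (U i - Var (U i) / 2)` has mean one. -/
lemma lintegral_logNormal (hU : IsCenteredGaussian U μ) (i : ι) :
    ∫⁻ ω, logNormal U μ i ω ∂μ = 1 := by
  have hlaw := (hU.gaussian.hasGaussianLaw_eval i).map_eq_gaussianReal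
  rw [hU.centered i] at hlaw
  have hm := mgf_gaussianReal hlaw 1
  have hint : Integrable (fun ω => Real.exp (1 * U i ω)) μ := by
    have := integrable_exp_mul_gaussianReal (μ := 0) (v := Var[U i; μ].toNNReal) 1
    rw [← hlaw] at this
    exact (integrable_map_measure (by fun_prop) (hU.aemeasurable i)).1 this
  simp only [one_mul] at hint
  simp only [mgf, one_mul] at hm
  have e : ∀ ω, logNormal U μ i ω
      = ENNReal.ofReal (Real.exp (-(Var[U i; μ] / 2)) * Real.exp (U i ω)) := by
    intro ω; rw [logNormal, ← Real.exp_add]; ring_nf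
  simp only [e]
  rw [← ofReal_integral_eq_lintegral_ofReal (hint.const_mul _)
    (ae_of_all _ fun ω => by positivity), integral_const_mul, hm, ← Real.exp_add,
    Real.coe_toNNReal _ (variance_nonneg _ _)]
  simp

lemma comp (hU : IsCenteredGaussian U μ) (f : κ → ι) : IsCenteredGaussian (fun k => U (f k)) μ :=
  ⟨hU.gaussian.comp_right f, fun k => hU.centered (f k)⟩

lemma const_mul (hU : IsCenteredGaussian U μ) (c : ℝ) :
    IsCenteredGaussian (fun i ω => c * U i ω) μ :=
  ⟨hU.gaussian.smul fun _ => c, fun i => by rw [integral_const_mul, hU.centered, mul_zero]⟩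

/-- The sum of independent Gaussian processes, indexed by pairs. -/
lemma add_prod {V : κ → Ω' → ℝ} (hU : IsCenteredGaussian U μ) (hV : IsCenteredGaussian V ν) :
    IsCenteredGaussian (fun (k : ι × κ) (ω : Ω × Ω') => U k.1 ω.1 + V k.2 ω.2) (μ.prod ν) where
  gaussian := by
    have := hU.gaussian.isProbabilityMeasure
    have := hV.gaussian.isProbabilityMeasure
    classical
    refine ⟨fun K => ?_⟩
    set I := K.image Prod.fst
    set J := K.image Prod.snd
    have hI : HasGaussianLaw (fun ω : Ω × Ω' => I.restrict (U · ω.1)) (μ.prod ν) := by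
      refine ⟨?_⟩
      have h := (hU.gaussian.hasGaussianLaw I)
      have e : (μ.prod ν).map (fun ω : Ω × Ω' => I.restrict (U · ω.1))
          = μ.map (fun ω => I.restrict (U · ω)) := by
        have hfst : (μ.prod ν).map Prod.fst = μ := by rw [Measure.map_fst_prod]; simp
        have := AEMeasurable.map_map_of_aemeasurable (μ := μ.prod ν) (f := Prod.fst)
          (g := fun ω => I.restrict (U · ω)) (by rw [hfst]; exact h.aemeasurable)
          measurable_fst.aemeasurable
        rw [hfst] at this
        exact this.symm
      rw [e]; exact h.isGaussian_map
    have hJ : HasGaussianLaw (fun ω : Ω × Ω' => J.restrict (V · ω.2)) (μ.prod ν) := by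
      refine ⟨?_⟩
      have h := (hV.gaussian.hasGaussianLaw J)
      have e : (μ.prod ν).map (fun ω : Ω × Ω' => J.restrict (V · ω.2))
          = ν.map (fun ω => J.restrict (V · ω)) := by
        have hsnd : (μ.prod ν).map Prod.snd = ν := by rw [Measure.map_snd_prod]; simp
        have := AEMeasurable.map_map_of_aemeasurable (μ := μ.prod ν) (f := Prod.snd)
          (g := fun ω => J.restrict (V · ω)) (by rw [hsnd]; exact h.aemeasurable)
          measurable_snd.aemeasurable
        rw [hsnd] at this
        exact this.symm
      rw [e]; exact h.isGaussian_map
    have hind := indepFun_prod₀ (hU.gaussian.hasGaussianLaw I).aemeasurable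
      (hV.gaussian.hasGaussianLaw J).aemeasurable
    have hpair := IndepFun.hasGaussianLaw hI hJ hind
    exact hpair.map_fun (ContinuousLinearMap.pi fun k : K =>
      (ContinuousLinearMap.proj (R := ℝ) (φ := fun _ : I => ℝ)
        ⟨k.1.1, Finset.mem_image_of_mem _ k.2⟩).comp (ContinuousLinearMap.fst ℝ _ _)
      + (ContinuousLinearMap.proj (R := ℝ) (φ := fun _ : J => ℝ)
        ⟨k.1.2, Finset.mem_image_of_mem _ k.2⟩).comp (ContinuousLinearMap.snd ℝ _ _))
  centered := by
    have := hU.gaussian.isProbabilityMeasure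
    have := hV.gaussian.isProbabilityMeasure
    intro k
    rw [integral_add (((hU.memLp k.1).integrable (by norm_num)).comp_fst ν)
      (((hV.memLp k.2).integrable (by norm_num)).comp_snd μ), integral_fun_fst, integral_fun_snd]
    simp [hU.centered, hV.centered]

end IsCenteredGaussian

lemma IsCenteredGaussian.maxMean_eq_lintegral_map (hU : IsCenteredGaussian U μ) (I : Finset ι) :
    maxMean U μ I = ∫⁻ x, ⨆ i, ENNReal.ofReal (Real.exp (x i -
      (∫ y, y i ^ 2 ∂(μ.map fun ω => I.restrict (U · ω))) / 2))
        ∂(μ.map fun ω => I.restrict (U · ω)) := by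
  have hm := (hU.gaussian.hasGaussianLaw I).aemeasurable
  rw [lintegral_map' (Measurable.iSup fun i => by fun_prop).aemeasurable hm, maxMean]
  refine lintegral_congr fun ω => ?_
  rw [iSup_subtype']
  refine iSup_congr fun i => ?_
  rw [integral_map hm (by fun_prop : Measurable fun y : I → ℝ => y i ^ 2).aestronglyMeasurable,
    logNormal, hU.variance_eq]
  rfl

lemma IsCenteredGaussian.integral_map_restrict_eval (hU : IsCenteredGaussian U μ) (I : Finset ι)
    (i : I) : ∫ x, x i ∂(μ.map fun ω => I.restrict (U · ω)) = 0 := by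
  rw [integral_map (hU.gaussian.hasGaussianLaw I).aemeasurable
    (measurable_pi_apply i).aestronglyMeasurable]
  exact hU.centered i

lemma IsCenteredGaussian.integral_map_restrict_sub_sq (hU : IsCenteredGaussian U μ) (I : Finset ι)
    (i j : I) : ∫ x, (x i - x j) ^ 2 ∂(μ.map fun ω => I.restrict (U · ω))
      = Var[fun ω => U i ω - U j ω; μ] := by
  rw [integral_map (hU.gaussian.hasGaussianLaw I).aemeasurable
    (by fun_prop : Measurable fun x : I → ℝ => (x i - x j) ^ 2).aestronglyMeasurable,
    hU.variance_sub_eq]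
  rfl

/-- Gaussian comparison over a finite set of indices of two processes. -/
lemma maxMean_le_maxMean (hU : IsCenteredGaussian U μ) (hV : IsCenteredGaussian V ν) (I : Finset ι)
    (h : ∀ i ∈ I, ∀ j ∈ I, Var[fun ω => V i ω - V j ω; ν] ≤ Var[fun ω => U i ω - U j ω; μ]) :
    maxMean V ν I ≤ maxMean U μ I := by
  have := (hU.gaussian.hasGaussianLaw I).isGaussian_map
  have := (hV.gaussian.hasGaussianLaw I).isGaussian_map
  rw [hU.maxMean_eq_lintegral_map, hV.maxMean_eq_lintegral_map]
  refine lintegral_iSup_exp_le _ _ (hU.integral_map_restrict_eval I)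
    (hV.integral_map_restrict_eval I) fun i j => ?_
  rw [hU.integral_map_restrict_sub_sq, hV.integral_map_restrict_sub_sq]
  exact h i i.2 j j.2

lemma supMean_le_supMean (hU : IsCenteredGaussian U μ) (hV : IsCenteredGaussian V ν) (A : Set ι)
    (h : ∀ i ∈ A, ∀ j ∈ A, Var[fun ω => V i ω - V j ω; ν] ≤ Var[fun ω => U i ω - U j ω; μ]) :
    supMean V ν A ≤ supMean U μ A :=
  supMean_le_iff.2 fun I hI => (maxMean_le_maxMean hU hV I fun i hi j hj =>
    h i (hI hi) j (hI hj)).trans (maxMean_le_supMean hI)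

lemma maxMean_image [DecidableEq ι] (f : κ → ι) (J : Finset κ) :
    maxMean U μ (J.image f) = maxMean (fun k => U (f k)) μ J := by
  unfold maxMean
  refine lintegral_congr fun ω => ?_
  simp only [Finset.mem_image, iSup_exists, iSup_and]
  refine le_antisymm (iSup_le fun i => iSup_le fun k => iSup_le fun hk => iSup_le fun e => ?_)
    (iSup₂_le fun k hk => ?_)
  · subst e; exact le_iSup₂_of_le k hk le_rfl
  · exact le_iSup_of_le (f k) (le_iSup_of_le k (le_iSup_of_le hk (le_iSup_of_le rfl le_rfl)))

lemma supMean_image (f : κ → ι) (A : Set κ) :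
    supMean U μ (f '' A) = supMean (fun k => U (f k)) μ A := by
  classical
  refine le_antisymm (supMean_le_iff.2 fun I hI => ?_) (supMean_le_iff.2 fun J hJ => ?_)
  · obtain ⟨J, hJ, rfl⟩ := Finset.subset_set_image_iff.1 hI
    rw [maxMean_image]
    exact maxMean_le_supMean hJ
  · rw [← maxMean_image]
    exact maxMean_le_supMean (by rw [Finset.coe_image]; exact image_mono hJ)

lemma supMean_union_le (hU : IsCenteredGaussian U μ) (A A' : Set ι) :
    supMean U μ (A ∪ A') ≤ supMean U μ A + supMean U μ A' := by
  classical
  refine supMean_le_iff.2 fun I hI => ?_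
  set I₁ := I.filter (· ∈ A)
  set I₂ := I.filter (· ∉ A)
  have h1 : maxMean U μ I ≤ maxMean U μ I₁ + maxMean U μ I₂ := by
    unfold maxMean
    rw [← lintegral_add_left' (hU.aemeasurable_iSup_logNormal I₁)]
    refine lintegral_mono fun ω => iSup₂_le fun i hi => ?_
    by_cases hA : i ∈ A
    · exact le_add_right (le_iSup₂_of_le i (Finset.mem_filter.2 ⟨hi, hA⟩) le_rfl)
    · exact le_add_left (le_iSup₂_of_le i (Finset.mem_filter.2 ⟨hi, hA⟩) le_rfl)
  refine h1.trans (add_le_add (maxMean_le_supMean fun i hi => ?_) (maxMean_le_supMean fun i hi => ?_))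
  · exact (Finset.mem_filter.1 hi).2
  · exact (hI (Finset.mem_filter.1 hi).1).resolve_left (Finset.mem_filter.1 hi).2

/-- The mean of the maximum is multiplicative for independent sums. -/
lemma maxMean_prod {V : κ → Ω' → ℝ} (hU : IsCenteredGaussian U μ) (hV : IsCenteredGaussian V ν)
    (I : Finset ι) (J : Finset κ) :
    maxMean (fun (k : ι × κ) (ω : Ω × Ω') => U k.1 ω.1 + V k.2 ω.2) (μ.prod ν) (I ×ˢ J)
      = maxMean U μ I * maxMean V ν J := by
  have := hU.gaussian.isProbabilityMeasure
  have := hV.gaussian.isProbabilityMeasure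
  unfold maxMean
  rw [← lintegral_prod_mul (hU.aemeasurable_iSup_logNormal I) (hV.aemeasurable_iSup_logNormal J)]
  refine lintegral_congr fun ω => ?_
  have e : ∀ k : ι × κ, logNormal (fun (k : ι × κ) (ω : Ω × Ω') => U k.1 ω.1 + V k.2 ω.2)
      (μ.prod ν) k ω = logNormal U μ k.1 ω.1 * logNormal V ν k.2 ω.2 := by
    intro k
    rw [logNormal, logNormal, logNormal, variance_add_prod (hU.memLp _) (hV.memLp _),
      ← ENNReal.ofReal_mul (Real.exp_pos _).le, ← Real.exp_add]
    ring_nf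
  simp only [e]
  refine le_antisymm (iSup₂_le fun k hk => ?_) ?_
  · obtain ⟨hi, hj⟩ := Finset.mem_product.1 hk
    exact mul_le_mul' (le_iSup₂_of_le k.1 hi le_rfl) (le_iSup₂_of_le k.2 hj le_rfl)
  · simp only [ENNReal.iSup_mul, ENNReal.mul_iSup, iSup_le_iff]
    intro j hj i hi
    exact le_iSup₂_of_le (f := fun (k : ι × κ) (_ : k ∈ I ×ˢ J) =>
      logNormal U μ k.1 ω.1 * logNormal V ν k.2 ω.2) (i, j) (Finset.mem_product.2 ⟨hi, hj⟩) le_rfl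

lemma maxMean_mono {I I' : Finset ι} (h : I ⊆ I') : maxMean U μ I ≤ maxMean U μ I' := by
  refine lintegral_mono fun ω => ?_
  exact biSup_mono fun i hi => h hi

lemma supMean_prod_le {V : κ → Ω' → ℝ} (hU : IsCenteredGaussian U μ) (hV : IsCenteredGaussian V ν)
    (A : Set ι) (A' : Set κ) :
    supMean (fun (k : ι × κ) (ω : Ω × Ω') => U k.1 ω.1 + V k.2 ω.2) (μ.prod ν) (A ×ˢ A')
      ≤ supMean U μ A * supMean V ν A' := by
  classical
  refine supMean_le_iff.2 fun K hK => ?_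
  calc _ ≤ maxMean (fun (k : ι × κ) (ω : Ω × Ω') => U k.1 ω.1 + V k.2 ω.2) (μ.prod ν)
        (K.image Prod.fst ×ˢ K.image Prod.snd) := maxMean_mono Finset.subset_product
    _ = maxMean U μ (K.image Prod.fst) * maxMean V ν (K.image Prod.snd) := maxMean_prod hU hV _ _
    _ ≤ _ := by
      refine mul_le_mul' (maxMean_le_supMean fun i hi => ?_) (maxMean_le_supMean fun j hj => ?_)
      · obtain ⟨k, hk, rfl⟩ := Finset.mem_image.1 hi
        exact (hK hk).1
      · obtain ⟨k, hk, rfl⟩ := Finset.mem_image.1 hj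
        exact (hK hk).2

lemma one_le_supMean (hU : IsCenteredGaussian U μ) {A : Set ι} (hA : A.Nonempty) :
    1 ≤ supMean U μ A := by
  obtain ⟨i, hi⟩ := hA
  refine le_trans ?_ (maxMean_le_supMean (I := {i}) (by simpa using hi))
  rw [maxMean, ← hU.lintegral_logNormal i]
  refine lintegral_mono fun ω => ?_
  simp

end Functional

/-! ### Mean suprema over small intervals -/

/-- A centered Gaussian process on the line such that the variance of an increment only depends on
the time lag, and equals the variance of the process at that lag. -/
structure HasStationaryVariogram {Ω : Type*} [MeasurableSpace Ω] (B : ℝ → Ω → ℝ) (μ : Measure Ω) :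
    Prop extends IsCenteredGaussian B μ where
  variance_increment : ∀ s t, Var[fun ω => B s ω - B t ω; μ] = stdDev B μ (s - t) ^ 2

lemma stdDev_nonneg {Ω : Type*} [MeasurableSpace Ω] (B : ℝ → Ω → ℝ) (μ : Measure Ω) (t : ℝ) :
    0 ≤ stdDev B μ t := Real.sqrt_nonneg _

lemma stdDev_sq {Ω : Type*} [MeasurableSpace Ω] (B : ℝ → Ω → ℝ) (μ : Measure Ω) (t : ℝ) :
    stdDev B μ t ^ 2 = Var[B t; μ] := Real.sq_sqrt (variance_nonneg _ _)

section

variable {Ω : Type*} [MeasurableSpace Ω] {B : ℝ → Ω → ℝ} {μ : Measure Ω}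

lemma sqrt_variance_sub_le [IsProbabilityMeasure μ] {X Y : Ω → ℝ} (hX : MemLp X 2 μ)
    (hY : MemLp Y 2 μ) :
    √Var[fun ω => X ω - Y ω; μ] ≤ √Var[X; μ] + √Var[Y; μ] := by
  have hq : ∀ c : ℝ, 0 ≤ Var[X; μ] * (c * c) + 2 * cov[X, Y; μ] * c + Var[Y; μ] := by
    intro c
    have h := variance_nonneg (fun ω => c * X ω + Y ω) μ
    rw [variance_fun_add (hX.const_mul c) hY, variance_const_mul, covariance_const_mul_left] at h
    linarith
  have hd := discrim_le_zero hq
  have hX0 := variance_nonneg X μ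
  have hY0 := variance_nonneg Y μ
  refine Real.sqrt_le_iff.2 ⟨by positivity, ?_⟩
  rw [variance_fun_sub hX hY, add_sq, Real.sq_sqrt hX0, Real.sq_sqrt hY0]
  have hc : -cov[X, Y; μ] ≤ √Var[X; μ] * √Var[Y; μ] := by
    rw [← Real.sqrt_mul hX0]
    refine (neg_le_abs _).trans (Real.abs_le_sqrt ?_)
    unfold discrim at hd
    linarith
  linarith

lemma stdDev_const_mul (c t : ℝ) : stdDev (fun t ω => c * B t ω) μ t = |c| * stdDev B μ t := by
  rw [stdDev, stdDev, variance_const_mul, Real.sqrt_mul (sq_nonneg c), Real.sqrt_sq_eq_abs]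

namespace HasStationaryVariogram

lemma const_mul (hB : HasStationaryVariogram B μ) (c : ℝ) :
    HasStationaryVariogram (fun t ω => c * B t ω) μ where
  toIsCenteredGaussian := hB.toIsCenteredGaussian.const_mul c
  variance_increment s t := by
    rw [stdDev_const_mul, mul_pow, sq_abs, ← hB.variance_increment, ← variance_const_mul]
    simp only [mul_sub]

lemma isProbabilityMeasure (hB : HasStationaryVariogram B μ) : IsProbabilityMeasure μ :=
  hB.gaussian.isProbabilityMeasure

lemma stdDev_eq_sqrt (hB : HasStationaryVariogram B μ) (s t : ℝ) :
    stdDev B μ (s - t) = √Var[fun ω => B s ω - B t ω; μ] := by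
  rw [hB.variance_increment, Real.sqrt_sq (stdDev_nonneg _ _ _)]

lemma stdDev_neg (hB : HasStationaryVariogram B μ) (t : ℝ) : stdDev B μ (-t) = stdDev B μ t := by
  have h1 := hB.stdDev_eq_sqrt 0 t
  have h2 := hB.stdDev_eq_sqrt t 0
  rw [zero_sub] at h1
  rw [sub_zero] at h2
  rw [h1, h2]
  congr 1
  rw [← variance_fun_neg]
  simp

lemma stdDev_sub_le (hB : HasStationaryVariogram B μ) (s t : ℝ) :
    stdDev B μ (s - t) ≤ stdDev B μ s + stdDev B μ t := by
  have := hB.isProbabilityMeasure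
  rw [hB.stdDev_eq_sqrt]
  exact sqrt_variance_sub_le (hB.memLp s) (hB.memLp t)

lemma stdDev_add_le (hB : HasStationaryVariogram B μ) (s t : ℝ) :
    stdDev B μ (s + t) ≤ stdDev B μ s + stdDev B μ t := by
  have := hB.stdDev_sub_le s (-t)
  rwa [sub_neg_eq_add, hB.stdDev_neg] at this

lemma stdDev_natCast_mul_le (hB : HasStationaryVariogram B μ) (n : ℕ) (t : ℝ) :
    stdDev B μ ((n + 1 : ℕ) * t) ≤ (n + 1 : ℕ) * stdDev B μ t := by
  induction n with
  | zero => simp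
  | succ n ih =>
    calc stdDev B μ ((n + 1 + 1 : ℕ) * t) = stdDev B μ ((n + 1 : ℕ) * t + t) := by
          congr 1; push_cast; ring
      _ ≤ (n + 1 : ℕ) * stdDev B μ t + stdDev B μ t := (hB.stdDev_add_le _ _).trans (by gcongr)
      _ = (n + 1 + 1 : ℕ) * stdDev B μ t := by push_cast; ring

/-- A standard deviation function that vanishes continuously at `0` is locally bounded. -/
lemma exists_stdDev_le (hB : HasStationaryVariogram B μ)
    (hcont : Tendsto (stdDev B μ) (𝓝 0) (𝓝 0)) (R : ℝ) :
    ∃ W : ℝ, 0 ≤ W ∧ ∀ t ∈ Icc (-R) R, stdDev B μ t ≤ W := by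
  obtain ⟨δ, hδ, h⟩ := Metric.eventually_nhds_iff.1 (hcont.eventually (gt_mem_nhds one_pos))
  obtain ⟨n, hn⟩ := exists_nat_gt (R / δ)
  refine ⟨(n + 1 : ℕ), by positivity, fun t ht => ?_⟩
  have hn1 : (0 : ℝ) < (n + 1 : ℕ) := by positivity
  have ht' : |t| ≤ R := abs_le.2 ht
  have hsmall : stdDev B μ (t / (n + 1 : ℕ)) < 1 := by
    refine h ?_
    rw [Real.dist_eq, sub_zero, abs_div, abs_of_pos hn1, div_lt_iff₀ hn1]
    rw [div_lt_iff₀ hδ] at hn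
    push_cast
    nlinarith
  calc stdDev B μ t = stdDev B μ ((n + 1 : ℕ) * (t / (n + 1 : ℕ))) := by
        congr 1; field_simp
    _ ≤ (n + 1 : ℕ) * stdDev B μ (t / (n + 1 : ℕ)) := hB.stdDev_natCast_mul_le _ _
    _ ≤ (n + 1 : ℕ) * 1 := by gcongr
    _ = _ := mul_one _

/-- Either `stdDev B μ x` is positive and the factor `a < 1` leaves room for small `u`, or
`stdDev B μ (x + u) = stdDev B μ u`. -/
lemma eventually_stdDev_sq_le (hB : HasStationaryVariogram B μ)
    (hcont : Tendsto (stdDev B μ) (𝓝 0) (𝓝 0)) (x : ℝ) {a : ℝ} (ha : 0 ≤ a) (ha1 : a < 1) :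
    ∀ᶠ u in 𝓝 (0 : ℝ), a ^ 2 * stdDev B μ x ^ 2 + stdDev B μ u ^ 2 ≤ stdDev B μ (x + u) ^ 2 := by
  set q := stdDev B μ x with hq
  rcases (stdDev_nonneg B μ x).eq_or_lt with h0 | hpos
  · refine Eventually.of_forall fun u => ?_
    have : stdDev B μ u ≤ stdDev B μ (x + u) := by
      have := hB.stdDev_sub_le (x + u) x
      rwa [add_sub_cancel_left, ← h0, add_zero] at this
    rw [hq, ← h0]
    have := pow_le_pow_left₀ (stdDev_nonneg B μ u) this 2
    linarith
  · have hlim : 0 < (1 - a ^ 2) * q / 2 := by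
      have : 0 < 1 - a ^ 2 := by nlinarith
      positivity
    filter_upwards [hcont.eventually (gt_mem_nhds hlim)] with u hu
    have h1 : q - stdDev B μ u ≤ stdDev B μ (x + u) := by
      have := hB.stdDev_sub_le (x + u) u
      rw [add_sub_cancel_right] at this
      linarith
    have hu0 := stdDev_nonneg B μ u
    have h2 : 0 ≤ q - stdDev B μ u := by nlinarith [sq_nonneg a]
    have h3 := pow_le_pow_left₀ h2 h1 2
    nlinarith

/-- Lower bound for the supremum over a sumset: a slightly shrunk copy of the process on the finite
set `I`, plus an independent copy near `0`, has smaller increments than the process on the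
sumset. -/
lemma exists_maxMean_mul_supMean_le (hB : HasStationaryVariogram B μ)
    (hcont : Tendsto (stdDev B μ) (𝓝 0) (𝓝 0)) {ε : ℝ} (hε : 0 < ε) {I : Finset ℝ}
    (hI : (I : Set ℝ) ⊆ Icc (-ε) ε) {a : ℝ} (ha : 0 ≤ a) (ha1 : a < 1) :
    ∃ δ > 0, maxMean (fun t ω => a * B t ω) μ I * supMean B μ (Icc (-δ) δ)
      ≤ supMean B μ (Icc (-(2 * ε)) (2 * ε)) := by
  have := hB.isProbabilityMeasure
  have hev : ∀ᶠ u in 𝓝 (0 : ℝ), ∀ t ∈ I, ∀ t' ∈ I,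
      a ^ 2 * stdDev B μ (t - t') ^ 2 + stdDev B μ u ^ 2 ≤ stdDev B μ (t - t' + u) ^ 2 := by
    rw [Filter.eventually_all_finset]
    intro t _
    rw [Filter.eventually_all_finset]
    intro t' _
    exact hB.eventually_stdDev_sq_le hcont _ ha ha1
  obtain ⟨δ₀, hδ₀, hδ⟩ := Metric.eventually_nhds_iff.1 hev
  -- Differences of points of `[-δ, δ]` have to be less than `δ₀`.
  refine ⟨min ε (δ₀ / 4), lt_min hε (by positivity), ?_⟩
  set δ := min ε (δ₀ / 4)
  have hδε : δ ≤ ε := min_le_left _ _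
  have hδ4 : δ ≤ δ₀ / 4 := min_le_right _ _
  conv_lhs => rw [supMean]
  simp only [ENNReal.mul_iSup]
  refine iSup₂_le fun J hJ => ?_
  have hU := hB.toIsCenteredGaussian.const_mul a
  rw [← maxMean_prod hU hB.toIsCenteredGaussian]
  calc _ ≤ maxMean (fun (k : ℝ × ℝ) ω => B (k.1 + k.2) ω) μ (I ×ˢ J) := by
        refine maxMean_le_maxMean (hB.toIsCenteredGaussian.comp fun k : ℝ × ℝ => k.1 + k.2)
          (hU.add_prod hB.toIsCenteredGaussian) _ fun k hk k' hk' => ?_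
        obtain ⟨hk1, hk2⟩ := Finset.mem_product.1 hk
        obtain ⟨hk1', hk2'⟩ := Finset.mem_product.1 hk'
        have e : (fun ω : Ω × Ω => a * B k.1 ω.1 + B k.2 ω.2 - (a * B k'.1 ω.1 + B k'.2 ω.2))
            = fun ω => (a * (B k.1 ω.1 - B k'.1 ω.1)) + (B k.2 ω.2 - B k'.2 ω.2) := by
          ext ω; ring
        rw [e, variance_add_prod (X := fun ω => a * (B k.1 ω - B k'.1 ω))
          (Y := fun ω => B k.2 ω - B k'.2 ω)
          (((hB.memLp k.1).sub (hB.memLp k'.1)).const_mul a) ((hB.memLp k.2).sub (hB.memLp k'.2)),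
          variance_const_mul, hB.variance_increment, hB.variance_increment, hB.variance_increment]
        have e2 : k.1 + k.2 - (k'.1 + k'.2) = k.1 - k'.1 + (k.2 - k'.2) := by ring
        rw [e2]
        refine hδ ?_ _ hk1 _ hk1'
        have b1 := hJ hk2
        have b2 := hJ hk2'
        rw [Real.dist_eq, sub_zero]
        have : |k.2 - k'.2| ≤ 2 * δ := by
          rw [abs_le]; constructor <;> linarith [b1.1, b1.2, b2.1, b2.2]
        linarith
    _ ≤ supMean (fun (k : ℝ × ℝ) ω => B (k.1 + k.2) ω) μ
          (Icc (-ε) ε ×ˢ Icc (-ε) ε) := by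
        refine maxMean_le_supMean ?_
        rw [Finset.coe_product]
        exact prod_mono hI (hJ.trans (Icc_subset_Icc (by linarith) hδε))
    _ = supMean B μ ((fun k : ℝ × ℝ => k.1 + k.2) '' (Icc (-ε) ε ×ˢ Icc (-ε) ε)) :=
        (supMean_image (fun k : ℝ × ℝ => k.1 + k.2) _).symm
    _ ≤ _ := by
        refine supMean_mono ?_
        rintro _ ⟨k, ⟨h1, h2⟩, rfl⟩
        exact ⟨by linarith [h1.1, h2.1], by linarith [h1.2, h2.2]⟩

end HasStationaryVariogram

/-- Lower semicontinuity (Fatou) of the mean of the maximum in the scale of the process. -/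
lemma maxMean_le_of_forall_lt {ι : Type*} {U : ι → Ω → ℝ} (hU : IsCenteredGaussian U μ)
    {I : Finset ι} {b : ℝ≥0∞}
    (h : ∀ a : ℝ, 0 ≤ a → a < 1 → maxMean (fun i ω => a * U i ω) μ I ≤ b) :
    maxMean U μ I ≤ b := by
  set a : ℕ → ℝ := fun n => 1 - 1 / ((n : ℝ) + 1) with ha
  have hlim : Tendsto a atTop (𝓝 1) := by
    have := (tendsto_const_nhds (x := (1 : ℝ))).sub
      (tendsto_one_div_add_atTop_nhds_zero_nat (𝕜 := ℝ))
    rwa [sub_zero] at this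
  have ha0 : ∀ n, 0 ≤ a n := fun n => by
    have : 1 / ((n : ℝ) + 1) ≤ 1 :=
      (div_le_one (by positivity)).2 (by linarith [n.cast_nonneg (α := ℝ)])
    simp only [ha]; linarith
  have ha1 : ∀ n, a n < 1 := fun n => by
    have : 0 < 1 / ((n : ℝ) + 1) := by positivity
    simp only [ha]; linarith
  have hpt : ∀ ω, ⨆ i ∈ I, logNormal U μ i ω
      ≤ liminf (fun n => ⨆ i ∈ I, logNormal (fun i ω => a n * U i ω) μ i ω) atTop := by
    intro ω
    refine iSup₂_le fun i hi => ?_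
    have hconv : Tendsto (fun n => logNormal (fun i ω => a n * U i ω) μ i ω) atTop
        (𝓝 (logNormal U μ i ω)) := by
      simp only [logNormal, variance_const_mul]
      refine ENNReal.tendsto_ofReal (Real.continuous_exp.continuousAt.tendsto.comp ?_)
      have := (hlim.mul_const (U i ω)).sub (((hlim.pow 2).mul_const Var[U i; μ]).div_const 2)
      simpa using this
    rw [← hconv.liminf_eq]
    exact liminf_le_liminf (Eventually.of_forall fun n =>
      le_iSup₂_of_le (f := fun i (_ : i ∈ I) => logNormal (fun i ω => a n * U i ω) μ i ω)
        i hi le_rfl)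
  calc maxMean U μ I
      ≤ ∫⁻ ω, liminf (fun n => ⨆ i ∈ I, logNormal (fun i ω => a n * U i ω) μ i ω) atTop ∂μ :=
        lintegral_mono hpt
    _ ≤ liminf (fun n => ∫⁻ ω, ⨆ i ∈ I, logNormal (fun i ω => a n * U i ω) μ i ω ∂μ) atTop :=
        lintegral_liminf_le' fun n => (hU.const_mul (a n)).aemeasurable_iSup_logNormal I
    _ ≤ liminf (fun _ : ℕ => b) atTop :=
        liminf_le_liminf (Eventually.of_forall fun n => h (a n) (ha0 n) (ha1 n))
    _ = b := liminf_const b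

namespace HasStationaryVariogram

/-- The mean supremum over a small interval is close to one. This is the quantitative form of
Belyaev's theorem (a locally bounded process with stationary increments has continuous paths): the
limit `b` of the mean suprema satisfies `b * b ≤ b`. -/
lemma iInf_supMean_Icc_le_one (hB : HasStationaryVariogram B μ)
    (hcont : Tendsto (stdDev B μ) (𝓝 0) (𝓝 0))
    (hfin : ∃ ε > 0, supMean B μ (Icc (-ε) ε) ≠ ∞) :
    ⨅ (ε : ℝ) (_ : 0 < ε), supMean B μ (Icc (-ε) ε) ≤ 1 := by
  set b := ⨅ (ε : ℝ) (_ : 0 < ε), supMean B μ (Icc (-ε) ε) with hb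
  have hbε : ∀ ε > 0, b ≤ supMean B μ (Icc (-ε) ε) := fun ε hε => iInf₂_le ε hε
  have hbt : b ≠ ∞ := by
    obtain ⟨ε, hε, h⟩ := hfin
    exact ne_top_of_le_ne_top h (hbε ε hε)
  have h1b : 1 ≤ b := le_iInf₂ fun ε hε =>
    one_le_supMean hB.toIsCenteredGaussian ⟨0, by constructor <;> linarith⟩
  have hb0 : b ≠ 0 := (one_pos.trans_le h1b).ne'
  have key : ∀ ε > 0, b * b ≤ supMean B μ (Icc (-(2 * ε)) (2 * ε)) := by
    intro ε hε
    refine (mul_le_mul_left (hbε ε hε) b).trans ?_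
    conv_lhs => rw [supMean]
    simp only [ENNReal.iSup_mul]
    refine iSup₂_le fun I hI => ?_
    rw [← ENNReal.le_div_iff_mul_le (Or.inl hb0) (Or.inl hbt)]
    refine maxMean_le_of_forall_lt hB.toIsCenteredGaussian fun a ha ha1 => ?_
    rw [ENNReal.le_div_iff_mul_le (Or.inl hb0) (Or.inl hbt)]
    obtain ⟨δ, hδ, h⟩ := hB.exists_maxMean_mul_supMean_le hcont hε hI ha ha1
    exact (mul_le_mul_right (hbε δ hδ) _).trans h
  have hbb : b * b ≤ b := by
    conv_rhs => rw [hb]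
    refine le_iInf₂ fun ε hε => ?_
    have := key (ε / 2) (by positivity)
    rwa [mul_div_cancel₀ _ (two_ne_zero)] at this
  calc b = b * b / b := (ENNReal.mul_div_cancel_right hb0 hbt).symm
    _ ≤ b / b := ENNReal.div_le_div_right hbb b
    _ = 1 := ENNReal.div_self hb0 hbt

end HasStationaryVariogram

end

/-! ### Outer regularity of mean suprema -/

section

variable {ι Ω : Type*} [MeasurableSpace Ω] {μ : Measure Ω} {U : ι → Ω → ℝ}

/-- Interpolation (Hölder) between the scales `1` and `2` of a Gaussian process. -/
lemma maxMean_const_mul_le (hU : IsCenteredGaussian U μ) {I : Finset ι} {w : ℝ}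
    (hw : ∀ i ∈ I, Var[U i; μ] ≤ w) {a : ℝ} (ha1 : 1 ≤ a) (ha2 : a ≤ 2) :
    maxMean (fun i ω => a * U i ω) μ I ≤ maxMean U μ I ^ (2 - a) *
      (ENNReal.ofReal (Real.exp w) * maxMean (fun i ω => 2 * U i ω) μ I) ^ (a - 1) := by
  set M : Ω → ℝ≥0∞ := fun ω => ⨆ i ∈ I, logNormal U μ i ω with hM
  have hMm : AEMeasurable M μ := hU.aemeasurable_iSup_logNormal I
  have h1 : ∀ ω, ⨆ i ∈ I, logNormal (fun i ω => a * U i ω) μ i ω ≤ M ω ^ a := by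
    intro ω
    refine iSup₂_le fun i hi => ?_
    refine le_trans ?_ (ENNReal.rpow_le_rpow
      (le_iSup₂_of_le (f := fun i (_ : i ∈ I) => logNormal U μ i ω) i hi le_rfl) (by linarith))
    rw [logNormal, logNormal, ENNReal.ofReal_rpow_of_pos (Real.exp_pos _), ← Real.exp_mul,
      variance_const_mul]
    refine ENNReal.ofReal_le_ofReal (Real.exp_le_exp.2 ?_)
    have := variance_nonneg (U i) μ
    nlinarith [mul_nonneg this (mul_nonneg (by linarith : 0 ≤ a) (by linarith : 0 ≤ a - 1))]
  have h2 : ∀ ω, M ω ^ (2 : ℝ) ≤ ENNReal.ofReal (Real.exp w) *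
      ⨆ i ∈ I, logNormal (fun i ω => 2 * U i ω) μ i ω := by
    intro ω
    rw [← ENNReal.le_rpow_inv_iff (by norm_num : (0 : ℝ) < 2)]
    refine iSup₂_le fun i hi => ?_
    rw [ENNReal.le_rpow_inv_iff (by norm_num : (0 : ℝ) < 2)]
    refine le_trans ?_ (mul_le_mul_right
      (le_iSup₂_of_le (f := fun i (_ : i ∈ I) => logNormal (fun i ω => 2 * U i ω) μ i ω)
        i hi le_rfl) _)
    rw [logNormal, logNormal, ENNReal.ofReal_rpow_of_pos (Real.exp_pos _), ← Real.exp_mul,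
      variance_const_mul, ← ENNReal.ofReal_mul (Real.exp_pos _).le, ← Real.exp_add]
    refine ENNReal.ofReal_le_ofReal (Real.exp_le_exp.2 ?_)
    linarith [hw i hi]
  have hsplit : ∀ ω, M ω ^ a = M ω ^ (2 - a) * (M ω ^ (2 : ℝ)) ^ (a - 1) := by
    intro ω
    rw [← ENNReal.rpow_mul, ← ENNReal.rpow_add_of_nonneg _ _ (by linarith) (by linarith)]
    congr 1; ring
  calc maxMean (fun i ω => a * U i ω) μ I ≤ ∫⁻ ω, M ω ^ a ∂μ := lintegral_mono h1
    _ = ∫⁻ ω, M ω ^ (2 - a) * (M ω ^ (2 : ℝ)) ^ (a - 1) ∂μ := lintegral_congr hsplit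
    _ ≤ (∫⁻ ω, M ω ∂μ) ^ (2 - a) * (∫⁻ ω, M ω ^ (2 : ℝ) ∂μ) ^ (a - 1) :=
        ENNReal.lintegral_mul_norm_pow_le hMm (hMm.pow_const 2) (by linarith) (by linarith)
          (by ring)
    _ ≤ _ := by
        refine mul_le_mul_right (ENNReal.rpow_le_rpow ?_ (by linarith)) _
        refine (lintegral_mono h2).trans_eq ?_
        rw [lintegral_const_mul'' _ ((hU.const_mul 2).aemeasurable_iSup_logNormal I)]
        rfl

lemma supMean_const_mul_le (hU : IsCenteredGaussian U μ) {A : Set ι} {w : ℝ}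
    (hw : ∀ i ∈ A, Var[U i; μ] ≤ w) {a : ℝ} (ha1 : 1 ≤ a) (ha2 : a ≤ 2) :
    supMean (fun i ω => a * U i ω) μ A ≤ supMean U μ A ^ (2 - a) *
      (ENNReal.ofReal (Real.exp w) * supMean (fun i ω => 2 * U i ω) μ A) ^ (a - 1) := by
  refine supMean_le_iff.2 fun I hI => ?_
  refine (maxMean_const_mul_le hU (fun i hi => hw i (hI hi)) ha1 ha2).trans ?_
  refine mul_le_mul' (ENNReal.rpow_le_rpow (maxMean_le_supMean hI) (by linarith))
    (ENNReal.rpow_le_rpow ?_ (by linarith))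
  gcongr
  exact maxMean_le_supMean hI

end

section

variable {Ω : Type*} [MeasurableSpace Ω] {B : ℝ → Ω → ℝ} {μ : Measure Ω}

namespace HasStationaryVariogram

/-- Upper bound for the supremum over a sumset: by `(x + y) ^ 2 ≤ a ^ 2 x ^ 2 + a' ^ 2 y ^ 2` the
process on the sumset has smaller increments than the independent sum of its copies at the scales
`a` and `a'`. -/
lemma supMean_sumset_le (hB : HasStationaryVariogram B μ) (A A' : Set ℝ) {a a' : ℝ}
    (ha : ∀ x y : ℝ, (x + y) ^ 2 ≤ a ^ 2 * x ^ 2 + a' ^ 2 * y ^ 2) :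
    supMean B μ ((fun k : ℝ × ℝ => k.1 + k.2) '' (A ×ˢ A'))
      ≤ supMean (fun t ω => a * B t ω) μ A * supMean (fun t ω => a' * B t ω) μ A' := by
  have := hB.isProbabilityMeasure
  have hU := hB.toIsCenteredGaussian.const_mul a
  have hV := hB.toIsCenteredGaussian.const_mul a'
  rw [supMean_image]
  refine le_trans ?_ (supMean_prod_le hU hV A A')
  refine supMean_le_supMean (hU.add_prod hV)
    (hB.toIsCenteredGaussian.comp fun k : ℝ × ℝ => k.1 + k.2) _ fun k _ k' _ => ?_
  have e : (fun ω : Ω × Ω => a * B k.1 ω.1 + a' * B k.2 ω.2 - (a * B k'.1 ω.1 + a' * B k'.2 ω.2))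
      = fun ω => a * (B k.1 ω.1 - B k'.1 ω.1) + a' * (B k.2 ω.2 - B k'.2 ω.2) := by
    ext ω; ring
  rw [e, variance_add_prod (X := fun ω => a * (B k.1 ω - B k'.1 ω))
    (Y := fun ω => a' * (B k.2 ω - B k'.2 ω))
    (((hB.memLp k.1).sub (hB.memLp k'.1)).const_mul a)
    (((hB.memLp k.2).sub (hB.memLp k'.2)).const_mul a'),
    variance_const_mul, variance_const_mul, hB.variance_increment, hB.variance_increment,
    hB.variance_increment]
  have e2 : k.1 + k.2 - (k'.1 + k'.2) = k.1 - k'.1 + (k.2 - k'.2) := by ring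
  rw [e2]
  exact (pow_le_pow_left₀ (stdDev_nonneg _ _ _) (hB.stdDev_add_le _ _) 2).trans (ha _ _)

/-- Outer regularity of `supMean` on bounded sets. -/
theorem iInf_supMean_sumset_le (hB : HasStationaryVariogram B μ)
    (hcont : Tendsto (stdDev B μ) (𝓝 0) (𝓝 0))
    (hfin : ∀ c R : ℝ, supMean (fun t ω => c * B t ω) μ (Icc (-R) R) ≠ ∞)
    {K : Set ℝ} {R : ℝ} (hK : K ⊆ Icc (-R) R) :
    ⨅ (ε : ℝ) (_ : 0 < ε), supMean B μ ((fun k : ℝ × ℝ => k.1 + k.2) '' (K ×ˢ Icc (-ε) ε))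
      ≤ supMean B μ K := by
  rcases K.eq_empty_or_nonempty with rfl | hKne
  · exact iInf₂_le_of_le 1 one_pos (by simp)
  set L := ⨅ (ε : ℝ) (_ : 0 < ε), supMean B μ ((fun k : ℝ × ℝ => k.1 + k.2) '' (K ×ˢ Icc (-ε) ε))
    with hL
  have hfinK : ∀ c : ℝ, supMean (fun t ω => c * B t ω) μ K ≠ ∞ := fun c =>
    ne_top_of_le_ne_top (hfin c R) (supMean_mono hK)
  have h1K : ∀ c : ℝ, 1 ≤ supMean (fun t ω => c * B t ω) μ K := fun c =>
    one_le_supMean (hB.const_mul c).toIsCenteredGaussian hKne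
  have step1 : ∀ a : ℝ, 1 < a → L ≤ supMean (fun t ω => a * B t ω) μ K := by
    intro a ha
    have hq : 0 < a ^ 2 - 1 := by nlinarith
    -- The least `a'` that makes the quadratic form in `hineq` nonnegative.
    set a' := a / √(a ^ 2 - 1) with ha'
    have ha'2 : a' ^ 2 = a ^ 2 / (a ^ 2 - 1) := by rw [ha', div_pow, Real.sq_sqrt hq.le]
    have hineq : ∀ x y : ℝ, (x + y) ^ 2 ≤ a ^ 2 * x ^ 2 + a' ^ 2 * y ^ 2 := by
      intro x y
      rw [ha'2]
      have : a ^ 2 * x ^ 2 + a ^ 2 / (a ^ 2 - 1) * y ^ 2 - (x + y) ^ 2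
          = ((a ^ 2 - 1) * x - y) ^ 2 / (a ^ 2 - 1) := by field_simp; ring
      have h0 : 0 ≤ ((a ^ 2 - 1) * x - y) ^ 2 / (a ^ 2 - 1) := by positivity
      linarith
    have hcont' : Tendsto (stdDev (fun t ω => a' * B t ω) μ) (𝓝 0) (𝓝 0) := by
      have : stdDev (fun t ω => a' * B t ω) μ = fun t => |a'| * stdDev B μ t := by
        ext t; exact stdDev_const_mul a' t
      rw [this]
      simpa using hcont.const_mul |a'|
    have hone := (hB.const_mul a').iInf_supMean_Icc_le_one hcont' ⟨1, one_pos, hfin a' 1⟩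
    -- At the scale `a'`, large but fixed, the factor from `[-ε, ε]` still tends to `1`.
    rw [← mul_one (supMean _ μ K)]
    refine ENNReal.le_mul_of_forall_lt (Or.inr ENNReal.one_ne_top) (Or.inr one_ne_zero)
      fun s hs y hy => ?_
    obtain ⟨ε, h⟩ := iInf_lt_iff.1 (hone.trans_lt hy)
    obtain ⟨hε, h⟩ := iInf_lt_iff.1 h
    calc L ≤ supMean B μ ((fun k : ℝ × ℝ => k.1 + k.2) '' (K ×ˢ Icc (-ε) ε)) := iInf₂_le ε hε
      _ ≤ _ := hB.supMean_sumset_le K (Icc (-ε) ε) hineq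
      _ ≤ s * y := mul_le_mul' hs.le h.le
  obtain ⟨W, hW0, hW⟩ := hB.exists_stdDev_le hcont R
  have hvar : ∀ t ∈ K, Var[B t; μ] ≤ W ^ 2 := fun t ht => by
    rw [← stdDev_sq]
    exact pow_le_pow_left₀ (stdDev_nonneg _ _ _) (hW t (hK ht)) 2
  set C := ENNReal.ofReal (Real.exp (W ^ 2)) * supMean (fun t ω => 2 * B t ω) μ K with hC
  have hCt : C ≠ ∞ := ENNReal.mul_ne_top ENNReal.ofReal_ne_top (hfinK 2)
  have hC1 : 1 ≤ C := by
    rw [hC, ← one_mul (1 : ℝ≥0∞)]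
    refine mul_le_mul' ?_ (h1K 2)
    rw [← ENNReal.ofReal_one]
    exact ENNReal.ofReal_le_ofReal (Real.one_le_exp (by positivity))
  have hS1 : 1 ≤ supMean B μ K := one_le_supMean hB.toIsCenteredGaussian hKne
  have step2 : ∀ a : ℝ, 1 < a → a ≤ 2 → L ≤ supMean B μ K * C ^ (a - 1) := by
    intro a ha ha2
    refine (step1 a ha).trans ((supMean_const_mul_le hB.toIsCenteredGaussian hvar ha.le ha2).trans
      ?_)
    refine mul_le_mul_left ?_ _
    calc supMean B μ K ^ (2 - a) ≤ supMean B μ K ^ (1 : ℝ) :=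
          ENNReal.rpow_le_rpow_of_exponent_le hS1 (by linarith)
      _ = _ := ENNReal.rpow_one _
  -- It remains to let the scale `a` decrease to `1`.
  have hlim : Tendsto (fun a : ℝ => supMean B μ K * C ^ (a - 1)) (𝓝[>] 1) (𝓝 (supMean B μ K)) := by
    have hc : C = ENNReal.ofReal C.toReal := (ENNReal.ofReal_toReal hCt).symm
    have hcpos : 0 < C.toReal := ENNReal.toReal_pos (one_pos.trans_le hC1).ne' hCt
    have h : Tendsto (fun a : ℝ => C ^ (a - 1)) (𝓝[>] 1) (𝓝 1) := by
      rw [hc]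
      simp only [ENNReal.ofReal_rpow_of_pos hcpos]
      have h1 : (1 : ℝ≥0∞) = ENNReal.ofReal (C.toReal ^ (0 : ℝ)) := by simp
      rw [h1]
      refine ENNReal.tendsto_ofReal (tendsto_const_nhds.rpow ?_ (Or.inl hcpos.ne'))
      have : Tendsto (fun a : ℝ => a - 1) (𝓝 1) (𝓝 (1 - 1)) := tendsto_id.sub tendsto_const_nhds
      rw [sub_self] at this
      exact this.mono_left nhdsWithin_le_nhds
    simpa using ENNReal.Tendsto.const_mul h (Or.inl one_ne_zero)
  refine ge_of_tendsto hlim ?_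
  filter_upwards [Ioc_mem_nhdsGT (one_lt_two)] with a ha
  exact step2 a ha.1 ha.2

end HasStationaryVariogram

end

/-! ### Finiteness of mean suprema -/

section

variable {ι : Type*} [Fintype ι] (ρ : Measure (ι → ℝ)) [IsGaussian ρ]

/-- A centered Gaussian vector is symmetric. -/
lemma map_neg_eq_self (hρ : ∀ i, ∫ x, x i ∂ρ = 0) : ρ.map (fun x => -x) = ρ := by
  have hrot := IsGaussian.map_rotation_eq_self (μ := ρ) (integral_id_eq_zero ρ hρ) Real.pi
  have hfst : ρ = ((ρ.prod ρ).map (ContinuousLinearMap.rotation Real.pi)).map Prod.fst := by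
    rw [hrot, Measure.map_fst_prod]; simp
  conv_rhs => rw [hfst]
  rw [Measure.map_map measurable_fst (by fun_prop)]
  have : (Prod.fst ∘ ContinuousLinearMap.rotation Real.pi : (ι → ℝ) × (ι → ℝ) → (ι → ℝ))
      = (fun x => -x) ∘ Prod.fst := by
    ext x i
    simp [ContinuousLinearMap.rotation_apply]
  rw [this, ← Measure.map_map measurable_neg measurable_fst, Measure.map_fst_prod]
  simp

end

section

/-- The bound in Fernique's theorem, in terms of a lower bound `c` for the probability of a ball. -/
noncomputable def ferniqueBound (c : ℝ≥0∞) : ℝ≥0∞ :=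
  .ofReal (Real.exp (Fernique.logRatio c))
    + ∑' n : ℕ, .ofReal (Real.exp (-2⁻¹ * Real.log (c / (1 - c)).toReal * 2 ^ n))

lemma ferniqueBound_lt_top {c : ℝ≥0∞} (hc : 2⁻¹ < c) (hc1 : c < 1) : ferniqueBound c < ∞ := by
  have hct : c < ∞ := hc1.trans ENNReal.one_lt_top
  have h1ct : 1 - c < ∞ := lt_top_of_lt (b := 2) (tsub_le_self.trans_lt (by simp))
  have h1c : 1 - c < c := by
    refine ENNReal.sub_lt_of_lt_add hc1.le ?_
    rw [← two_mul]
    rwa [inv_eq_one_div, ENNReal.div_lt_iff (by simp) (by simp), mul_comm] at hc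
  refine ENNReal.add_lt_top.mpr ⟨ENNReal.ofReal_lt_top, ?_⟩
  refine Summable.tsum_ofReal_lt_top <|
    Real.summable_exp_nat_mul_of_ge ?_ (fun i => mod_cast (Nat.lt_pow_self (by simp)).le)
  refine mul_neg_of_neg_of_pos (by simp) (Real.log_pos ?_)
  simp only [ENNReal.toReal_div, one_lt_div_iff, ENNReal.toReal_pos_iff, tsub_pos_iff_lt, hc1,
    h1ct, and_self, true_and]
  rw [ENNReal.toReal_lt_toReal h1ct.ne hct.ne]
  exact .inl h1c

variable {ι Ω : Type*} [MeasurableSpace Ω] {μ : Measure Ω} {U : ι → Ω → ℝ}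

/-- A Gaussian process that is bounded in probability on `A`, uniformly over the finite subsets of
`A`, has finite mean suprema on `A` at all scales (Fernique's theorem). -/
lemma supMean_const_mul_ne_top (hU : IsCenteredGaussian U μ) {A : Set ι} {a : ℝ} (ha : 0 < a)
    {c : ℝ≥0∞} (hc : 2⁻¹ < c) (hc1 : c < 1)
    (h : ∀ I : Finset ι, (I : Set ι) ⊆ A →
      c ≤ (μ.map fun ω => I.restrict (U · ω)) {x | ‖x‖ ≤ a}) (r : ℝ) :
    supMean (fun i ω => r * U i ω) μ A ≠ ∞ := by
  -- Fernique's theorem gives a bound for `exp (κ ‖x‖ ^ 2)` that does not depend on `I`.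
  set κ := Fernique.logRatio c * a⁻¹ ^ 2 with hκ
  have hκ0 : 0 < κ := mul_pos (Fernique.logRatio_pos hc hc1) (by positivity)
  set C := ENNReal.ofReal (Real.exp (r ^ 2 / (4 * κ))) * ferniqueBound c with hC
  have hCt : C ≠ ∞ := ENNReal.mul_ne_top ENNReal.ofReal_ne_top (ferniqueBound_lt_top hc hc1).ne
  refine ne_top_of_le_ne_top hCt (supMean_le_iff.2 fun I hI => ?_)
  have := (hU.gaussian.hasGaussianLaw I).isGaussian_map
  have hfern := lintegral_exp_mul_sq_norm_le_of_map_rotation_eq_self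
    (IsGaussian.map_rotation_eq_self (integral_id_eq_zero _ (hU.integral_map_restrict_eval I)) _)
    (h I hI) hc
  rw [lintegral_map' (by fun_prop) (hU.gaussian.hasGaussianLaw I).aemeasurable] at hfern
  refine le_trans ?_ (mul_le_mul_right hfern _)
  rw [← lintegral_const_mul'' _ (by
    have := (hU.gaussian.hasGaussianLaw I).aemeasurable
    fun_prop)]
  refine lintegral_mono fun ω => iSup₂_le fun i hi => ?_
  rw [← ENNReal.ofReal_mul (Real.exp_pos _).le, ← Real.exp_add]
  refine ENNReal.ofReal_le_ofReal (Real.exp_le_exp.2 ?_)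
  rw [← hκ]
  set n := ‖I.restrict (U · ω)‖ with hn
  have h1 : |U i ω| ≤ n := norm_le_pi_norm (I.restrict (U · ω)) ⟨i, hi⟩
  have h2 : r * U i ω ≤ |r| * n := by
    calc r * U i ω ≤ |r * U i ω| := le_abs_self _
      _ = |r| * |U i ω| := abs_mul _ _
      _ ≤ _ := by gcongr
  have h3 := variance_nonneg (fun ω => r * U i ω) μ
  have h4 : r ^ 2 / (4 * κ) + κ * n ^ 2 - |r| * n = (|r| - 2 * κ * n) ^ 2 / (4 * κ) := by
    rw [← sq_abs r]; field_simp; ring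
  have h5 : 0 ≤ (|r| - 2 * κ * n) ^ 2 / (4 * κ) := by positivity
  linarith

end

section

variable {Ω : Type*} [MeasurableSpace Ω] {B : ℝ → Ω → ℝ} {μ : Measure Ω}

/-- Local boundedness of the paths of the spectral process, with Fernique's theorem, gives finite
mean suprema on bounded sets. Only upper bounds on `B` are available directly; lower bounds in
probability come from the symmetry of `B`. -/
theorem supMean_Icc_ne_top (hB : HasStationaryVariogram B μ)
    (hcont : Tendsto (stdDev B μ) (𝓝 0) (𝓝 0))
    (hbdd : HasLocallyBoundedPaths (spectral B μ) μ) (r R : ℝ) :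
    supMean (fun t ω => r * B t ω) μ (Icc (-R) R) ≠ ∞ := by
  have := hB.isProbabilityMeasure
  obtain ⟨W, hW0, hW⟩ := hB.exists_stdDev_le hcont R
  set E : ℕ → Set Ω := fun n => {ω | ∀ t ∈ Icc (-R) R, spectral B μ t ω ≤ n} with hE
  have hEmono : Monotone E := fun n m hnm ω hω t ht =>
    (hω t ht).trans (by exact_mod_cast hnm)
  have hEun : μ (⋃ n, E n) = 1 := by
    rw [← measure_univ (μ := μ)]
    refine measure_congr (eventuallyEq_univ.2 ?_)
    filter_upwards [hbdd] with ω hω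
    obtain ⟨C, hC⟩ := (hω (Icc (-R) R) isCompact_Icc).exists_norm_le
    obtain ⟨n, hn⟩ := exists_nat_ge C
    exact mem_iUnion.2 ⟨n, fun t ht =>
      (le_abs_self _).trans ((hC _ (mem_image_of_mem _ ht)).trans hn)⟩
  rw [hEmono.measure_iUnion] at hEun
  have h78 : ENNReal.ofReal (7 / 8) < ⨆ n, μ (E n) := by
    rw [hEun, ← ENNReal.ofReal_one]
    exact (ENNReal.ofReal_lt_ofReal_iff one_pos).2 (by norm_num)
  obtain ⟨n, hn⟩ := lt_iSup_iff.1 h78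
  -- Off an event of probability `1 / 8`, `B ≤ a` on the interval; by symmetry `-a ≤ B` off another.
  set a := max 1 (Real.log (max n 1) + W ^ 2 / 2) with ha
  refine supMean_const_mul_ne_top hB.toIsCenteredGaussian (a := a)
    (lt_of_lt_of_le one_pos (le_max_left _ _)) (c := ENNReal.ofReal (3 / 4)) ?_ ?_ ?_ r
  · rw [ENNReal.lt_ofReal_iff_toReal_lt (by simp)]
    simp only [ENNReal.toReal_inv, ENNReal.toReal_ofNat]; norm_num
  · rw [← ENNReal.ofReal_one]
    exact (ENNReal.ofReal_lt_ofReal_iff one_pos).2 (by norm_num)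
  intro I hI
  set ρ := μ.map fun ω => I.restrict (B · ω) with hρ
  have hgl := hB.gaussian.hasGaussianLaw I
  have : IsGaussian ρ := hgl.isGaussian_map
  set S₁ : Set (I → ℝ) := {x | ∀ i, x i ≤ a} with hS₁
  set S₂ : Set (I → ℝ) := {x | ∀ i, -x i ≤ a} with hS₂
  have m₁ : MeasurableSet S₁ := by
    simp only [hS₁, ofPred_forall]
    exact MeasurableSet.iInter fun i => measurableSet_le (measurable_pi_apply i) measurable_const
  have m₂ : MeasurableSet S₂ := by
    simp only [hS₂, ofPred_forall]
    exact MeasurableSet.iInter fun i =>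
      measurableSet_le (measurable_pi_apply i).neg measurable_const
  have p₁ : ENNReal.ofReal (7 / 8) ≤ ρ S₁ := by
    rw [hρ, Measure.map_apply_of_aemeasurable hgl.aemeasurable m₁]
    refine hn.le.trans (measure_mono fun ω hω i => ?_)
    have h1 := hω i (hI i.2)
    have h2 : B i ω - stdDev B μ i ^ 2 / 2 ≤ Real.log (max n 1) := by
      rw [Real.le_log_iff_exp_le (by positivity)]
      exact h1.trans (le_max_left _ _)
    have h3 := pow_le_pow_left₀ (stdDev_nonneg B μ i) (hW i (hI i.2)) 2
    change B i ω ≤ a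
    exact le_trans (by linarith) (le_max_right _ _)
  have p₂ : ENNReal.ofReal (7 / 8) ≤ ρ S₂ := by
    refine p₁.trans (le_of_eq ?_)
    conv_lhs => rw [← map_neg_eq_self ρ (hB.integral_map_restrict_eval I)]
    rw [Measure.map_apply measurable_neg m₁]
    rfl
  have hsub : S₁ ∩ S₂ ⊆ {x | ‖x‖ ≤ a} := by
    intro x hx
    refine (pi_norm_le_iff_of_nonneg (by positivity)).2 fun i => abs_le.2 ⟨?_, hx.1 i⟩
    linarith [hx.2 i]
  refine le_trans ?_ (measure_mono hsub)
  have h := measure_union_add_inter (μ := ρ) S₁ m₂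
  have h1 : ρ (S₁ ∪ S₂) ≤ 1 := prob_le_one
  rw [ENNReal.ofReal_le_iff_le_toReal (measure_ne_top _ _)] at p₁ p₂ ⊢
  have h' := congrArg ENNReal.toReal h
  rw [ENNReal.toReal_add (measure_ne_top _ _) (measure_ne_top _ _),
    ENNReal.toReal_add (measure_ne_top _ _) (measure_ne_top _ _)] at h'
  have h1' : (ρ (S₁ ∪ S₂)).toReal ≤ 1 :=
    ENNReal.toReal_le_of_le_ofReal zero_le_one (by simpa using h1)
  linarith

end

/-! ### The Laplace functional of a Poisson point process -/

lemma hasSum_poisson_mul_pow (r : ℝ) (a : ℝ) :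
    HasSum (fun n : ℕ => Real.exp (-r) * r ^ n / (n.factorial : ℝ) * a ^ n)
      (Real.exp (-((1 - a) * r))) := by
  have h := (NormedSpace.expSeries_div_hasSum_exp (𝔸 := ℝ) (r * a)).mul_left (Real.exp (-r))
  rw [← Real.exp_eq_exp_ℝ, ← Real.exp_add] at h
  rw [show -((1 - a) * r) = -r + r * a by ring]
  refine (funext fun n => ?_ : (fun n : ℕ => _) = _) ▸ h
  rw [mul_pow]
  ring

lemma lintegral_rpow_poisson {r : ℝ≥0} {c : ℝ≥0∞} (hc : c ≤ 1) :
    ∫⁻ n : ℕ, (1 - c) ^ (((n : ℝ≥0∞)).toReal) ∂(poissonMeasure r) =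
      ENNReal.ofReal (Real.exp (-(c * r).toReal)) := by
  have hc' : c ≠ ∞ := ne_top_of_le_ne_top ENNReal.one_ne_top hc
  have h1c : 1 - c = ENNReal.ofReal (1 - c.toReal) := by
    rw [ENNReal.ofReal_sub _ ENNReal.toReal_nonneg, ENNReal.ofReal_one, ENNReal.ofReal_toReal hc']
  have h0 : 0 ≤ 1 - c.toReal := by
    have := ENNReal.toReal_mono ENNReal.one_ne_top hc
    simp at this
    linarith
  have h := hasSum_poisson_mul_pow r (1 - c.toReal)
  rw [poissonMeasure, lintegral_sum_measure, ENNReal.toReal_mul, ENNReal.coe_toReal,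
    show c.toReal * (r : ℝ) = (1 - (1 - c.toReal)) * r by ring, ← h.tsum_eq,
    ENNReal.ofReal_tsum_of_nonneg (fun n => by positivity) h.summable]
  refine tsum_congr fun n => ?_
  rw [lintegral_smul_measure, lintegral_dirac, ENNReal.toReal_natCast, ENNReal.rpow_natCast, h1c,
    smul_eq_mul, ENNReal.ofReal_mul (by positivity), ENNReal.ofReal_pow h0]

lemma countingMeasure_apply {Ω : Type*} (p : ℕ → Ω → ℝ) (ω : Ω) {A : Set ℝ} (hA : MeasurableSet A) :
    countingMeasure p ω A = ({k | p k ω ∈ A} : Set ℕ).encard := by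
  rw [countingMeasure, Measure.sum_apply _ hA, ← Measure.count_apply MeasurableSet.of_discrete,
    Measure.count, Measure.sum_apply _ MeasurableSet.of_discrete]
  refine tsum_congr fun k => ?_
  rw [Measure.dirac_apply' _ hA, Measure.dirac_apply]
  rfl

variable {Ω : Type*} [MeasurableSpace Ω] {Q : Measure Ω} {p : ℕ → Ω → ℝ} {ν : Measure ℝ}

namespace IsPoissonPointProcess

lemma measurable_countingMeasure (hp : IsPoissonPointProcess p ν Q) {A : Set ℝ}
    (hA : MeasurableSet A) : Measurable fun ω => countingMeasure p ω A := by
  simp only [countingMeasure, Measure.sum_apply _ hA, Measure.dirac_apply' _ hA]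
  exact Measurable.tsum fun k =>
    (measurable_one.indicator hA).comp (hp.measurable k)

lemma lintegral_rpow_countingMeasure (hp : IsPoissonPointProcess p ν Q) {A : Set ℝ}
    (hA : MeasurableSet A) (hν : ν A ≠ ∞) {c : ℝ≥0∞} (hc : c ≤ 1) :
    ∫⁻ ω, (1 - c) ^ (countingMeasure p ω A).toReal ∂Q =
      ENNReal.ofReal (Real.exp (-(c * ν A).toReal)) := by
  have hm : Measurable fun N : ℝ≥0∞ => (1 - c) ^ N.toReal := by fun_prop
  rw [(hp.hasLaw A hA hν).lintegral_comp hm.aemeasurable,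
    lintegral_map hm (by fun_prop), lintegral_rpow_poisson hc, ENNReal.coe_toNNReal hν]

lemma ae_countingMeasure_ne_top (hp : IsPoissonPointProcess p ν Q) {A : Set ℝ}
    (hA : MeasurableSet A) (hν : ν A ≠ ∞) : ∀ᵐ ω ∂Q, countingMeasure p ω A ≠ ∞ := by
  have h : ∀ᵐ N ∂((poissonMeasure (ν A).toNNReal).map (Nat.cast : ℕ → ℝ≥0∞)), N ≠ ∞ := by
    rw [ae_map_iff (by fun_prop) (by measurability)]
    exact Eventually.of_forall fun n => ENNReal.natCast_ne_top n
  rw [← (hp.hasLaw A hA hν).map_eq] at h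
  exact ae_of_ae_map (hp.hasLaw A hA hν).aemeasurable h

end IsPoissonPointProcess

/-- Grouping the points of a sequence by the value of a simple function: the infinite product
`∏ₖ (1 - g(uₖ))` has only finitely many factors different from `1`. -/
lemma iInf_prod_one_sub_simpleFunc {Ω : Type*} (p : ℕ → Ω → ℝ) (ω : Ω) (g : SimpleFunc ℝ ℝ≥0∞)
    (hN : ∀ c ∈ g.range.filter (· ≠ 0), countingMeasure p ω (g ⁻¹' {c}) ≠ ∞) :
    ⨅ n, ∏ k ∈ Finset.range n, (1 - g (p k ω)) =
      ∏ c ∈ g.range.filter (· ≠ 0), (1 - c) ^ (countingMeasure p ω (g ⁻¹' {c})).toReal := by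
  classical
  set s := g.range.filter (· ≠ 0) with hs
  have hfin : ∀ c ∈ s, ({k | g (p k ω) = c} : Set ℕ).Finite := by
    intro c hc
    have h := hN c hc
    rw [countingMeasure_apply p ω (g.measurableSet_fiber c)] at h
    have h2 : ({k | p k ω ∈ g ⁻¹' {c}} : Set ℕ).encard ≠ ⊤ := by
      intro h3
      rw [h3] at h
      simp at h
    exact Set.encard_ne_top_iff.1 h2
  have hS : ({k | g (p k ω) ≠ 0} : Set ℕ).Finite := by
    refine (s.finite_toSet.biUnion hfin).subset fun k hk => ?_
    simp only [mem_iUnion]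
    exact ⟨g (p k ω), by simpa [hs] using hk, rfl⟩
  set S := hS.toFinset with hSdef
  have hmem : ∀ k, k ∈ S ↔ g (p k ω) ≠ 0 := fun k => by simp [hSdef]
  have hprod : ∏ k ∈ S, (1 - g (p k ω)) =
      ∏ c ∈ s, (1 - c) ^ (countingMeasure p ω (g ⁻¹' {c})).toReal := by
    rw [← Finset.prod_fiberwise_of_maps_to (t := s) (g := fun k => g (p k ω))
      (fun k hk => by simpa [hs] using (hmem k).1 hk)]
    refine Finset.prod_congr rfl fun c hc => ?_
    have hc0 : c ≠ 0 := (Finset.mem_filter.1 hc).2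
    rw [Finset.prod_congr rfl fun k hk => by rw [(Finset.mem_filter.1 hk).2], Finset.prod_const,
      countingMeasure_apply p ω (g.measurableSet_fiber c), ← ENNReal.rpow_natCast]
    congr 1
    have : ({k | p k ω ∈ g ⁻¹' {c}} : Set ℕ) = ↑(S.filter fun k => g (p k ω) = c) := by
      ext k
      simp only [mem_preimage, mem_singleton_iff, Finset.coe_filter, hmem]
      exact ⟨fun h => ⟨by rw [show g (p k ω) = c from h]; exact hc0, h⟩, fun h => h.2⟩
    rw [this, Set.encard_coe_eq_coe_finsetCard]
    simp
  obtain ⟨n₀, hn₀⟩ : ∃ n₀, S ⊆ Finset.range n₀ := S.exists_nat_subset_range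
  refine le_antisymm ?_ (le_iInf fun n => ?_)
  · refine (iInf_le _ n₀).trans_eq ?_
    rw [← hprod]
    refine (Finset.prod_subset hn₀ fun k _ hk => ?_).symm
    rw [hmem, not_not] at hk
    simp [hk]
  · have : ∏ k ∈ S, (1 - g (p k ω)) = ∏ k ∈ Finset.range (max n n₀), (1 - g (p k ω)) := by
      refine Finset.prod_subset (hn₀.trans (Finset.range_mono (le_max_right _ _)))
        fun k _ hk => ?_
      rw [hmem, not_not] at hk
      simp [hk]
    rw [← hprod, this]
    exact Finset.prod_le_prod_of_subset_of_le_one' (Finset.range_mono (le_max_left _ _))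
      fun k _ _ => tsub_le_self

namespace IsPoissonPointProcess

lemma lintegral_iInf_prod_one_sub_simpleFunc [IsProbabilityMeasure Q]
    (hp : IsPoissonPointProcess p ν Q) (g : SimpleFunc ℝ ℝ≥0∞) (hg : ∀ u, g u ≤ 1)
    (hν : ∫⁻ u, g u ∂ν ≠ ∞) :
    ∫⁻ ω, ⨅ n, ∏ k ∈ Finset.range n, (1 - g (p k ω)) ∂Q =
      ENNReal.ofReal (Real.exp (-(∫⁻ u, g u ∂ν).toReal)) := by
  classical
  set s := g.range.filter (· ≠ 0) with hs
  have hint : ∫⁻ u, g u ∂ν = ∑ c ∈ s, c * ν (g ⁻¹' {c}) := by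
    rw [SimpleFunc.lintegral_eq_lintegral, SimpleFunc.lintegral, hs, Finset.sum_filter]
    refine Finset.sum_congr rfl fun c _ => ?_
    split_ifs with h
    · rfl
    · rw [not_not.1 h, zero_mul]
  have hle : ∀ c ∈ s, c ≤ 1 := by
    intro c hc
    obtain ⟨u, rfl⟩ := SimpleFunc.mem_range.1 (Finset.mem_filter.1 hc).1
    exact hg u
  have hcν : ∀ c ∈ s, c * ν (g ⁻¹' {c}) ≠ ∞ := fun c hc =>
    ne_top_of_le_ne_top (hint ▸ hν)
      (Finset.single_le_sum (f := fun c => c * ν (g ⁻¹' {c})) (fun _ _ => zero_le) hc)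
  have hνA : ∀ c ∈ s, ν (g ⁻¹' {c}) ≠ ∞ := by
    intro c hc h
    refine hcν c hc ?_
    rw [h, ENNReal.mul_top (Finset.mem_filter.1 hc).2]
  have hae : ∀ᵐ ω ∂Q, ∀ c ∈ s, countingMeasure p ω (g ⁻¹' {c}) ≠ ∞ :=
    (Finset.eventually_all s).2 fun c hc =>
      hp.ae_countingMeasure_ne_top (g.measurableSet_fiber c) (hνA c hc)
  rw [lintegral_congr_ae (hae.mono fun ω h => iInf_prod_one_sub_simpleFunc p ω g h)]
  have hind : iIndepFun (fun (c : s) ω => (1 - (c : ℝ≥0∞)) ^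
      (countingMeasure p ω (g ⁻¹' {(c : ℝ≥0∞)})).toReal) Q := by
    -- Independence is available for families indexed by `Fin n`.
    have h := hp.indep s.card (fun i => g ⁻¹' {((s.equivFin.symm i : s) : ℝ≥0∞)})
      (fun i => g.measurableSet_fiber _) fun i j hij => by
        refine Disjoint.preimage _ (disjoint_singleton.2 fun h => hij ?_)
        exact s.equivFin.symm.injective (Subtype.ext h)
    have h2 := h.precomp s.equivFin.injective
    simp only [Equiv.symm_apply_apply] at h2
    exact h2.comp (fun c N => (1 - (c : ℝ≥0∞)) ^ N.toReal) fun c => by fun_prop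
  have hprod : ∀ ω, ∏ c ∈ s, (1 - c) ^ (countingMeasure p ω (g ⁻¹' {c})).toReal =
      ∏ c : s, (1 - (c : ℝ≥0∞)) ^ (countingMeasure p ω (g ⁻¹' {(c : ℝ≥0∞)})).toReal := fun ω =>
    (Finset.prod_attach s (fun c => (1 - c) ^ (countingMeasure p ω (g ⁻¹' {c})).toReal)).symm
  rw [lintegral_congr hprod]
  rw [lintegral_prod_eq_prod_lintegral_of_indepFun Finset.univ _ hind fun c => by
    have := hp.measurable_countingMeasure (g.measurableSet_fiber (c : ℝ≥0∞))
    fun_prop]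
  rw [hint, ENNReal.toReal_sum hcν, ← Finset.sum_neg_distrib, Real.exp_sum,
    ENNReal.ofReal_prod_of_nonneg fun _ _ => (Real.exp_pos _).le, Finset.univ_eq_attach,
    ← Finset.prod_attach s]
  refine Finset.prod_congr rfl fun c _ => ?_
  exact hp.lintegral_rpow_countingMeasure (g.measurableSet_fiber _) (hνA c c.2) (hle c c.2)

/-- The Laplace functional of a Poisson point process with intensity `ν`:
`E[∏ₖ (1 - f(pₖ))] = exp (-∫ f dν)`. -/
theorem lintegral_iInf_prod_one_sub [IsProbabilityMeasure Q]
    (hp : IsPoissonPointProcess p ν Q) {f : ℝ → ℝ≥0∞} (hf : Measurable f) (hf1 : ∀ u, f u ≤ 1)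
    (hν : ∫⁻ u, f u ∂ν ≠ ∞) :
    ∫⁻ ω, ⨅ n, ∏ k ∈ Finset.range n, (1 - f (p k ω)) ∂Q =
      ENNReal.ofReal (Real.exp (-(∫⁻ u, f u ∂ν).toReal)) := by
  -- Approximate `f` by simple functions from below; the infima over `n` and `m` commute.
  set g := SimpleFunc.eapprox f with hgdef
  have hgmono : Monotone g := SimpleFunc.monotone_eapprox f
  have hgf : ∀ n u, g n u ≤ f u := fun n u => by
    rw [← SimpleFunc.iSup_eapprox_apply hf u]
    exact le_iSup (fun n => g n u) n
  have hgt : ∀ u, Tendsto (fun n => g n u) atTop (𝓝 (f u)) := fun u => by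
    rw [← SimpleFunc.iSup_eapprox_apply hf u]
    exact tendsto_atTop_iSup fun m n hmn => hgmono hmn u
  have hgint : ∀ n, ∫⁻ u, g n u ∂ν ≠ ∞ := fun n =>
    ne_top_of_le_ne_top hν (lintegral_mono (hgf n))
  set F : ℕ → Ω → ℝ≥0∞ := fun m ω => ⨅ n, ∏ k ∈ Finset.range n, (1 - g m (p k ω)) with hF
  have hFanti : Antitone F := fun m m' hm ω =>
    iInf_mono fun n => Finset.prod_le_prod' fun k _ => tsub_le_tsub_left (hgmono hm _) _
  have hFmeas : ∀ m, Measurable (F m) := fun m =>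
    Measurable.iInf fun n => Finset.measurable_prod _ fun k _ =>
      measurable_const.sub ((g m).measurable.comp (hp.measurable k))
  have hF0 : ∫⁻ ω, F 0 ω ∂Q ≠ ∞ := by
    rw [hp.lintegral_iInf_prod_one_sub_simpleFunc (g 0) (fun u => (hgf 0 u).trans (hf1 u))
      (hgint 0)]
    exact ENNReal.ofReal_ne_top
  have hswap : ∀ ω, ⨅ n, ∏ k ∈ Finset.range n, (1 - f (p k ω)) = ⨅ m, F m ω := by
    intro ω
    rw [hF, iInf_comm]
    refine iInf_congr fun n => ?_
    refine (iInf_eq_of_tendsto (fun m m' hm => ?_) ?_).symm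
    · exact Finset.prod_le_prod' fun k _ => tsub_le_tsub_left (hgmono hm _) _
    · refine ENNReal.tendsto_finsetProd_of_ne_top _ (fun k _ => ?_) fun k _ => ?_
      · exact ENNReal.Tendsto.sub tendsto_const_nhds (hgt _) (Or.inl ENNReal.one_ne_top)
      · exact ne_top_of_le_ne_top ENNReal.one_ne_top tsub_le_self
  simp_rw [hswap]
  rw [lintegral_iInf hFmeas hFanti hF0]
  refine iInf_eq_of_tendsto (fun m m' hm => lintegral_mono (hFanti hm)) ?_
  have h1 : ∀ m, ∫⁻ ω, F m ω ∂Q = ENNReal.ofReal (Real.exp (-(∫⁻ u, g m u ∂ν).toReal)) :=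
    fun m => hp.lintegral_iInf_prod_one_sub_simpleFunc (g m) (fun u => (hgf m u).trans (hf1 u))
      (hgint m)
  simp_rw [h1]
  have h2 : Tendsto (fun m => ∫⁻ u, g m u ∂ν) atTop (𝓝 (∫⁻ u, f u ∂ν)) :=
    lintegral_tendsto_of_tendsto_of_monotone (fun m => (g m).measurable.aemeasurable)
      (Eventually.of_forall fun u m m' hm => hgmono hm u) (Eventually.of_forall hgt)
  exact ENNReal.tendsto_ofReal
    ((Real.continuous_exp.tendsto _).comp ((ENNReal.tendsto_toReal hν).comp h2).neg)

end IsPoissonPointProcess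

/-! ### Finite-dimensional distributions of a max-stable process -/

lemma frechetIntensity_Ioi {a : ℝ} (ha : 0 < a) :
    frechetIntensity (Ioi a) = ENNReal.ofReal a⁻¹ := by
  have hIoi : Ioi a ∩ Ioi (0 : ℝ) = Ioi a := inter_eq_left.2 (Ioi_subset_Ioi ha.le)
  rw [frechetIntensity, withDensity_apply _ measurableSet_Ioi,
    Measure.restrict_restrict measurableSet_Ioi, hIoi]
  have hcongr : ∀ u ∈ Ioi a, ENNReal.ofReal (1 / u ^ 2) = ENNReal.ofReal (u ^ (-2 : ℝ)) := by
    intro u hu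
    rw [Real.rpow_neg (ha.trans hu).le, one_div]
    norm_cast
  rw [setLIntegral_congr_fun measurableSet_Ioi hcongr,
    ← ofReal_integral_eq_lintegral_ofReal (integrableOn_Ioi_rpow_of_lt (by norm_num) ha)
      ((ae_restrict_iff' measurableSet_Ioi).2 (Eventually.of_forall fun u hu =>
        Real.rpow_nonneg (ha.trans hu).le _)),
    integral_Ioi_rpow_of_lt (by norm_num) ha]
  congr 1
  rw [show (-2 : ℝ) + 1 = -1 by norm_num, Real.rpow_neg_one]
  ring

lemma frechetIntensity_Iic_zero : frechetIntensity (Iic 0) = 0 := by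
  rw [frechetIntensity, withDensity_apply _ measurableSet_Iic,
    Measure.restrict_restrict measurableSet_Iic, Iic_inter_Ioi, Ioc_self]
  simp

instance : SFinite frechetIntensity := by
  unfold frechetIntensity
  infer_instance

/-- On the support `(0, ∞)` of the intensity, only the largest `z i` matters. -/
lemma frechetIntensity_setOf_exists_lt_mul {ι : Type*} [Fintype ι] (z : ι → ℝ) {x : ℝ}
    (hx : 0 < x) :
    frechetIntensity {u | ∃ i, x < u * z i} = (⨆ i, ENNReal.ofReal (z i)) / ENNReal.ofReal x := by
  rcases isEmpty_or_nonempty ι with hι | hι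
  · simp
  obtain ⟨j, hj⟩ := Finite.exists_max z
  have hsup : ⨆ i, ENNReal.ofReal (z i) = ENNReal.ofReal (z j) :=
    le_antisymm (iSup_le fun i => ENNReal.ofReal_le_ofReal (hj i)) (le_iSup (fun i => ENNReal.ofReal (z i)) j)
  rw [hsup]
  have hpos : {u | ∃ i, x < u * z i} =ᵐ[frechetIntensity] {u | 0 < u ∧ x < u * z j} := by
    have h0 : ∀ᵐ u ∂frechetIntensity, 0 < u := by
      rw [ae_iff]
      simpa [Iic_def] using frechetIntensity_Iic_zero
    refine h0.mono fun u hu => propext ⟨fun ⟨i, hi⟩ => ⟨hu, hi.trans_le ?_⟩, fun h => ⟨j, h.2⟩⟩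
    exact mul_le_mul_of_nonneg_left (hj i) hu.le
  rw [measure_congr hpos]
  rcases le_or_gt (z j) 0 with hz | hz
  · have : {u : ℝ | 0 < u ∧ x < u * z j} = ∅ := by
      refine eq_empty_of_forall_notMem fun u hu => ?_
      nlinarith [hu.1, hu.2]
    rw [this, measure_empty, ENNReal.ofReal_of_nonpos hz, ENNReal.zero_div]
  · have : {u : ℝ | 0 < u ∧ x < u * z j} = Ioi (x / z j) := by
      ext u
      simp only [mem_ofPred_eq, mem_Ioi, div_lt_iff₀ hz]
      exact ⟨fun h => h.2, fun h => ⟨pos_of_mul_pos_left (hx.trans h) hz.le, h⟩⟩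
    rw [this, frechetIntensity_Ioi (div_pos hx hz), inv_div, ENNReal.ofReal_div_of_pos hx]

variable {Ω Ω' Ω₀ : Type*} [MeasurableSpace Ω] [MeasurableSpace Ω'] [MeasurableSpace Ω₀]
  {μ : Measure Ω} {Q : Measure Ω'} {P : Measure Ω₀} {p : ℕ → Ω' → ℝ} {Y : ℕ → ℝ → Ω' → ℝ}
  {Z : ℝ → Ω → ℝ} {B : ℝ → Ω → ℝ} {X : ℝ → Ω₀ → ℝ}

lemma lintegral_map_restrict_frechetIntensity {ι : Type*} [Fintype ι] {ρ : Measure (ι → ℝ)}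
    [SFinite ρ] {x : ℝ} (hx : 0 < x) :
    ∫⁻ u, ρ {z | ∃ i, x < u * z i} ∂frechetIntensity =
      (∫⁻ z, ⨆ i, ENNReal.ofReal (z i) ∂ρ) / ENNReal.ofReal x := by
  have hS : MeasurableSet {q : ℝ × (ι → ℝ) | ∃ i, x < q.1 * q.2 i} := by
    simp only [ofPred_exists]
    exact MeasurableSet.iUnion fun i => measurableSet_lt measurable_const (by fun_prop)
  have h1 := Measure.prod_apply (μ := frechetIntensity) (ν := ρ) hS
  have h2 := Measure.prod_apply_symm (μ := frechetIntensity) (ν := ρ) hS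
  have h3 : ∫⁻ u, ρ {z | ∃ i, x < u * z i} ∂frechetIntensity =
      ∫⁻ z, frechetIntensity {u | ∃ i, x < u * z i} ∂ρ := h1.symm.trans h2
  rw [h3]
  simp_rw [frechetIntensity_setOf_exists_lt_mul _ hx, div_eq_mul_inv]
  exact lintegral_mul_const _ (Measurable.iSup fun i => by fun_prop)

namespace IsDeHaanSystem

/-- Conditionally on the points `p = q`, the probability that all the processes `q k * Y k` stay
below `x` on `I` is the product of the individual ones. -/
lemma measure_forall_mul_le [IsProbabilityMeasure Q] (hS : IsDeHaanSystem p Y Q Z μ)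
    (I : Finset ℝ) (x : ℝ) (q : ℕ → ℝ) :
    Q {ω | ∀ k, ∀ t : I, q k * Y k t ω ≤ x} =
      ⨅ n, ∏ k ∈ Finset.range n,
        (1 - μ.map (fun ω => I.restrict (Z · ω)) {z | ∃ t : I, x < q k * z t}) := by
  set ρ := μ.map (fun ω => I.restrict (Z · ω)) with hρ
  set A : ℕ → Set Ω' := fun k => {ω | ∀ t : I, q k * Y k t ω ≤ x} with hA
  have hmeasT : ∀ u : ℝ, MeasurableSet {z : I → ℝ | ∀ t : I, u * z t ≤ x} := fun u => by
    simp only [ofPred_forall]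
    exact MeasurableSet.iInter fun t => measurableSet_le (by fun_prop) measurable_const
  have hprobρ : IsProbabilityMeasure ρ := by
    rw [hρ, ← (hS.copies 0 I).map_eq]
    exact Measure.isProbabilityMeasure_map (hS.copies 0 I).aemeasurable_fst
  have hQA : ∀ k, Q (A k) = 1 - ρ {z | ∃ t : I, x < q k * z t} := by
    intro k
    have h1 : Q (A k) = ρ {z | ∀ t : I, q k * z t ≤ x} := by
      rw [hρ, ← (hS.copies k I).map_eq,
        Measure.map_apply_of_aemeasurable (hS.copies k I).aemeasurable_fst (hmeasT _)]
      rfl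
    have h2 : {z : I → ℝ | ∀ t : I, q k * z t ≤ x} = {z | ∃ t : I, x < q k * z t}ᶜ := by
      ext z
      simp
    have h3 : MeasurableSet {z : I → ℝ | ∃ t : I, x < q k * z t} := by
      rw [← compl_compl {z : I → ℝ | ∃ t : I, x < q k * z t}, ← h2]
      exact (hmeasT _).compl
    rw [h1, h2, prob_compl_eq_one_sub h3]
  have hAmeas : ∀ k, MeasurableSet (A k) := fun k => by
    simp only [hA, ofPred_forall]
    exact MeasurableSet.iInter fun t =>
      measurableSet_le ((hS.measurable k t).const_mul _) measurable_const
  have hset : {ω | ∀ k, ∀ t : I, q k * Y k t ω ≤ x} = ⋂ n, ⋂ k ∈ Finset.range n, A k := by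
    ext ω
    simp only [mem_ofPred_eq, mem_iInter, hA, Finset.mem_range]
    exact ⟨fun h n k _ => h k, fun h k => h (k + 1) k (Nat.lt_succ_self k)⟩
  have hanti : Antitone fun n => ⋂ k ∈ Finset.range n, A k := fun m n hmn =>
    biInter_subset_biInter_left fun k hk => Finset.range_mono hmn hk
  rw [hset, hanti.measure_iInter
    (fun n => (Finset.measurableSet_biInter _ fun k _ => hAmeas k).nullMeasurableSet)
    ⟨0, measure_ne_top _ _⟩]
  refine iInf_congr fun n => ?_
  rw [hS.indep_copies.meas_biInter fun k _ => ?_]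
  · exact Finset.prod_congr rfl fun k _ => hQA k
  · refine ⟨{y : ℝ → ℝ | ∀ t : I, q k * y t ≤ x}, ?_, rfl⟩
    simp only [ofPred_forall]
    exact MeasurableSet.iInter fun t =>
      measurableSet_le ((measurable_pi_apply (t : ℝ)).const_mul _) measurable_const

/-- De Haan's formula: the probability that `sup_k p k * Y k t ≤ x` for all `t ∈ I` is
`exp (-E[max_{t ∈ I} Z t] / x)`. -/
theorem measure_forall_le [IsProbabilityMeasure Q] (hS : IsDeHaanSystem p Y Q Z μ)
    (I : Finset ℝ) {x : ℝ} (hx : 0 < x)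
    (hfin : ∫⁻ ω, ⨆ t ∈ I, ENNReal.ofReal (Z t ω) ∂μ ≠ ∞) :
    Q {ω | ∀ k, ∀ t ∈ I, p k ω * Y k t ω ≤ x} =
      ENNReal.ofReal (Real.exp
        (-((∫⁻ ω, ⨆ t ∈ I, ENNReal.ofReal (Z t ω) ∂μ) / ENNReal.ofReal x).toReal)) := by
  set ρ := μ.map (fun ω => I.restrict (Z · ω)) with hρ
  have hprobρ : IsProbabilityMeasure ρ := by
    rw [hρ, ← (hS.copies 0 I).map_eq]
    exact Measure.isProbabilityMeasure_map (hS.copies 0 I).aemeasurable_fst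
  have hmean : ∫⁻ z, ⨆ t : I, ENNReal.ofReal (z t) ∂ρ = ∫⁻ ω, ⨆ t ∈ I, ENNReal.ofReal (Z t ω) ∂μ := by
    rw [hρ, lintegral_map' (Measurable.iSup fun i => by fun_prop).aemeasurable
      (hS.copies 0 I).aemeasurable_snd]
    refine lintegral_congr fun ω => ?_
    rw [iSup_subtype']
    rfl
  set f : ℝ → ℝ≥0∞ := fun u => ρ {z | ∃ t : I, x < u * z t} with hf
  have hfmeas : Measurable f := by
    have hS : MeasurableSet {q : ℝ × (I → ℝ) | ∃ t, x < q.1 * q.2 t} := by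
      simp only [ofPred_exists]
      exact MeasurableSet.iUnion fun i => measurableSet_lt measurable_const (by fun_prop)
    exact measurable_measure_prodMk_left hS
  have hfint : ∫⁻ u, f u ∂frechetIntensity =
      (∫⁻ ω, ⨆ t ∈ I, ENNReal.ofReal (Z t ω) ∂μ) / ENNReal.ofReal x := by
    rw [← hmean]
    exact lintegral_map_restrict_frechetIntensity hx
  have hlap := hS.poisson.lintegral_iInf_prod_one_sub hfmeas (fun u => prob_le_one) (by
    rw [hfint]
    exact ENNReal.div_ne_top hfin (ENNReal.ofReal_pos.2 hx).ne')
  rw [hfint] at hlap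
  rw [← hlap]
  -- Condition on the points, which are independent of the processes.
  set pp : Ω' → ℕ → ℝ := fun ω k => p k ω with hpp
  set YI : Ω' → ℕ → I → ℝ := fun ω k t => Y k t ω with hYI
  have hppm : Measurable pp := measurable_pi_lambda _ hS.poisson.measurable
  have hYIm : Measurable YI := measurable_pi_lambda _ fun k => measurable_pi_lambda _ fun t =>
    hS.measurable k t
  have hind : IndepFun pp YI Q := by
    have hr : Measurable fun (y : ℕ → ℝ → ℝ) (k : ℕ) (t : I) => y k t :=
      measurable_pi_lambda _ fun k => measurable_pi_lambda _ fun t =>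
        (measurable_pi_apply (t : ℝ)).comp (measurable_pi_apply k)
    exact hS.indep_points.comp measurable_id hr
  have hjoint := (indepFun_iff_map_prod_eq_prod_map_map hppm.aemeasurable hYIm.aemeasurable).1 hind
  have hT : MeasurableSet {r : (ℕ → ℝ) × (ℕ → I → ℝ) | ∀ k, ∀ t, r.1 k * r.2 k t ≤ x} := by
    simp only [ofPred_forall]
    refine MeasurableSet.iInter fun k => MeasurableSet.iInter fun t =>
      measurableSet_le (Measurable.mul ?_ ?_) measurable_const
    · exact (measurable_pi_apply k).comp measurable_fst
    · exact (measurable_pi_apply t).comp ((measurable_pi_apply k).comp measurable_snd)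
  have h1 : Q {ω | ∀ k, ∀ t ∈ I, p k ω * Y k t ω ≤ x} =
      Q.map (fun ω => (pp ω, YI ω)) {r | ∀ k, ∀ t, r.1 k * r.2 k t ≤ x} := by
    rw [Measure.map_apply (hppm.prodMk hYIm) hT]
    congr 1
    ext ω
    simp [hpp, hYI]
  have : IsProbabilityMeasure (Q.map YI) := Measure.isProbabilityMeasure_map hYIm.aemeasurable
  rw [h1, hjoint, Measure.prod_apply hT, lintegral_map (measurable_measure_prodMk_left hT) hppm]
  refine lintegral_congr fun ω => ?_
  rw [Measure.map_apply hYIm (measurable_prodMk_left hT)]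
  exact hS.measure_forall_mul_le I x (pp ω)

end IsDeHaanSystem

/-- The finite-dimensional distributions of a max-stable process with spectral process `Z`. -/
theorem IsMaxStableWithSpectral.measure_forall_le (hX : IsMaxStableWithSpectral X P Z μ)
    (I : Finset ℝ) {x : ℝ} (hx : 0 < x)
    (hfin : ∫⁻ ω, ⨆ t ∈ I, ENNReal.ofReal (Z t ω) ∂μ ≠ ∞) :
    P {ω | ∀ t ∈ I, X t ω ≤ x} =
      ENNReal.ofReal (Real.exp
        (-((∫⁻ ω, ⨆ t ∈ I, ENNReal.ofReal (Z t ω) ∂μ) / ENNReal.ofReal x).toReal)) := by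
  obtain ⟨Ω', _, Q, p, Y, hQ, hS, hfidi⟩ := hX
  set m := ∫⁻ ω, ⨆ t ∈ I, ENNReal.ofReal (Z t ω) ∂μ with hm
  have hT : MeasurableSet {z : I → ℝ | ∀ t, z t ≤ x} := by
    simp only [ofPred_forall]
    exact MeasurableSet.iInter fun t => measurableSet_le (measurable_pi_apply t) measurable_const
  have h1 := (hfidi I).measure_mem_eq hT
  have h2 : P {ω | ∀ t ∈ I, X t ω ≤ x} = Q {ω | ∀ t ∈ I, ⨆ k, p k ω * Y k t ω ≤ x} := by
    convert h1 using 2 <;> · ext ω; simp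
  rw [h2, ← hS.measure_forall_le I hx hfin]
  -- Almost surely the suprema over `k` are those of bounded sequences.
  set G : ℕ → Set Ω' := fun n => {ω | ∀ k, ∀ t ∈ I, p k ω * Y k t ω ≤ (n : ℝ) + 1} with hG
  have hGmono : Monotone G := fun n n' hn ω h k t ht => (h k t ht).trans (by gcongr)
  have hGmeas : ∀ n, MeasurableSet (G n) := fun n => by
    simp only [hG, ofPred_forall]
    exact MeasurableSet.iInter fun k => I.measurableSet_biInter fun t _ =>
      measurableSet_le ((hS.poisson.measurable k).mul (hS.measurable k t)) measurable_const
  have hlim : Tendsto (fun n => Q (G n)) atTop (𝓝 1) := by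
    have h3 : Tendsto (fun n : ℕ => (m / ENNReal.ofReal ((n : ℝ) + 1)).toReal) atTop (𝓝 0) := by
      have h4 := (tendsto_const_div_atTop_nhds_zero_nat m.toReal).comp (tendsto_add_atTop_nat 1)
      refine h4.congr fun n => ?_
      rw [ENNReal.toReal_div, ENNReal.toReal_ofReal (by positivity)]
      simp
    have h5 := ENNReal.tendsto_ofReal ((Real.continuous_exp.tendsto _).comp h3.neg)
    simp only [neg_zero, Real.exp_zero, ENNReal.ofReal_one] at h5
    exact h5.congr fun n => (hS.measure_forall_le I (by positivity) hfin).symm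
  have hunion : Q (⋃ n, G n) = 1 :=
    tendsto_nhds_unique (tendsto_measure_iUnion_atTop hGmono) hlim
  have hae : ∀ᵐ ω ∂Q, ω ∈ ⋃ n, G n := by
    rw [← mem_ae_iff_prob_eq_one (MeasurableSet.iUnion hGmeas)] at hunion
    exact hunion
  refine measure_congr (hae.mono fun ω hω => propext ?_)
  obtain ⟨n, hn⟩ := mem_iUnion.1 hω
  have hbdd : ∀ t ∈ I, BddAbove (range fun k => p k ω * Y k t ω) := fun t ht =>
    ⟨(n : ℝ) + 1, by rintro _ ⟨k, rfl⟩; exact hn k t ht⟩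
  exact ⟨fun h k t ht => (le_ciSup (hbdd t ht) k).trans (h t ht),
    fun h t ht => ciSup_le fun k => h k t ht⟩

lemma ofReal_spectral (B : ℝ → Ω → ℝ) (μ : Measure Ω) (t : ℝ) (ω : Ω) :
    ENNReal.ofReal (spectral B μ t ω) = logNormal B μ t ω := by
  rw [spectral, logNormal, stdDev_sq]

lemma IsCenteredGaussian.maxMean_ne_top {ι : Type*} {U : ι → Ω → ℝ} (hU : IsCenteredGaussian U μ)
    (I : Finset ι) : maxMean U μ I ≠ ∞ := by
  have h : maxMean U μ I ≤ ∑ i ∈ I, ∫⁻ ω, logNormal U μ i ω ∂μ := by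
    rw [← lintegral_finsetSum' _ fun i _ => hU.aemeasurable_logNormal i]
    refine lintegral_mono fun ω => iSup₂_le fun i hi => ?_
    exact Finset.single_le_sum (f := fun i => logNormal U μ i ω) (fun _ _ => zero_le) hi
  simp only [hU.lintegral_logNormal, Finset.sum_const, nsmul_eq_mul, mul_one] at h
  exact ne_top_of_le_ne_top (ENNReal.natCast_ne_top _) h

namespace IsStationaryBrownResnick

lemma isCenteredGaussian (hX : IsStationaryBrownResnick X P B μ) : IsCenteredGaussian B μ :=
  ⟨hX.gaussian, hX.centered⟩

/-- The finite-dimensional distributions of a Brown-Resnick process. -/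
lemma measure_forall_le (hX : IsStationaryBrownResnick X P B μ) (I : Finset ℝ) {x : ℝ}
    (hx : 0 < x) :
    P {ω | ∀ t ∈ I, X t ω ≤ x} =
      ENNReal.ofReal (Real.exp (-(maxMean B μ I / ENNReal.ofReal x).toReal)) := by
  have h : ∫⁻ ω, ⨆ t ∈ I, ENNReal.ofReal (spectral B μ t ω) ∂μ = maxMean B μ I := by
    simp_rw [ofReal_spectral]
    rfl
  rw [← h]
  refine hX.maxStable.measure_forall_le I hx ?_
  rw [h]
  exact hX.isCenteredGaussian.maxMean_ne_top I

end IsStationaryBrownResnick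

/-! ### The variogram of a Brown-Resnick process -/

section

variable {Ω Ω₀ : Type*} [MeasurableSpace Ω] [MeasurableSpace Ω₀]
  {μ : Measure Ω} {P : Measure Ω₀} {B : ℝ → Ω → ℝ} {X : ℝ → Ω₀ → ℝ}

lemma IsCenteredGaussian.ae_eq_zero {ι : Type*} {U : ι → Ω → ℝ} (hU : IsCenteredGaussian U μ)
    {i : ι} (h : Var[U i; μ] = 0) : ∀ᵐ ω ∂μ, U i ω = 0 := by
  have := hU.gaussian.isProbabilityMeasure
  filter_upwards [ae_eq_integral_of_variance_eq_zero (hU.memLp i) h] with ω hω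
  rw [hω, hU.centered]

namespace IsStationaryBrownResnick

lemma hasStationaryVariogram (hX : IsStationaryBrownResnick X P B μ) (h0 : stdDev B μ 0 = 0) :
    HasStationaryVariogram B μ where
  toIsCenteredGaussian := hX.isCenteredGaussian
  variance_increment s t := by
    have hB0 : ∀ᵐ ω ∂μ, B 0 ω = 0 :=
      hX.isCenteredGaussian.ae_eq_zero (by rw [← stdDev_sq, h0]; norm_num)
    have h1 := hX.stationaryIncrements t {s - t}
    have h2 := h1.comp (measurable_pi_apply
      (⟨s - t, Finset.mem_singleton_self _⟩ : ({s - t} : Finset ℝ)))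
    have h3 := h2.variance_eq
    have h4 : Var[fun ω => B (s - t) ω - B 0 ω; μ] = Var[B (s - t); μ] :=
      variance_congr (hB0.mono fun ω hω => by simp [hω])
    rw [stdDev_sq, ← h4]
    convert h3 using 2
    · ext ω
      simp
    · rfl

lemma aemeasurable (hX : IsStationaryBrownResnick X P B μ) (t : ℝ) : AEMeasurable (X t) P := by
  obtain ⟨_, _, Q, p, Y, _, _, hfidi⟩ := hX.maxStable
  exact (measurable_pi_apply (⟨t, Finset.mem_singleton_self _⟩ : ({t} : Finset ℝ))).comp_aemeasurable
    (hfidi {t}).aemeasurable_fst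

/-- Stochastic continuity of `X` at `0`, expressed through the spectral process:
`P (X 0 ≤ 1, X t ≤ 1)` cannot be much smaller than `P (X 0 ≤ y)` for `y < 1`. -/
lemma eventually_maxMean_pair_lt (hX : IsStationaryBrownResnick X P B μ)
    (hcont : IsStochasticallyContinuous X P) {m : ℝ} (hm : 1 < m) :
    ∀ᶠ t in 𝓝 (0 : ℝ), maxMean B μ {0, t} < ENNReal.ofReal m := by
  obtain ⟨y, hmy, hy1⟩ := exists_between (inv_lt_one_of_one_lt₀ hm)
  have hm0 : 0 < m := one_pos.trans hm
  have hy0 : 0 < y := (inv_pos.2 hm0).trans hmy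
  have hlt : Real.exp (-m) < Real.exp (-y⁻¹) := by
    rw [Real.exp_lt_exp, neg_lt_neg_iff]
    exact inv_lt_of_inv_lt₀ hm0 hmy
  have hsingle : P {ω | X 0 ω ≤ y} = ENNReal.ofReal (Real.exp (-y⁻¹)) := by
    have h := hX.measure_forall_le {0} hy0
    have h1 : maxMean B μ {0} = 1 := by
      simp [maxMean, hX.isCenteredGaussian.lintegral_logNormal]
    rw [h1, ENNReal.toReal_div, ENNReal.toReal_ofReal hy0.le, ENNReal.toReal_one, one_div] at h
    simpa using h
  have hη : 0 < ENNReal.ofReal (Real.exp (-y⁻¹)) - ENNReal.ofReal (Real.exp (-m)) := by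
    rw [tsub_pos_iff_lt]
    exact (ENNReal.ofReal_lt_ofReal_iff (Real.exp_pos _)).2 hlt
  have htend := hcont 0 (ENNReal.ofReal (1 - y)) (ENNReal.ofReal_pos.2 (by linarith))
  filter_upwards [htend.eventually (gt_mem_nhds hη)] with t ht
  have hpair := hX.measure_forall_le {0, t} one_pos
  rw [ENNReal.ofReal_one, div_one] at hpair
  have hsub : {ω | X 0 ω ≤ y} ⊆ {ω | ∀ s ∈ ({0, t} : Finset ℝ), X s ω ≤ 1} ∪
      {ω | ENNReal.ofReal (1 - y) ≤ edist (X t ω) (X 0 ω)} := by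
    intro ω hω
    have hω' : X 0 ω ≤ y := hω
    by_cases h : X t ω ≤ 1
    · left
      intro s hs
      rcases Finset.mem_insert.1 hs with rfl | hs
      · exact hω'.trans hy1.le
      · rw [Finset.mem_singleton.1 hs]
        exact h
    · right
      push Not at h
      simp only [mem_ofPred_eq, edist_dist]
      refine ENNReal.ofReal_le_ofReal ?_
      rw [Real.dist_eq]
      exact (by linarith : 1 - y ≤ X t ω - X 0 ω).trans (le_abs_self _)
  have h2 := (measure_mono (μ := P) hsub).trans (measure_union_le _ _)
  rw [hsingle, hpair] at h2
  have h3 : ENNReal.ofReal (Real.exp (-m)) <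
      ENNReal.ofReal (Real.exp (-(maxMean B μ {0, t}).toReal)) := by
    by_contra hcon
    push Not at hcon
    have h4 : ENNReal.ofReal (Real.exp (-y⁻¹)) < ENNReal.ofReal (Real.exp (-m)) +
        (ENNReal.ofReal (Real.exp (-y⁻¹)) - ENNReal.ofReal (Real.exp (-m))) :=
      h2.trans_lt ((add_le_add_left hcon _).trans_lt
        (ENNReal.add_lt_add_left ENNReal.ofReal_ne_top ht))
    rw [add_tsub_cancel_of_le (ENNReal.ofReal_le_ofReal hlt.le)] at h4
    exact lt_irrefl _ h4
  rw [ENNReal.ofReal_lt_ofReal_iff (Real.exp_pos _), Real.exp_lt_exp, neg_lt_neg_iff] at h3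
  exact (ENNReal.lt_ofReal_iff_toReal_lt (hX.isCenteredGaussian.maxMean_ne_top _)).2 h3

end IsStationaryBrownResnick

/-- If the maximum of two log-normal variables of mean one has mean one as well, then the two
variables agree, and the Gaussian variables have a constant difference. -/
lemma IsCenteredGaussian.variance_sub_eq_zero {ι : Type*} [DecidableEq ι] {U : ι → Ω → ℝ}
    (hU : IsCenteredGaussian U μ) {i j : ι} (h : maxMean U μ {i, j} ≤ 1) :
    Var[fun ω => U i ω - U j ω; μ] = 0 := by
  have := hU.gaussian.isProbabilityMeasure
  have hmax : ∀ k ∈ ({i, j} : Finset ι),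
      logNormal U μ k =ᵐ[μ] fun ω => ⨆ k ∈ ({i, j} : Finset ι), logNormal U μ k ω := by
    intro k hk
    refine ae_eq_of_ae_le_of_lintegral_le (Eventually.of_forall fun ω => ?_) ?_
      (hU.aemeasurable_iSup_logNormal _) ?_
    · exact le_iSup₂ (f := fun k (_ : k ∈ ({i, j} : Finset ι)) => logNormal U μ k ω) k hk
    · rw [hU.lintegral_logNormal]
      exact ENNReal.one_ne_top
    · rw [hU.lintegral_logNormal]
      exact h
  have hij := (hmax i (by simp)).trans (hmax j (by simp)).symm
  have hconst : (fun ω => U i ω - U j ω) =ᵐ[μ] fun _ => Var[U i; μ] / 2 - Var[U j; μ] / 2 := by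
    filter_upwards [hij] with ω hω
    rw [logNormal, logNormal, ENNReal.ofReal_eq_ofReal_iff (Real.exp_pos _).le (Real.exp_pos _).le,
      Real.exp_eq_exp] at hω
    linarith
  rw [variance_congr hconst]
  simp [variance_eq_integral]

/-- The standard deviation function of the Gaussian process behind a stochastically continuous
Brown-Resnick process is continuous at `0`: where it is at least `s > 0`, the mean of
`max (Z 0) (Z t)` is bounded away from `1` by comparison with a rescaled process. -/
theorem IsStationaryBrownResnick.tendsto_stdDev (hX : IsStationaryBrownResnick X P B μ)
    (hcont : IsStochasticallyContinuous X P) (hB : HasStationaryVariogram B μ) :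
    Tendsto (stdDev B μ) (𝓝 0) (𝓝 0) := by
  rw [tendsto_order]
  refine ⟨fun s hs => Eventually.of_forall fun t => hs.trans_le (stdDev_nonneg B μ t),
    fun s hs => ?_⟩
  by_cases hex : ∃ t₀, s ≤ stdDev B μ t₀
  swap
  · push Not at hex
    exact Eventually.of_forall hex
  obtain ⟨t₀, ht₀⟩ := hex
  have ht₀pos : 0 < stdDev B μ t₀ := hs.trans_le ht₀
  set c := s / stdDev B μ t₀ with hc
  have hcpos : 0 < c := div_pos hs ht₀pos
  have hW := hB.const_mul c
  -- The rescaled process has standard deviation `s` at `t₀`.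
  set W : ℝ → Ω → ℝ := fun t ω => c * B t ω with hWdef
  have hWt₀ : stdDev W μ t₀ = s := by
    rw [hWdef, stdDev_const_mul, abs_of_pos hcpos, hc, div_mul_cancel₀ _ ht₀pos.ne']
  have hone : 1 < maxMean W μ {0, t₀} := by
    by_contra hcon
    have h1 := hW.toIsCenteredGaussian.variance_sub_eq_zero (not_lt.1 hcon)
    rw [hW.variance_increment, zero_sub, hW.stdDev_neg, hWt₀] at h1
    exact (pow_pos hs 2).ne' h1
  have hWtop := hW.toIsCenteredGaussian.maxMean_ne_top {0, t₀}
  have hone' : 1 < (maxMean W μ {0, t₀}).toReal := by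
    rw [← ENNReal.toReal_one]
    exact (ENNReal.toReal_lt_toReal ENNReal.one_ne_top hWtop).2 hone
  filter_upwards [hX.eventually_maxMean_pair_lt hcont hone'] with t ht
  by_contra hcon
  push Not at hcon
  rw [ENNReal.ofReal_toReal hWtop] at ht
  refine ht.not_ge ?_
  have himg : ∀ r : ℝ, ({0, r} : Finset ℝ) =
      (Finset.univ : Finset Bool).image fun b => bif b then r else 0 := by
    intro r
    ext u
    simp [eq_comm]
    tauto
  rw [himg t₀, himg t, maxMean_image, maxMean_image]
  refine maxMean_le_maxMean (hB.toIsCenteredGaussian.comp _) (hW.toIsCenteredGaussian.comp _) _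
    fun b _ b' _ => ?_
  rw [hB.variance_increment, hW.variance_increment]
  have hst : stdDev W μ t₀ ≤ stdDev B μ t := hWt₀.trans_le hcon
  have h0 : stdDev W μ 0 ≤ stdDev B μ 0 := by
    have hz : ∀ {V : ℝ → Ω → ℝ}, HasStationaryVariogram V μ → stdDev V μ 0 = 0 := fun {V} hV => by
      have h := hV.variance_increment 0 0
      simp only [sub_self] at h
      have h' : Var[fun _ : Ω => (0 : ℝ); μ] = 0 := variance_zero μ
      rw [h'] at h
      exact pow_eq_zero_iff (two_ne_zero) |>.1 h.symm
    rw [hz hB, hz hW]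
  refine pow_le_pow_left₀ (stdDev_nonneg _ _ _) ?_ 2
  rcases b with _ | _ <;> rcases b' with _ | _ <;>
    simp [hB.stdDev_neg, hW.stdDev_neg, h0, hst]

end

/-! ### The distribution of the supremum over a compact set -/

/-- The probability `1 - exp (-m / x)` that a Fréchet variable with scale `m` exceeds `x`. It is
meaningful for finite `m` only. -/
noncomputable def frechetTail (x : ℝ) (m : ℝ≥0∞) : ℝ≥0∞ :=
  1 - ENNReal.ofReal (Real.exp (-(m / ENNReal.ofReal x).toReal))

lemma frechetTail_zero (x : ℝ) : frechetTail x 0 = 0 := by simp [frechetTail]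

lemma frechetTail_mono {x : ℝ} (hx : 0 < x) {m m' : ℝ≥0∞} (h : m ≤ m') (hm' : m' ≠ ∞) :
    frechetTail x m ≤ frechetTail x m' := by
  have : m' / ENNReal.ofReal x ≠ ∞ := ENNReal.div_ne_top hm' (ENNReal.ofReal_pos.2 hx).ne'
  unfold frechetTail
  gcongr

lemma continuousAt_frechetTail {x : ℝ} (hx : 0 < x) {m : ℝ≥0∞} (hm : m ≠ ∞) :
    ContinuousAt (frechetTail x) m := by
  have hx' := (ENNReal.ofReal_pos.2 hx).ne'
  have h1 : Tendsto (fun m => (m / ENNReal.ofReal x).toReal) (𝓝 m)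
      (𝓝 (m / ENNReal.ofReal x).toReal) :=
    (ENNReal.tendsto_toReal (ENNReal.div_ne_top hm hx')).comp
      (ENNReal.Tendsto.div_const tendsto_id (Or.inr hx'))
  exact ENNReal.Tendsto.sub tendsto_const_nhds
    (ENNReal.tendsto_ofReal ((Real.continuous_exp.tendsto _).comp h1.neg))
    (Or.inl ENNReal.one_ne_top)

/-- In a countable set of times, the probability that some event `E t` happens is approximated by
finitely many times. -/
lemma measure_biUnion_le_of_finset {T Ω : Type*} [MeasurableSpace Ω] {P : Measure Ω} {A : Set T}
    (hA : A.Countable) {E : T → Set Ω} {b : ℝ≥0∞}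
    (h : ∀ I : Finset T, (I : Set T) ⊆ A → P (⋃ t ∈ I, E t) ≤ b) : P (⋃ t ∈ A, E t) ≤ b := by
  have := hA.to_subtype
  have hunion : ⋃ t ∈ A, E t = ⋃ J : Finset A, ⋃ t ∈ J, E t := by
    rw [biUnion_eq_iUnion]
    ext ω
    simp only [mem_iUnion]
    exact ⟨fun ⟨t, ht⟩ => ⟨{t}, t, by simp, ht⟩, fun ⟨_, t, _, ht⟩ => ⟨t, ht⟩⟩
  have hdir : Directed (· ⊆ ·) fun J : Finset A => ⋃ t ∈ J, E (t : T) :=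
    directed_of_isDirected_le fun J J' hJ => biUnion_subset_biUnion_left hJ
  rw [hunion, hdir.measure_iUnion]
  refine iSup_le fun J => ?_
  have h1 := h (J.map (Function.Embedding.subtype _)) (by
    intro t ht
    simp only [Finset.coe_map, mem_image] at ht
    obtain ⟨s, _, rfl⟩ := ht
    exact s.2)
  simpa using h1

namespace IsStationaryBrownResnick

variable {Ω Ω₀ : Type*} [MeasurableSpace Ω] [MeasurableSpace Ω₀]
  {μ : Measure Ω} {P : Measure Ω₀} [IsProbabilityMeasure P] {B : ℝ → Ω → ℝ} {X : ℝ → Ω₀ → ℝ}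

lemma measure_iUnion_lt (hX : IsStationaryBrownResnick X P B μ) (I : Finset ℝ) {x : ℝ}
    (hx : 0 < x) : P (⋃ t ∈ I, {ω | x < X t ω}) = frechetTail x (maxMean B μ I) := by
  have hcompl : ⋃ t ∈ I, {ω | x < X t ω} = {ω | ∀ t ∈ I, X t ω ≤ x}ᶜ := by
    ext ω
    simp
  have hnull : NullMeasurableSet {ω | ∀ t ∈ I, X t ω ≤ x} P := by
    have : {ω | ∀ t ∈ I, X t ω ≤ x} = ⋂ t ∈ I, {ω | X t ω ≤ x} := by
      ext ω
      simp
    rw [this]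
    exact Finset.nullMeasurableSet_biInter I fun t _ =>
      nullMeasurableSet_le (hX.aemeasurable t) aemeasurable_const
  rw [hcompl, prob_compl_eq_one_sub₀ hnull, hX.measure_forall_le I hx, frechetTail]

lemma frechetTail_le_measure (hX : IsStationaryBrownResnick X P B μ) {K : Set ℝ}
    (hfin : supMean B μ K ≠ ∞) {x : ℝ} (hx : 0 < x) :
    frechetTail x (supMean B μ K) ≤ P {ω | (x : EReal) < ⨆ t ∈ K, (X t ω : EReal)} := by
  rcases eq_or_ne (supMean B μ K) 0 with h0 | h0
  · rw [h0, frechetTail_zero]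
    exact zero_le
  have : (𝓝[<] supMean B μ K).NeBot := nhdsLT_neBot_of_exists_lt ⟨0, pos_iff_ne_zero.2 h0⟩
  refine le_of_tendsto ((continuousAt_frechetTail hx hfin).tendsto.mono_left
    (nhdsWithin_le_nhds (s := Iio (supMean B μ K)))) ?_
  filter_upwards [self_mem_nhdsWithin] with m hm
  obtain ⟨I, hI, hmI⟩ : ∃ I : Finset ℝ, ∃ _ : (I : Set ℝ) ⊆ K, m < maxMean B μ I := by
    simpa only [supMean, mem_Iio, lt_iSup_iff] using hm
  refine (frechetTail_mono hx hmI.le (hX.isCenteredGaussian.maxMean_ne_top I)).trans ?_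
  rw [← hX.measure_iUnion_lt I hx]
  refine measure_mono (iUnion₂_subset fun t ht ω hω => ?_)
  exact (EReal.coe_lt_coe_iff.2 hω).trans_le
    (le_iSup₂ (f := fun t (_ : t ∈ K) => (X t ω : EReal)) t (hI ht))

/-- Separability bounds the supremum over `K` by suprema over countable subsets of any
neighbourhood of `K`. -/
lemma measure_le_frechetTail_sumset (hX : IsStationaryBrownResnick X P B μ)
    (hsep : IsSeparable X P) {K : Set ℝ} {ε : ℝ} (hε : 0 < ε)
    (hfin : supMean B μ ((fun k : ℝ × ℝ => k.1 + k.2) '' (K ×ˢ Icc (-ε) ε)) ≠ ∞)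
    {x : ℝ} (hx : 0 < x) :
    P {ω | (x : EReal) < ⨆ t ∈ K, (X t ω : EReal)} ≤
      frechetTail x (supMean B μ ((fun k : ℝ × ℝ => k.1 + k.2) '' (K ×ˢ Icc (-ε) ε))) := by
  set S := (fun k : ℝ × ℝ => k.1 + k.2) '' (K ×ˢ Icc (-ε) ε) with hS
  obtain ⟨D, hD, -, hae⟩ := hsep
  have hsub : {ω | (x : EReal) < ⨆ t ∈ K, (X t ω : EReal)} ≤ᵐ[P]
      ⋃ t ∈ D ∩ S, {ω | x < X t ω} := by
    filter_upwards [hae] with ω hω hlt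
    have hlt' : (x : EReal) < ⨆ t ∈ K, (X t ω : EReal) := hlt
    simp only [lt_iSup_iff, EReal.coe_lt_coe_iff] at hlt'
    obtain ⟨t, htK, htx⟩ := hlt'
    obtain ⟨_, ⟨hs1, hs2⟩, s, hsD, rfl⟩ := mem_closure_iff.1 (hω t) (Ioo (t - ε) (t + ε) ×ˢ Ioi x)
      (isOpen_Ioo.prod isOpen_Ioi) ⟨⟨by simp [hε], by simp [hε]⟩, htx⟩
    have hsS : s ∈ S := ⟨(t, s - t), ⟨htK, by linarith [hs1.1], by linarith [hs1.2]⟩, by simp⟩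
    exact mem_biUnion (show s ∈ D ∩ S from ⟨hsD, hsS⟩) hs2
  refine (measure_mono_ae hsub).trans
    (measure_biUnion_le_of_finset (hD.mono inter_subset_left) fun I hI => ?_)
  rw [hX.measure_iUnion_lt I hx]
  exact frechetTail_mono hx (maxMean_le_supMean (hI.trans inter_subset_right)) hfin

/-- The supremum over a compact set `K` of a Brown-Resnick process has the Fréchet law with scale
`E[sup_K Z]`. -/
theorem measure_lt_iSup_eq (hX : IsStationaryBrownResnick X P B μ)
    (hB : HasStationaryVariogram B μ) (hcont : Tendsto (stdDev B μ) (𝓝 0) (𝓝 0))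
    (hfin : ∀ c R : ℝ, supMean (fun t ω => c * B t ω) μ (Icc (-R) R) ≠ ∞)
    (hsep : IsSeparable X P) {K : Set ℝ} (hK : IsCompact K) {x : ℝ} (hx : 0 < x) :
    P {ω | (x : EReal) < ⨆ t ∈ K, (X t ω : EReal)} = frechetTail x (supMean B μ K) := by
  obtain ⟨R, hR⟩ : ∃ R : ℝ, K ⊆ Icc (-R) R := by
    obtain ⟨R, hR⟩ := hK.isBounded.subset_closedBall 0
    exact ⟨R, hR.trans (by rw [Real.closedBall_eq_Icc, zero_sub, zero_add])⟩
  have hfin1 : ∀ R : ℝ, supMean B μ (Icc (-R) R) ≠ ∞ := fun R => by simpa using hfin 1 R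
  have hKfin : supMean B μ K ≠ ∞ := ne_top_of_le_ne_top (hfin1 R) (supMean_mono hR)
  refine le_antisymm ?_ (hX.frechetTail_le_measure hKfin hx)
  have : (𝓝[>] supMean B μ K).NeBot :=
    nhdsGT_neBot_of_exists_gt ⟨∞, lt_top_iff_ne_top.2 hKfin⟩
  refine ge_of_tendsto ((continuousAt_frechetTail hx hKfin).tendsto.mono_left
    (nhdsWithin_le_nhds (s := Ioi (supMean B μ K)))) ?_
  have hlt : ∀ᶠ m in 𝓝[>] supMean B μ K, m < ∞ :=
    nhdsWithin_le_nhds (gt_mem_nhds (lt_top_iff_ne_top.2 hKfin))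
  filter_upwards [self_mem_nhdsWithin, hlt] with m hm hmtop
  have hinf := (hB.iInf_supMean_sumset_le hcont hfin hR).trans_lt hm
  simp only [iInf_lt_iff] at hinf
  obtain ⟨ε, hε, hεm⟩ := hinf
  exact (hX.measure_le_frechetTail_sumset hsep hε (hεm.trans hmtop).ne hx).trans
    (frechetTail_mono hx hεm.le hmtop.ne)

end IsStationaryBrownResnick

/-! ### Pickands constants -/

namespace HasStationaryVariogram

variable {Ω : Type*} [MeasurableSpace Ω] {μ : Measure Ω} {B : ℝ → Ω → ℝ}

lemma supMean_add_image (hB : HasStationaryVariogram B μ) (h : ℝ) (A : Set ℝ) :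
    supMean B μ ((· + h) '' A) = supMean B μ A := by
  have hvar : ∀ s t, Var[fun ω => B (s + h) ω - B (t + h) ω; μ] =
      Var[fun ω => B s ω - B t ω; μ] := fun s t => by
    rw [hB.variance_increment, hB.variance_increment, add_sub_add_right_eq_sub]
  rw [supMean_image]
  exact le_antisymm
    (supMean_le_supMean hB.toIsCenteredGaussian (hB.toIsCenteredGaussian.comp _) A
      fun s _ t _ => (hvar s t).le)
    (supMean_le_supMean (hB.toIsCenteredGaussian.comp _) hB.toIsCenteredGaussian A
      fun s _ t _ => (hvar s t).ge)

lemma supMean_Icc_add_le (hB : HasStationaryVariogram B μ) {S T : ℝ} :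
    supMean B μ (Icc 0 (S + T)) ≤ supMean B μ (Icc 0 S) + supMean B μ (Icc 0 T) := by
  have hsub : Icc 0 (S + T) ⊆ Icc 0 S ∪ (· + S) '' Icc 0 T := by
    rw [image_add_const_Icc, zero_add, add_comm T S]
    exact Icc_subset_Icc_union_Icc
  refine (supMean_mono hsub).trans ((supMean_union_le hB.toIsCenteredGaussian _ _).trans ?_)
  rw [hB.supMean_add_image]

/-- Fekete's lemma for the mean suprema over the intervals `[0, T]`. -/
theorem exists_tendsto_supMean_div (hB : HasStationaryVariogram B μ)
    (hfin : ∀ T : ℝ, supMean B μ (Icc 0 T) ≠ ∞) :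
    ∃ H : ℝ≥0, Tendsto (fun T : ℝ => supMean B μ (Icc 0 T) / ENNReal.ofReal T) atTop
      (𝓝 (H : ℝ≥0∞)) := by
  set u : ℝ → ℝ := fun T => (supMean B μ (Icc 0 T)).toReal with hu
  have humono : Monotone u := fun S T h =>
    ENNReal.toReal_mono (hfin T) (supMean_mono (Icc_subset_Icc_right h))
  have hu0 : ∀ T, 0 ≤ u T := fun T => ENNReal.toReal_nonneg
  have hsub : Subadditive fun n : ℕ => u n := fun m n => by
    simp only [hu, Nat.cast_add]
    rw [← ENNReal.toReal_add (hfin _) (hfin _)]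
    exact ENNReal.toReal_mono (ENNReal.add_ne_top.2 ⟨hfin _, hfin _⟩) hB.supMean_Icc_add_le
  have hlim := hsub.tendsto_lim ⟨0, by
    rintro _ ⟨n, rfl⟩
    exact div_nonneg (hu0 _) n.cast_nonneg⟩
  have hL0 : 0 ≤ hsub.lim := ge_of_tendsto' hlim fun n => div_nonneg (hu0 _) n.cast_nonneg
  refine ⟨hsub.lim.toNNReal, ?_⟩
  have hreal : Tendsto (fun T : ℝ => u T / T) atTop (𝓝 hsub.lim) := by
    have hfloor : Tendsto (fun T : ℝ => u ⌊T⌋₊ / ⌊T⌋₊ * (⌊T⌋₊ / T)) atTop (𝓝 (hsub.lim * 1)) :=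
      (hlim.comp tendsto_nat_floor_atTop).mul tendsto_nat_floor_div_atTop
    have hceil : Tendsto (fun T : ℝ => u ⌈T⌉₊ / ⌈T⌉₊ * (⌈T⌉₊ / T)) atTop (𝓝 (hsub.lim * 1)) :=
      (hlim.comp tendsto_nat_ceil_atTop).mul tendsto_nat_ceil_div_atTop
    rw [mul_one] at hfloor hceil
    refine tendsto_of_tendsto_of_tendsto_of_le_of_le' hfloor hceil ?_ ?_
    · filter_upwards [eventually_ge_atTop 1] with T hT
      have : (0 : ℝ) < ⌊T⌋₊ := by exact_mod_cast Nat.floor_pos.2 hT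
      rw [div_mul_div_cancel₀ this.ne']
      have h := humono (Nat.floor_le (zero_le_one.trans hT))
      gcongr
    · filter_upwards [eventually_gt_atTop 0] with T hT
      have : (0 : ℝ) < ⌈T⌉₊ := by exact_mod_cast Nat.ceil_pos.2 hT
      rw [div_mul_div_cancel₀ this.ne']
      have h := humono (Nat.le_ceil T)
      gcongr
  refine (ENNReal.tendsto_ofReal hreal).congr' ?_
  filter_upwards [eventually_gt_atTop 0] with T hT
  rw [ENNReal.ofReal_div_of_pos hT, hu, ENNReal.ofReal_toReal (hfin T)]

/-- For a separable spectral process, `supMean` over an interval is the mean of the supremum. -/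
theorem lintegral_iSup_Icc (hB : HasStationaryVariogram B μ)
    (hsep : IsSeparable (spectral B μ) μ) {T : ℝ} (hT : 0 ≤ T) :
    ∫⁻ ω, ⨆ t ∈ Icc 0 T, ENNReal.ofReal (spectral B μ t ω) ∂μ = supMean B μ (Icc 0 T) := by
  refine le_antisymm ?_ (supMean_le_iff.2 fun I hI => lintegral_mono fun ω => ?_)
  swap
  · refine iSup₂_le fun t ht => ?_
    rw [← ofReal_spectral]
    exact le_iSup₂ (f := fun t (_ : t ∈ Icc 0 T) => ENNReal.ofReal (spectral B μ t ω)) t (hI ht)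
  obtain ⟨D, hD, -, hae⟩ := hsep
  -- The end points may be isolated from the points of `D` inside the interval.
  set A : Set ℝ := D ∩ Ioo 0 T ∪ {0, T} with hA
  have hAc : A.Countable := (hD.mono inter_subset_left).union (by simp)
  have hAsub : A ⊆ Icc 0 T := by
    refine union_subset (inter_subset_right.trans Ioo_subset_Icc_self) ?_
    rintro t (rfl | rfl)
    · exact left_mem_Icc.2 hT
    · exact right_mem_Icc.2 hT
  have := hAc.to_subtype
  have hle : ∀ᵐ ω ∂μ, ⨆ t ∈ Icc 0 T, ENNReal.ofReal (spectral B μ t ω) ≤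
      ⨆ J : Finset A, ⨆ s ∈ J, logNormal B μ s ω := by
    filter_upwards [hae] with ω hω
    rw [← iSup_eq_iSup_finset (fun s : A => logNormal B μ s ω)]
    refine iSup₂_le fun t ht => ?_
    rcases eq_or_ne t 0 with rfl | h0
    · rw [ofReal_spectral]
      exact le_iSup (fun s : A => logNormal B μ s ω) ⟨0, by simp [hA]⟩
    rcases eq_or_ne t T with rfl | h1
    · rw [ofReal_spectral]
      exact le_iSup (fun s : A => logNormal B μ s ω) ⟨t, by simp [hA]⟩
    have htI : t ∈ Ioo 0 T := ⟨lt_of_le_of_ne ht.1 h0.symm, lt_of_le_of_ne ht.2 h1⟩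
    refine le_of_forall_lt fun c hc => ?_
    obtain ⟨_, ⟨hs1, hs2⟩, s, hsD, rfl⟩ := mem_closure_iff.1 (hω t)
      (Ioo 0 T ×ˢ (ENNReal.ofReal ⁻¹' Ioi c))
      (isOpen_Ioo.prod (isOpen_Ioi.preimage ENNReal.continuous_ofReal)) ⟨htI, hc⟩
    refine lt_of_lt_of_le (show c < ENNReal.ofReal (spectral B μ s ω) from hs2) ?_
    rw [ofReal_spectral]
    exact le_iSup (fun s : A => logNormal B μ s ω) ⟨s, Or.inl ⟨hsD, hs1⟩⟩
  refine (lintegral_mono_ae hle).trans ?_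
  rw [lintegral_iSup_directed]
  · refine iSup_le fun J => ?_
    have h1 : maxMean B μ (J.map (Function.Embedding.subtype _)) ≤ supMean B μ (Icc 0 T) :=
      maxMean_le_supMean fun t ht => by
        simp only [Finset.coe_map, mem_image] at ht
        obtain ⟨s, _, rfl⟩ := ht
        exact hAsub s.2
    refine le_trans (lintegral_mono fun ω => ?_) h1
    refine iSup₂_le fun s hs => ?_
    exact le_iSup₂ (f := fun t (_ : t ∈ J.map (Function.Embedding.subtype _)) =>
      logNormal B μ t ω) (s : ℝ) (Finset.mem_map_of_mem _ hs)
  · exact fun J => (hB.toIsCenteredGaussian.comp (fun s : A => (s : ℝ))).aemeasurable_iSup_logNormal J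
  · exact directed_of_isDirected_le fun J J' hJ ω => biSup_mono fun s hs =>
      Finset.mem_of_subset hJ hs

end HasStationaryVariogram

/-! ### The comparison of Brown-Resnick processes -/

lemma HasStationaryVariogram.supMean_le_of_stdDev_le {Ω Ω' : Type*} [MeasurableSpace Ω]
    [MeasurableSpace Ω'] {μ : Measure Ω} {ν : Measure Ω'} {B : ℝ → Ω → ℝ} {B' : ℝ → Ω' → ℝ}
    (hB : HasStationaryVariogram B μ) (hB' : HasStationaryVariogram B' ν)
    (h : ∀ t, stdDev B' ν t ≤ stdDev B μ t) (A : Set ℝ) : supMean B' ν A ≤ supMean B μ A :=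
  supMean_le_supMean hB.toIsCenteredGaussian hB'.toIsCenteredGaussian A fun s _ t _ => by
    rw [hB.variance_increment, hB'.variance_increment]
    exact pow_le_pow_left₀ (stdDev_nonneg _ _ _) (h _) 2

lemma HasStationaryVariogram.exists_hasPickandsConstant {Ω : Type*} [MeasurableSpace Ω]
    {μ : Measure Ω} {B : ℝ → Ω → ℝ} (hB : HasStationaryVariogram B μ)
    (hfin : ∀ T : ℝ, supMean B μ (Icc 0 T) ≠ ∞) (hsep : IsSeparable (spectral B μ) μ) :
    ∃ H : ℝ≥0, HasPickandsConstant (spectral B μ) μ H := by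
  obtain ⟨H, hH⟩ := hB.exists_tendsto_supMean_div hfin
  refine ⟨H, hH.congr' ?_⟩
  filter_upwards [eventually_ge_atTop 0] with T hT
  rw [hB.lintegral_iSup_Icc hsep hT]

end BrownResnick

theorem theorem3p1
    {Ω₁ Ω₂ Ω₁' Ω₂' : Type*}
    [MeasurableSpace Ω₁] [MeasurableSpace Ω₂] [MeasurableSpace Ω₁'] [MeasurableSpace Ω₂']
    (μ₁ : Measure Ω₁) (μ₂ : Measure Ω₂) (P₁ : Measure Ω₁') (P₂ : Measure Ω₂')
    [IsProbabilityMeasure μ₁] [IsProbabilityMeasure μ₂]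
    [IsProbabilityMeasure P₁] [IsProbabilityMeasure P₂]
    (B₁ : ℝ → Ω₁ → ℝ) (B₂ : ℝ → Ω₂ → ℝ) (X₁ : ℝ → Ω₁' → ℝ) (X₂ : ℝ → Ω₂' → ℝ)
    (hX₁ : BrownResnick.IsStationaryBrownResnick X₁ P₁ B₁ μ₁)
    (hX₂ : BrownResnick.IsStationaryBrownResnick X₂ P₂ B₂ μ₂)
    (hXcont₁ : BrownResnick.IsStochasticallyContinuous X₁ P₁)
    (hXcont₂ : BrownResnick.IsStochasticallyContinuous X₂ P₂)
    (hXsep₁ : BrownResnick.IsSeparable X₁ P₁)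
    (hXsep₂ : BrownResnick.IsSeparable X₂ P₂)
    (hσ₁ : BrownResnick.stdDev B₁ μ₁ 0 = 0)
    (hσ₂ : BrownResnick.stdDev B₂ μ₂ 0 = 0)
    (hZsep₁ : BrownResnick.IsSeparable (BrownResnick.spectral B₁ μ₁) μ₁)
    (hZsep₂ : BrownResnick.IsSeparable (BrownResnick.spectral B₂ μ₂) μ₂)
    (hZbdd₁ : BrownResnick.HasLocallyBoundedPaths (BrownResnick.spectral B₁ μ₁) μ₁)
    (hZbdd₂ : BrownResnick.HasLocallyBoundedPaths (BrownResnick.spectral B₂ μ₂) μ₂)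
    (hσ : ∀ t : ℝ, BrownResnick.stdDev B₂ μ₂ t ≤ BrownResnick.stdDev B₁ μ₁ t) :
    (∀ K : Set ℝ, IsCompact K → ∀ x : ℝ, 0 < x →
      P₂ {ω | (x : EReal) < ⨆ t ∈ K, (X₂ t ω : EReal)} ≤
        P₁ {ω | (x : EReal) < ⨆ t ∈ K, (X₁ t ω : EReal)}) ∧
    ∃ H₁ H₂ : ℝ≥0,
      BrownResnick.HasPickandsConstant (BrownResnick.spectral B₁ μ₁) μ₁ H₁ ∧
      BrownResnick.HasPickandsConstant (BrownResnick.spectral B₂ μ₂) μ₂ H₂ ∧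
      H₂ ≤ H₁ := by
  have hB₁ := hX₁.hasStationaryVariogram hσ₁
  have hB₂ := hX₂.hasStationaryVariogram hσ₂
  have hc₁ := hX₁.tendsto_stdDev hXcont₁ hB₁
  have hc₂ := hX₂.tendsto_stdDev hXcont₂ hB₂
  have hfin₁ := BrownResnick.supMean_Icc_ne_top hB₁ hc₁ hZbdd₁
  have hfin₂ := BrownResnick.supMean_Icc_ne_top hB₂ hc₂ hZbdd₂
  have hR₁ : ∀ R : ℝ, BrownResnick.supMean B₁ μ₁ (Icc (-R) R) ≠ ∞ := fun R => by simpa using hfin₁ 1 R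
  have hR₂ : ∀ R : ℝ, BrownResnick.supMean B₂ μ₂ (Icc (-R) R) ≠ ∞ := fun R => by simpa using hfin₂ 1 R
  have hIcc : ∀ T : ℝ, Icc 0 T ⊆ Icc (-T) T := fun T t ht => ⟨by linarith [ht.1, ht.2], ht.2⟩
  have hle := hB₁.supMean_le_of_stdDev_le hB₂ hσ
  refine ⟨fun K hK x hx => ?_, ?_⟩
  · rw [hX₁.measure_lt_iSup_eq hB₁ hc₁ hfin₁ hXsep₁ hK hx,
      hX₂.measure_lt_iSup_eq hB₂ hc₂ hfin₂ hXsep₂ hK hx]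
    obtain ⟨R, hR⟩ := hK.isBounded.subset_closedBall 0
    rw [Real.closedBall_eq_Icc, zero_sub, zero_add] at hR
    exact BrownResnick.frechetTail_mono hx (hle K) (ne_top_of_le_ne_top (hR₁ R) (BrownResnick.supMean_mono hR))
  · obtain ⟨H₁, hH₁⟩ := hB₁.exists_hasPickandsConstant
      (fun T => ne_top_of_le_ne_top (hR₁ T) (BrownResnick.supMean_mono (hIcc T))) hZsep₁
    obtain ⟨H₂, hH₂⟩ := hB₂.exists_hasPickandsConstant
      (fun T => ne_top_of_le_ne_top (hR₂ T) (BrownResnick.supMean_mono (hIcc T))) hZsep₂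
    refine ⟨H₁, H₂, hH₁, hH₂, ENNReal.coe_le_coe.1 (le_of_tendsto_of_tendsto hH₂ hH₁ ?_)⟩
    filter_upwards [eventually_ge_atTop 0] with T hT
    rw [hB₁.lintegral_iSup_Icc hZsep₁ hT, hB₂.lintegral_iSup_Icc hZsep₂ hT]
    exact ENNReal.div_le_div_right (hle _) _
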